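/- **Theorem (Stone duality for ample inverse semigroupoids).** *Ample inverse semigroupoids.* A graphed semigroupoid $\mathcal S$ consists of a set of vertices $\mathcal S^{(0)}$, a set of arrows (also denoted $\mathcal S$), source and range maps $\mathbf s,\mathbf r\colon\mathcal S\to\mathcal S^{(0)}$ with $\mathcal S^{(0)}=\mathbf s(\mathcal S)\cup\mathbf r(\mathcal S)$, and an associative product $ab$, defined exactly when $\mathbf s(a)=\mathbf r(b)$, with $\mathbf s(ab)=\mathbf s(b)$ and $\mathbf r(ab)=\mathbf r(a)$. It is an inverse semigroupoid if every arrow $a$ has a unique inverse $a^*$, i.e. $aa^*$ and $a^*a$ are defined, $aa^*a=a$ and $a^*aa^*=a^*$. It is topological if arrows and vertices carry topologies for which source, range, product and inversion are continuous, and ample if moreover $\mathbf s$ is a local homeomorphism and $\mathcal S^{(0)}$ is locally compact, Hausdorff and zero-dimensional (has a basis of clopen sets). A bisection is a set of arrows on which $\mathbf s$ and $\mathbf r$ are injective; $\mathbf{KB}(\mathcal S)$ is the set of compact-open bisections, with the product $AB=\{ab: a\in A,\ b\in B,\ ab\text{ defined}\}$. Let $\mathbf{Amp}_\star$ be the category of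 ample inverse semigroupoids whose morphisms are the homomorphisms $\phi\colon\mathcal S\to\mathcal T$ (if $ab$ is defined, then so is $\phi(a)\phi(b)$, and it equals $\phi(ab)$) that are continuous, proper (preimages of compact sets are compact), star-injective ($\mathbf s(a)=\mathbf s(b)$ and $\phi(a)=\phi(b)$ imply $a=b$) and star-surjective (if $\mathbf s(t)=\mathbf s(\phi(a))$, there is $b$ with $\mathbf s(b)=\mathbf s(a)$ and $\phi(b)=t$). *$\Sigma$-ordered inverse semigroups.* In an inverse semigroup, $a\le b$ means $a=ba^*a$, and $E(S)$ is the set of idempotents. A $\Sigma$-ordered inverse semigroup is an inverse semigroup $S$ with zero together with a partial order $\subseteq$ (joins and meets for $\subseteq$ are written $\cup$, $\cap$) such that: $a\subseteq b$ implies $a\le b$, $ax\subseteq bx$ and $ya\subseteq yb$ for all $x,y\in S$; $0\subseteq a$ for all $a$; if $a_1,a_2\subseteq c$ then $a_1\cup a_2$ exists; if $c_1\cup c_2$ exists then $a(c_1\cup c_2)=ac_1\cup ac_2$ for all $a$; if $e\subseteq f$ in $E(S)$ there is $c\in E(S)$ with $e\cup c=f$ and $e\cap c=0$; if $a^*b=ab^*=0$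 then $a\cup b$ exists; and if $t\le a$ there is $z$ with $t\le z\subseteq a$ such that $tx=0\iff zx=0$ for all $x\in S$. For $t\le a$ the interpolator $a|t$ is the unique $p$ with $t\le p\subseteq a$, $tx=0\iff px=0$ and $xt=0\iff xp=0$ for all $x\in S$. Let $\Sigma\text{-}\mathbf{Ord}$ be the category of $\Sigma$-ordered inverse semigroups whose morphisms are the semigroup homomorphisms $\theta\colon S\to T$ such that: $\theta(0)=0$; $a\subseteq b$ implies $\theta(a)\subseteq\theta(b)$; if $a\cup b$ exists, then $\theta(a)\cup\theta(b)$ exists and equals $\theta(a\cup b)$; if $t\subseteq\theta(a),\theta(b)$, there is $c\subseteq a,b$ with $t\subseteq\theta(c)$; every $t\in T$ is a join $t=\bigcup_{i=1}^n t_i$ with $t_i\subseteq\theta(s_i)$ for some $s_i\in S$; and $\theta(b|a)=\theta(b)|\theta(a)$ whenever $a\le b$. *Germs.* For a $\Sigma$-ordered inverse semigroup $S$, let $\Omega(E(S))$ be the space of ultrafilters (maximal proper filters) of $(E(S),\le)$, with the topology generated by the sets $X[e]=\{\mathfrak F: e\in\mathfrak F\}$, $e\in E(S)$. For $a\in S$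 and $\mathfrak F\in X[a^*a]$ put $\widehat\mu_a(\mathfrak F)=\{u\in E(S): u\ge aea^*\text{ for some }e\in\mathfrak F\text{ with }e\le a^*a\}$ (the action on the spectrum dual to the Munn action). On $\{(a,\mathfrak F): a^*a\in\mathfrak F\}\subseteq S\times\Omega(E(S))$, $S$ being discrete, let $(a,\mathfrak F)\sim(b,\mathfrak F)$ if there is $z\subseteq a,b$ with $z^*z\in\mathfrak F$, and let $[a,\mathfrak F]$ be the class (germ) of $(a,\mathfrak F)$. **Claim.** The categories $\mathbf{Amp}_\star$ and $\Sigma\text{-}\mathbf{Ord}$ are dually equivalent: there is an equivalence $\mathbf{Amp}_\star^{\mathrm{op}}\simeq\Sigma\text{-}\mathbf{Ord}$ given (up to canonical isomorphism) by the following functors. * $\mathbb K\colon\mathbf{Amp}_\star^{\mathrm{op}}\to\Sigma\text{-}\mathbf{Ord}$, $\mathbb K(\mathcal S)=(\mathbf{KB}(\mathcal S),\subseteq)$ with the product of sets and set inclusion, and $\mathbb K(\phi)(A)=\phi^{-1}(A)$. * $\mathbb P\colon\Sigma\text{-}\mathbf{Ord}^{\mathrm{op}}\to\mathbf{Amp}_\star$,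 where $\mathbb P(S,\subseteq)$ has vertex space $\Omega(E(S))$ and as arrows the germs $[a,\mathfrak F]$, with the quotient topology, source $\mathfrak F$, range $\widehat\mu_a(\mathfrak F)$ and product $[a,\widehat\mu_b(\mathfrak F)]\,[b,\mathfrak F]=[ab,\mathfrak F]$. For a morphism $\theta\colon S\to T$, the homomorphism $\mathbb P(\theta)\colon\mathbb P(T)\to\mathbb P(S)$ sends $[t,\mathfrak F]$ to $[s,\mathfrak G]$, where $\mathfrak G=\{e\in E(S): ef\ne0\text{ for all }f\in E(S)\text{ with }\theta(f)\in\mathfrak F\}$ and $s\in S$ is any element with $[\theta(s),\mathfrak F]=[t,\mathfrak F]$ (such $s$ exists, and the result does not depend on its choice). -/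

import Mathlib

open CategoryTheory Opposite

universe u

/-! ### Inverse semigroupoids -/

/-- A graphed semigroupoid: a graph with a partial associative product `a b`, defined exactly when
the source of `a` is the range of `b`. Every vertex is the source or the range of some arrow. -/
structure GraphedSemigroupoid : Type (u + 1) where
  Vert : Type u
  Arr : Type u
  src : Arr → Vert
  rng : Arr → Vert
  mul : (a b : Arr) → src a = rng b → Arr
  src_mul : ∀ (a b : Arr) (h : src a = rng b), src (mul a b h) = src b
  rng_mul : ∀ (a b : Arr) (h : src a = rng b), rng (mul a b h) = rng a
  mul_assoc : ∀ (a b c : Arr) (h : src a = rng b) (k : src b = rng c),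
    mul (mul a b h) c ((src_mul a b h).trans k) = mul a (mul b c k) (h.trans (rng_mul b c k).symm)
  vert_eq : ∀ v : Vert, (∃ a, src a = v) ∨ (∃ a, rng a = v)

namespace GraphedSemigroupoid

/-- `b` is an inverse of `a`: `ab` and `ba` are defined, `aba = a` and `bab = b`. -/
def IsInverse (S : GraphedSemigroupoid.{u}) (a b : S.Arr) : Prop :=
  ∃ (h : S.src a = S.rng b) (k : S.src b = S.rng a),
    S.mul (S.mul a b h) a ((S.src_mul a b h).trans k) = a ∧
    S.mul (S.mul b a k) b ((S.src_mul b a k).trans h) = b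

/-- The product of two sets of arrows: all the products that are defined. -/
def setMul (S : GraphedSemigroupoid.{u}) (A B : Set S.Arr) : Set S.Arr :=
  {c | ∃ a ∈ A, ∃ b ∈ B, ∃ h : S.src a = S.rng b, S.mul a b h = c}

/-- A bisection: a set of arrows on which source and range are injective. -/
def IsBisection (S : GraphedSemigroupoid.{u}) (A : Set S.Arr) : Prop :=
  Set.InjOn S.src A ∧ Set.InjOn S.rng A

end GraphedSemigroupoid

/-- An inverse semigroupoid: every arrow has exactly one inverse. -/
structure InverseSemigroupoid : Type (u + 1) extends GraphedSemigroupoid.{u} where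
  existsUnique_inverse : ∀ a : Arr, ∃! b : Arr, toGraphedSemigroupoid.IsInverse a b

/-- The inverse `a*` of an arrow. -/
noncomputable def InverseSemigroupoid.star (S : InverseSemigroupoid.{u}) (a : S.Arr) : S.Arr :=
  (S.existsUnique_inverse a).choose

/-- A topological inverse semigroupoid: arrows and vertices carry topologies such that source,
range, product and inversion are continuous. -/
structure TopInverseSemigroupoid : Type (u + 1) extends InverseSemigroupoid.{u} where
  [topVert : TopologicalSpace Vert]
  [topArr : TopologicalSpace Arr]
  continuous_src : Continuous src
  continuous_rng : Continuous rng
  continuous_mul : Continuous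
    (fun p : {p : Arr × Arr // src p.1 = rng p.2} => mul p.1.1 p.1.2 p.2)
  continuous_star : Continuous toInverseSemigroupoid.star

attribute [instance] TopInverseSemigroupoid.topVert TopInverseSemigroupoid.topArr

/-- An ample inverse semigroupoid: étale (the source map is a local homeomorphism), with locally
compact, Hausdorff, zero-dimensional vertex space. These are the objects of `Amp_⋆`. -/
structure AmpStar : Type (u + 1) extends TopInverseSemigroupoid.{u} where
  etale : IsLocalHomeomorph src
  locallyCompact : LocallyCompactSpace Vert
  hausdorff : T2Space Vert
  zeroDimensional : TopologicalSpace.IsTopologicalBasis {U : Set Vert | IsClopen U}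

namespace AmpStar

/-- A morphism of `Amp_⋆`: a continuous, proper, star-injective and star-surjective
homomorphism. Arrow spaces may be non-Hausdorff; proper means that preimages of compact sets are
compact. -/
@[ext]
structure Hom (S T : AmpStar.{u}) where
  toFun : S.Arr → T.Arr
  composable : ∀ a b : S.Arr, S.src a = S.rng b → T.src (toFun a) = T.rng (toFun b)
  map_mul : ∀ (a b : S.Arr) (h : S.src a = S.rng b),
    toFun (S.mul a b h) = T.mul (toFun a) (toFun b) (composable a b h)
  continuous : Continuous toFun
  proper : ∀ C : Set T.Arr, IsCompact C → IsCompact (toFun ⁻¹' C)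
  starInjective : ∀ a b : S.Arr, S.src a = S.src b → toFun a = toFun b → a = b
  starSurjective : ∀ (t : T.Arr) (a : S.Arr), T.src t = T.src (toFun a) →
    ∃ b : S.Arr, S.src b = S.src a ∧ toFun b = t

/-- A homomorphism sends arrows with the same source to arrows with the same source. -/
theorem Hom.src_eq {S T : AmpStar.{u}} (f : Hom S T) {a b : S.Arr} (h : S.src a = S.src b) :
    T.src (f.toFun a) = T.src (f.toFun b) := by
  obtain ⟨z, ⟨hz, -⟩, -⟩ := S.existsUnique_inverse a
  exact (f.composable a z hz).trans (f.composable b z (h.symm.trans hz)).symm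

/-- The identity homomorphism. -/
def Hom.id (S : AmpStar.{u}) : Hom S S where
  toFun := fun a => a
  composable := fun _ _ h => h
  map_mul := fun _ _ _ => rfl
  continuous := continuous_id
  proper := fun _ h => h
  starInjective := fun _ _ _ h => h
  starSurjective := fun t _ h => ⟨t, h, rfl⟩

/-- The composition of two homomorphisms. -/
def Hom.comp {S T U : AmpStar.{u}} (f : Hom S T) (g : Hom T U) : Hom S U where
  toFun := fun a => g.toFun (f.toFun a)
  composable := fun a b h => g.composable _ _ (f.composable a b h)
  map_mul := fun a b h => by rw [f.map_mul, g.map_mul]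
  continuous := g.continuous.comp f.continuous
  proper := fun C hC => f.proper _ (g.proper C hC)
  starInjective := fun a b h e => f.starInjective a b h (g.starInjective _ _ (f.src_eq h) e)
  starSurjective := fun t a h => by
    obtain ⟨b, hb, rfl⟩ := g.starSurjective t (f.toFun a) h
    obtain ⟨c, hc, rfl⟩ := f.starSurjective b a hb
    exact ⟨c, hc, rfl⟩

instance : Category.{u} AmpStar.{u} where
  Hom := Hom
  id := Hom.id
  comp := Hom.comp

/-- The set `KB(S)` of compact-open bisections. -/
def KB (S : AmpStar.{u}) : Type u :=
  {A : Set S.Arr // IsCompact A ∧ IsOpen A ∧ S.IsBisection A}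

end AmpStar

/-! ### Inverse semigroups -/

/-- An inverse semigroup: every element has exactly one inverse. -/
class IsInverseSemigroup (S : Type u) [Semigroup S] : Prop where
  existsUnique_inverse : ∀ a : S, ∃! b : S, a * b * a = a ∧ b * a * b = b

namespace InvSemigroup

variable {S : Type u} [Semigroup S] [IsInverseSemigroup S]

/-- The inverse `a*`. -/
noncomputable def sinv (a : S) : S :=
  (IsInverseSemigroup.existsUnique_inverse a).choose

/-- The canonical order: `a ≤ b` if and only if `a = b a* a`. -/
def NatLE (a b : S) : Prop := a = b * sinv a * a

theorem mul_sinv_mul (a : S) : a * sinv a * a = a :=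
  (IsInverseSemigroup.existsUnique_inverse a).choose_spec.1.1

theorem sinv_mul_sinv (a : S) : sinv a * a * sinv a = sinv a :=
  (IsInverseSemigroup.existsUnique_inverse a).choose_spec.1.2

theorem eq_sinv {a b : S} (h : a * b * a = a) (k : b * a * b = b) : b = sinv a :=
  (IsInverseSemigroup.existsUnique_inverse a).choose_spec.2 b ⟨h, k⟩

/-- A product of idempotents is idempotent. -/
theorem mul_idem {e f : S} (he : e * e = e) (hf : f * f = f) : e * f * (e * f) = e * f := by
  have h1 := mul_sinv_mul (e * f)
  have h2 := sinv_mul_sinv (e * f)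
  generalize hx : sinv (e * f) = x at h1 h2
  simp only [← mul_assoc] at h1 h2
  have a1 : e * f * (f * x * e) * (e * f) = e * f := by
    simp only [← mul_assoc]
    rw [mul_assoc e f f, hf, mul_assoc (e * f * x) e e, he, h1]
  have a2 : f * x * e * (e * f) * (f * x * e) = f * x * e := by
    simp only [← mul_assoc]
    rw [mul_assoc (f * x) e e, he, mul_assoc (f * x * e) f f, hf]
    simpa only [← mul_assoc] using congrArg (fun y => f * y * e) h2
  have hfx : f * x * e = x := (eq_sinv a1 a2).trans hx
  have hxx : x * x = x := by
    have : f * x * e * (f * x * e) = f * x * e := by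
      simpa only [← mul_assoc] using congrArg (fun y => f * y * e) h2
    rwa [hfx] at this
  have e1 : e * f = sinv x := eq_sinv (by simpa only [← mul_assoc] using h2)
    (by simpa only [← mul_assoc] using h1)
  have e2 : x = sinv x := eq_sinv (by rw [hxx, hxx]) (by rw [hxx, hxx])
  rw [e1, ← e2, hxx]

/-- Idempotents commute. -/
theorem idem_comm {e f : S} (he : e * e = e) (hf : f * f = f) : e * f = f * e := by
  have h1 := mul_idem he hf
  have h2 := mul_idem hf he
  have a1 : e * f * (f * e) * (e * f) = e * f := by
    simp only [← mul_assoc] at h1 ⊢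
    rw [mul_assoc e f f, hf, mul_assoc (e * f) e e, he, h1]
  have a2 : f * e * (e * f) * (f * e) = f * e := by
    simp only [← mul_assoc] at h2 ⊢
    rw [mul_assoc f e e, he, mul_assoc (f * e) f f, hf, h2]
  have e1 : e * f = sinv (e * f) := eq_sinv (by rw [h1, h1]) (by rw [h1, h1])
  rw [eq_sinv a1 a2, ← e1]

/-- If `t ≤ u` then `t = (t t*) u`. -/
theorem NatLE.eq_left {t u : S} (h : NatLE t u) : t * sinv t * u = t := by
  have ht : sinv t * t * (sinv t * t) = sinv t * t := by
    rw [← mul_assoc, sinv_mul_sinv]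
  have hu : sinv u * u * (sinv u * u) = sinv u * u := by
    rw [← mul_assoc, sinv_mul_sinv]
  have hc := idem_comm hu ht
  have hs : sinv t * t * sinv u = sinv t := by
    have h' : u * (sinv t * t) = t := by rw [← mul_assoc]; exact h.symm
    apply eq_sinv
    · calc t * (sinv t * t * sinv u) * t
          = t * (sinv t * t) * sinv u * (u * (sinv t * t)) := by rw [h']; simp only [mul_assoc]
        _ = t * ((sinv t * t) * (sinv u * u) * (sinv t * t)) := by simp only [mul_assoc]
        _ = t * ((sinv u * u) * (sinv t * t) * (sinv t * t)) := by rw [hc]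
        _ = t * ((sinv u * u) * (sinv t * t)) := by rw [mul_assoc (sinv u * u), ht]
        _ = t * ((sinv t * t) * (sinv u * u)) := by rw [hc]
        _ = u * (sinv t * t) * ((sinv t * t) * (sinv u * u)) := by rw [h']
        _ = u * (((sinv t * t) * (sinv t * t)) * (sinv u * u)) := by simp only [mul_assoc]
        _ = u * ((sinv u * u) * (sinv t * t)) := by rw [ht, hc]
        _ = u * sinv u * u * (sinv t * t) := by simp only [mul_assoc]
        _ = t := by rw [mul_sinv_mul, h']
    · calc sinv t * t * sinv u * t * (sinv t * t * sinv u)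
          = sinv t * t * sinv u * (u * (sinv t * t)) * (sinv t * t * sinv u) := by rw [h']
        _ = (sinv t * t) * ((sinv u * u) * (sinv t * t)) * (sinv t * t) * sinv u := by
            simp only [mul_assoc]
        _ = (sinv t * t) * (sinv u * u) * sinv u := by
            rw [hc, ← mul_assoc (sinv t * t) (sinv t * t), ht,
              mul_assoc (sinv t * t) (sinv u * u) (sinv t * t), hc,
              ← mul_assoc (sinv t * t) (sinv t * t), ht]
        _ = (sinv t * t) * (sinv u * u * sinv u) := by simp only [mul_assoc]
        _ = sinv t * t * sinv u := by rw [sinv_mul_sinv]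
  calc t * sinv t * u = t * (sinv t * t * sinv u) * u := by rw [hs]
    _ = t * ((sinv t * t) * (sinv u * u)) := by simp only [mul_assoc]
    _ = t * ((sinv u * u) * (sinv t * t)) := by rw [hc]
    _ = u * (sinv t * t) * ((sinv u * u) * (sinv t * t)) := by
        rw [← mul_assoc u, ← h]
    _ = u * ((sinv t * t) * ((sinv u * u) * (sinv t * t))) := by simp only [mul_assoc]
    _ = u * ((sinv u * u) * (sinv t * t)) := by rw [hc, ← mul_assoc (sinv t * t), ht]
    _ = u * sinv u * u * sinv t * t := by simp only [mul_assoc]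
    _ = t := by rw [mul_sinv_mul, ← h]

end InvSemigroup

open InvSemigroup

/-! ### Σ-ordered inverse semigroups -/

/-- `c` is the supremum of the set `F` for the relation `r`. -/
def IsSupOf {S : Type u} (r : S → S → Prop) (F : Set S) (c : S) : Prop :=
  (∀ x ∈ F, r x c) ∧ ∀ d, (∀ x ∈ F, r x d) → r c d

/-- `c` is the infimum of the set `F` for the relation `r`. -/
def IsInfOf {S : Type u} (r : S → S → Prop) (F : Set S) (c : S) : Prop :=
  (∀ x ∈ F, r c x) ∧ ∀ d, (∀ x ∈ F, r d x) → r d c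

/-- A Σ-ordered inverse semigroup; the order `⊆` is `sub`. These are the objects of `Σ-Ord`.
In `relCompl` the join and the meet may be taken in `S` or in the idempotents: all elements below
an idempotent are idempotent. -/
structure SigmaOrd : Type (u + 1) where
  Carrier : Type u
  [semigroupWithZero : SemigroupWithZero Carrier]
  [isInverse : IsInverseSemigroup Carrier]
  sub : Carrier → Carrier → Prop
  sub_refl : ∀ a, sub a a
  sub_trans : ∀ a b c, sub a b → sub b c → sub a c
  sub_antisymm : ∀ a b, sub a b → sub b a → a = b
  natLE_of_sub : ∀ a b, sub a b → NatLE a b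
  mul_right_sub : ∀ a b x, sub a b → sub (a * x) (b * x)
  mul_left_sub : ∀ a b y, sub a b → sub (y * a) (y * b)
  zero_sub : ∀ a, sub 0 a
  condJoin : ∀ a₁ a₂ c, sub a₁ c → sub a₂ c → ∃ j, IsSupOf sub {a₁, a₂} j
  distrib : ∀ a c₁ c₂ c, IsSupOf sub {c₁, c₂} c → IsSupOf sub {a * c₁, a * c₂} (a * c)
  relCompl : ∀ e f, e * e = e → f * f = f → sub e f →
    ∃ c, c * c = c ∧ IsSupOf sub {e, c} f ∧ IsInfOf sub {e, c} 0
  orthJoin : ∀ a b, sinv a * b = 0 → a * sinv b = 0 → ∃ j, IsSupOf sub {a, b} j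
  interpolation : ∀ t a, NatLE t a →
    ∃ z, NatLE t z ∧ sub z a ∧ ∀ x, t * x = 0 ↔ z * x = 0

attribute [instance] SigmaOrd.semigroupWithZero SigmaOrd.isInverse

namespace SigmaOrd

/-- `p` is the interpolator `a|t` of `t ≤ a`: the (unique) element with these properties. -/
def IsInterpolator (S : SigmaOrd.{u}) (t a p : S.Carrier) : Prop :=
  NatLE t p ∧ S.sub p a ∧ (∀ x, t * x = 0 ↔ p * x = 0) ∧ (∀ x, x * t = 0 ↔ x * p = 0)

/-- A morphism of Σ-ordered inverse semigroups. -/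
@[ext]
structure Hom (S T : SigmaOrd.{u}) where
  toFun : S.Carrier → T.Carrier
  map_mul : ∀ a b, toFun (a * b) = toFun a * toFun b
  map_zero : toFun 0 = 0
  mono : ∀ a b, S.sub a b → T.sub (toFun a) (toFun b)
  map_join : ∀ a b c, IsSupOf S.sub {a, b} c → IsSupOf T.sub {toFun a, toFun b} (toFun c)
  weakMeet : ∀ a b t, T.sub t (toFun a) → T.sub t (toFun b) →
    ∃ c, S.sub c a ∧ S.sub c b ∧ T.sub t (toFun c)
  proper : ∀ t, ∃ F : Set T.Carrier, F.Finite ∧ IsSupOf T.sub F t ∧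
    ∀ x ∈ F, ∃ s, T.sub x (toFun s)
  map_interpolator : ∀ a b p, NatLE a b → S.IsInterpolator a b p →
    T.IsInterpolator (toFun a) (toFun b) (toFun p)

theorem sup_unique (S : SigmaOrd.{u}) {F : Set S.Carrier} {a b : S.Carrier}
    (ha : IsSupOf S.sub F a) (hb : IsSupOf S.sub F b) : a = b :=
  S.sub_antisymm a b (ha.2 b hb.1) (hb.2 a ha.1)

/-- A map that preserves `0` and binary joins preserves finite joins. -/
theorem map_finite_sup {S T : SigmaOrd.{u}} (g : S.Carrier → T.Carrier)
    (h0 : ∀ d, T.sub (g 0) d)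
    (hj : ∀ a b c, IsSupOf S.sub {a, b} c → IsSupOf T.sub {g a, g b} (g c))
    {F : Set S.Carrier} (hF : F.Finite) {c : S.Carrier} (hc : IsSupOf S.sub F c) :
    IsSupOf T.sub (g '' F) (g c) := by
  suffices H : ∀ u : S.Carrier, (∀ x ∈ F, S.sub x u) →
      ∃ j, IsSupOf S.sub F j ∧ S.sub j u ∧ IsSupOf T.sub (g '' F) (g j) by
    obtain ⟨j, hj1, -, hj2⟩ := H c hc.1
    rwa [S.sup_unique hc hj1]
  clear hc
  induction F, hF using Set.Finite.induction_on with
  | empty =>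
    intro u _
    exact ⟨0, ⟨by simp, fun d _ => S.zero_sub d⟩, S.zero_sub u, by simp, fun d _ => h0 d⟩
  | @insert a F _ _ ih =>
    intro u hu
    obtain ⟨j, hj1, hj2, hj3⟩ := ih u (fun x hx => hu x (Set.mem_insert_of_mem _ hx))
    obtain ⟨k, hk⟩ := S.condJoin a j u (hu a (Set.mem_insert _ _)) hj2
    have hgk := hj a j k hk
    refine ⟨k, ⟨?_, ?_⟩, ?_, ?_, ?_⟩
    · rintro x (rfl | hx)
      · exact hk.1 _ (by simp)
      · exact S.sub_trans _ _ _ (hj1.1 x hx) (hk.1 _ (by simp))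
    · intro d hd
      refine hk.2 d ?_
      rintro x (rfl | rfl)
      · exact hd _ (Set.mem_insert _ _)
      · exact hj1.2 d (fun x hx => hd x (Set.mem_insert_of_mem _ hx))
    · refine hk.2 u ?_
      rintro x (rfl | rfl)
      · exact hu _ (Set.mem_insert _ _)
      · exact hj2
    · rintro _ ⟨x, rfl | hx, rfl⟩
      · exact hgk.1 _ (by simp)
      · exact T.sub_trans _ _ _ (hj3.1 _ ⟨x, hx, rfl⟩) (hgk.1 _ (by simp))
    · intro d hd
      refine hgk.2 d ?_
      rintro x (rfl | rfl)
      · exact hd _ ⟨a, Set.mem_insert _ _, rfl⟩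
      · refine hj3.2 d ?_
        rintro _ ⟨x, hx, rfl⟩
        exact hd _ ⟨x, Set.mem_insert_of_mem _ hx, rfl⟩

/-- The identity morphism. -/
def Hom.id (S : SigmaOrd.{u}) : Hom S S where
  toFun := fun a => a
  map_mul := fun _ _ => rfl
  map_zero := rfl
  mono := fun _ _ h => h
  map_join := fun _ _ _ h => h
  weakMeet := fun _ _ t h k => ⟨t, h, k, S.sub_refl t⟩
  proper := fun t => ⟨{t}, Set.finite_singleton t,
    ⟨by rintro _ rfl; exact S.sub_refl _, fun _ hd => hd t rfl⟩,
    fun x _ => ⟨x, S.sub_refl x⟩⟩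
  map_interpolator := fun _ _ _ _ h => h

theorem Hom.map_sinv {S T : SigmaOrd.{u}} (f : Hom S T) (a : S.Carrier) :
    f.toFun (sinv a) = sinv (f.toFun a) :=
  eq_sinv (by rw [← f.map_mul, ← f.map_mul, mul_sinv_mul])
    (by rw [← f.map_mul, ← f.map_mul, sinv_mul_sinv])

theorem Hom.map_natLE {S T : SigmaOrd.{u}} (f : Hom S T) {a b : S.Carrier} (h : NatLE a b) :
    NatLE (f.toFun a) (f.toFun b) := by
  unfold NatLE at h ⊢
  rw [← f.map_sinv, ← f.map_mul, ← f.map_mul, ← h]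

/-- The composition of two morphisms. -/
def Hom.comp {S T U : SigmaOrd.{u}} (f : Hom S T) (g : Hom T U) : Hom S U where
  toFun := fun a => g.toFun (f.toFun a)
  map_mul := fun a b => by rw [f.map_mul, g.map_mul]
  map_zero := by rw [f.map_zero, g.map_zero]
  mono := fun a b h => g.mono _ _ (f.mono a b h)
  map_join := fun a b c h => g.map_join _ _ _ (f.map_join a b c h)
  weakMeet := fun a b t h k => by
    obtain ⟨c, hc1, hc2, hc3⟩ := g.weakMeet _ _ t h k
    obtain ⟨d, hd1, hd2, hd3⟩ := f.weakMeet a b c hc1 hc2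
    exact ⟨d, hd1, hd2, U.sub_trans _ _ _ hc3 (g.mono _ _ hd3)⟩
  proper := fun t => by
    obtain ⟨F, hF, hFt, hFs⟩ := g.proper t
    have key : ∀ x ∈ F, ∃ G : Set U.Carrier, G.Finite ∧ IsSupOf U.sub G x ∧
        ∀ y ∈ G, ∃ s, U.sub y (g.toFun (f.toFun s)) := by
      intro x hx
      obtain ⟨b, hb⟩ := hFs x hx
      obtain ⟨H, hH, hHb, hHs⟩ := f.proper b
      have hxb := (U.natLE_of_sub _ _ hb).eq_left
      have hsup := map_finite_sup (S := T) (T := U) (fun y => x * sinv x * g.toFun y)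
        (fun d => by
          rw [g.map_zero, mul_zero]
          exact U.zero_sub d)
        (fun a c d h => U.distrib _ _ _ _ (g.map_join a c d h)) hH hHb
      refine ⟨_, hH.image _, by simpa only [hxb] using hsup, ?_⟩
      rintro _ ⟨y, hy, rfl⟩
      obtain ⟨s, hs⟩ := hHs y hy
      refine ⟨s, U.sub_trans _ _ _ ?_ (g.mono _ _ hs)⟩
      have hys := g.mono _ _ (hHb.1 y hy)
      have hsub : U.sub (x * sinv x * g.toFun y) x := by
        have := U.mul_left_sub _ _ (x * sinv x) hys
        rwa [hxb] at this
      -- an element `sub` a common upper bound and canonically below is `sub`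
      have h1 : U.sub (x * sinv x * g.toFun y) (g.toFun b) := U.sub_trans _ _ _ hsub hb
      have h2 := U.mul_right_sub _ _ (sinv (g.toFun y) * g.toFun y) h1
      have e1 : x * sinv x * g.toFun y * (sinv (g.toFun y) * g.toFun y)
          = x * sinv x * g.toFun y := by
        rw [mul_assoc (x * sinv x), ← mul_assoc (g.toFun y), mul_sinv_mul]
      have e2 : g.toFun b * (sinv (g.toFun y) * g.toFun y) = g.toFun y := by
        rw [← mul_assoc]
        exact (U.natLE_of_sub _ _ hys).symm
      rwa [e1, e2] at h2
    choose! G hG1 hG2 hG3 using key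
    refine ⟨⋃ x ∈ F, G x, hF.biUnion hG1, ⟨?_, ?_⟩, ?_⟩
    · intro y hy
      simp only [Set.mem_iUnion] at hy
      obtain ⟨x, hx, hy⟩ := hy
      exact U.sub_trans _ _ _ ((hG2 x hx).1 y hy) (hFt.1 x hx)
    · intro d hd
      refine hFt.2 d (fun x hx => (hG2 x hx).2 d (fun y hy => hd y ?_))
      simp only [Set.mem_iUnion]
      exact ⟨x, hx, hy⟩
    · intro y hy
      simp only [Set.mem_iUnion] at hy
      obtain ⟨x, hx, hy⟩ := hy
      exact hG3 x hx y hy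
  map_interpolator := fun a b p h k =>
    g.map_interpolator _ _ _ (f.map_natLE h) (f.map_interpolator a b p h k)

instance : Category.{u} SigmaOrd.{u} where
  Hom := Hom
  id := Hom.id
  comp := Hom.comp

/-! ### The spectrum and the germs of the Munn action -/

/-- The idempotents `E(S)`. -/
def idem (S : SigmaOrd.{u}) : Set S.Carrier := {e | e * e = e}

/-- Proper filters of the semilattice `E(S)`, with its canonical order. -/
structure IsProperFilter (S : SigmaOrd.{u}) (F : Set S.Carrier) : Prop where
  subset : F ⊆ S.idem
  nonempty : F.Nonempty
  mul_mem : ∀ e ∈ F, ∀ f ∈ F, e * f ∈ F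
  up_mem : ∀ e ∈ F, ∀ f ∈ S.idem, NatLE e f → f ∈ F
  ne_idem : F ≠ S.idem

/-- The spectrum `Ω(E(S))`: the ultrafilters, i.e. the maximal proper filters, of `E(S)`. -/
@[ext]
structure Spectrum (S : SigmaOrd.{u}) : Type u where
  carrier : Set S.Carrier
  isProperFilter : S.IsProperFilter carrier
  maximal : ∀ G : Set S.Carrier, S.IsProperFilter G → carrier ⊆ G → G = carrier

/-- The topology generated by the sets `X[e]` of the ultrafilters that contain `e`. -/
instance (S : SigmaOrd.{u}) : TopologicalSpace S.Spectrum :=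
  TopologicalSpace.generateFrom
    {X | ∃ e ∈ S.idem, X = {F : S.Spectrum | e ∈ F.carrier}}

/-- The dual Munn action of `a` on an ultrafilter `F` that contains `a* a`:
the upward closure in `E(S)` of all `a e a*` with `e ∈ F`, `e ≤ a* a`. -/
def munnHat (S : SigmaOrd.{u}) (a : S.Carrier) (F : Set S.Carrier) : Set S.Carrier :=
  {v | v ∈ S.idem ∧ ∃ e ∈ F, NatLE e (sinv a * a) ∧ NatLE (a * e * sinv a) v}

/-- The arrows `(a, F)` of the semidirect product of `S` and `Ω(E(S))` for the dual Munn action,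
whose domain at `a` is `X[a* a]`. -/
structure Semidirect (S : SigmaOrd.{u}) : Type u where
  elt : S.Carrier
  pt : S.Spectrum
  mem : sinv elt * elt ∈ pt.carrier

/-- The topology of the semidirect product: that of a subspace of `S × Ω(E(S))`, `S` discrete. -/
instance (S : SigmaOrd.{u}) : TopologicalSpace S.Semidirect :=
  TopologicalSpace.induced Semidirect.elt ⊥ ⊓ TopologicalSpace.induced Semidirect.pt inferInstance

/-- The order of the semidirect product that `⊆` induces. -/
def Semidirect.sub {S : SigmaOrd.{u}} (p q : S.Semidirect) : Prop :=
  p.pt = q.pt ∧ S.sub p.elt q.elt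

/-- The germ relation: having a common lower bound. It is an equivalence relation. -/
def germRel (S : SigmaOrd.{u}) (p q : S.Semidirect) : Prop :=
  ∃ z : S.Semidirect, z.sub p ∧ z.sub q

/-- The germs `[a, F]`, with the quotient topology. -/
def Germ (S : SigmaOrd.{u}) : Type u := Quot S.germRel

instance (S : SigmaOrd.{u}) : TopologicalSpace S.Germ :=
  TopologicalSpace.coinduced (Quot.mk S.germRel) inferInstance

/-- The germ `[a, F]`. -/
def Semidirect.germ {S : SigmaOrd.{u}} (p : S.Semidirect) : S.Germ := Quot.mk S.germRel p

/-- The map of spectra of a morphism `θ : S → T`: the set of all idempotents `e` of `S` with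
`e f ≠ 0` for all idempotents `f` of `S` with `θ f ∈ F`. -/
def specMap {S T : SigmaOrd.{u}} (θ : S ⟶ T) (F : Set T.Carrier) : Set S.Carrier :=
  {e | e ∈ S.idem ∧ ∀ f ∈ S.idem, Hom.toFun θ f ∈ F → e * f ≠ 0}

/-- `p = (s, G)` represents the image of the germ of `q = (t, F)` under the map induced by
`θ : S → T`: `G` is the image of `F` under the map of spectra and `[θ s, F] = [t, F]`. -/
def Represents {S T : SigmaOrd.{u}} (θ : S ⟶ T) (q : T.Semidirect) (p : S.Semidirect) : Prop :=
  p.pt.carrier = specMap θ q.pt.carrier ∧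
  ∃ q' : T.Semidirect, q'.elt = Hom.toFun θ p.elt ∧ q'.pt = q.pt ∧ q'.germ = q.germ

end SigmaOrd

/-! ### The two functors -/

/-- `K` is the functor of compact-open bisections: up to the bijections `κ`, the Σ-ordered inverse
semigroup `K(S)` is `KB(S)` with the product of sets and with inclusion, and `K` sends `φ` to
`A ↦ φ⁻¹(A)`. -/
def IsBisectionFunctor (K : AmpStar.{u}ᵒᵖ ⥤ SigmaOrd.{u}) : Prop :=
  ∃ κ : ∀ S : AmpStar.{u}, (K.obj (op S)).Carrier ≃ S.KB,
    (∀ (S : AmpStar.{u}) (x y : (K.obj (op S)).Carrier),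
      (κ S (x * y)).1 = S.setMul (κ S x).1 (κ S y).1) ∧
    (∀ (S : AmpStar.{u}) (x y : (K.obj (op S)).Carrier),
      (K.obj (op S)).sub x y ↔ (κ S x).1 ⊆ (κ S y).1) ∧
    (∀ (S T : AmpStar.{u}) (φ : S ⟶ T) (x : (K.obj (op T)).Carrier),
      (κ S (SigmaOrd.Hom.toFun (K.map φ.op) x)).1 = AmpStar.Hom.toFun φ ⁻¹' (κ T x).1)

/-- `P` is the functor of germs of the Munn action on the spectrum: up to homeomorphisms, the
vertices of `P(S)` are the points of `Ω(E(S))` and its arrows are the germs `[a, F]`, with source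
`F`, range the image of `F` under `a`, and product `[a, G][b, F] = [ab, F]` (when `G` is the image
of `F` under `b`). For `θ : S → T`, the homomorphism `P(θ) : P(T) → P(S)` sends `[t, F]` to
`[s, G]`, for any `s` with `[θ s, F] = [t, F]`, and `G` the image of `F` under the map of spectra. -/
def IsGermFunctor (P : SigmaOrd.{u}ᵒᵖ ⥤ AmpStar.{u}) : Prop :=
  ∃ (γ₀ : ∀ S : SigmaOrd.{u}, (P.obj (op S)).Vert ≃ₜ S.Spectrum)
    (γ : ∀ S : SigmaOrd.{u}, (P.obj (op S)).Arr ≃ₜ S.Germ),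
    (∀ (S : SigmaOrd.{u}) (p : S.Semidirect),
      γ₀ S ((P.obj (op S)).src ((γ S).symm p.germ)) = p.pt) ∧
    (∀ (S : SigmaOrd.{u}) (p : S.Semidirect),
      (γ₀ S ((P.obj (op S)).rng ((γ S).symm p.germ))).carrier =
        S.munnHat p.elt p.pt.carrier) ∧
    (∀ (S : SigmaOrd.{u}) (p q : S.Semidirect)
      (h : (P.obj (op S)).src ((γ S).symm p.germ) = (P.obj (op S)).rng ((γ S).symm q.germ)),
      ∃ r : S.Semidirect, r.elt = p.elt * q.elt ∧ r.pt = q.pt ∧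
        γ S ((P.obj (op S)).mul _ _ h) = r.germ) ∧
    (∀ (S T : SigmaOrd.{u}) (θ : S ⟶ T) (q : T.Semidirect),
      (∃ p : S.Semidirect, SigmaOrd.Represents θ q p) ∧
      ∀ p : S.Semidirect, SigmaOrd.Represents θ q p →
        γ S (AmpStar.Hom.toFun (P.map θ.op) ((γ T).symm q.germ)) = p.germ)

/-! The functor of compact-open bisections is fully faithful and essentially surjective, and germs
supply its quasi-inverse.

Compact-open bisections form a basis of the arrow space. That space need not be Hausdorff, but they
still determine its points (`KB.eq_of_forall_mem`): different sources are separated among the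
vertices, and a bisection has at most one arrow over each source. This gives faithfulness. For
fullness, let θ send bisections of T to bisections of S. For an arrow x of S, the A with x ∈ θ(A)
are exactly the compact-open bisections around one arrow of T (`exists_forall_mem_iff`). Properness
provides one such A; preservation of joins and compactness give an arrow in it all of whose
neighbourhoods belong to the family; weak meets and θ(0) = 0 exclude the bisections that miss this
arrow. The resulting map is a homomorphism since θ is multiplicative, star-injective since every
θ(A) is a bisection, and star-surjective since θ preserves interpolators, which among bisections are
restrictions to a set of sources.

For essential surjectivity, each a in S is sent to the set `ofElt a` of its germs. The sets X[e] are
compact: interpolation replaces e g by some z ⊆ e lying in the same ultrafilters, and the complement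
of z in e makes the filter cut out by a topological ultrafilter maximal (`isCompact_basic`). Through
the source, the germs of a form a copy of X[a* a], so they are a compact-open bisection. This
assignment reflects the order (`ofElt_subset_iff`): compactly many common germs are the germs of a
single lower bound, and a complement without germs is zero because nonzero idempotents lie in
ultrafilters. It is surjective because a compact-open bisection is a finite union of sets of germs,
and two such sets inside one bisection become orthogonal once their common part is removed, so that
an orthogonal join represents their union (`exists_ofElt_union`).

On morphisms the germ functor is obtained by transport along these isomorphisms. Its explicit
formula follows from `germMap_mem_ofElt` and star-surjectivity, which determine the source of the
image of a germ. -/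

/-! ### Inverse semigroups -/

namespace InvSemigroup

/-- A regular semigroup whose idempotents commute is an inverse semigroup. -/
theorem isInverseSemigroup_of_idem_comm {S : Type u} [Semigroup S]
    (hr : ∀ a : S, ∃ b, a * b * a = a ∧ b * a * b = b)
    (hc : ∀ e f : S, e * e = e → f * f = f → e * f = f * e) : IsInverseSemigroup S where
  existsUnique_inverse a := by
    obtain ⟨b, hb⟩ := hr a
    refine ⟨b, hb, ?_⟩
    rintro c ⟨h1, h2⟩
    obtain ⟨h3, h4⟩ := hb
    have e1 : c * a * (c * a) = c * a := by rw [← mul_assoc, h2]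
    have e2 : b * a * (b * a) = b * a := by rw [← mul_assoc, h4]
    have e3 : a * c * (a * c) = a * c := by rw [← mul_assoc, h1]
    have e4 : a * b * (a * b) = a * b := by rw [← mul_assoc, h3]
    -- Both inverses equal `c * a * b`, by commuting the idempotents on one side of `a`.
    have k1 : c = c * a * b := by
      calc c = c * a * c := h2.symm
        _ = c * (a * b * a) * c := by rw [h3]
        _ = c * (a * b * (a * c)) := by simp only [mul_assoc]
        _ = c * (a * c * (a * b)) := by rw [hc _ _ e4 e3]
        _ = c * a * c * a * b := by simp only [mul_assoc]
        _ = c * a * b := by rw [h2]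
    have k2 : b = c * a * b := by
      calc b = b * a * b := h4.symm
        _ = b * (a * c * a) * b := by rw [h1]
        _ = b * a * (c * a) * b := by simp only [mul_assoc]
        _ = c * a * (b * a) * b := by rw [hc _ _ e2 e1]
        _ = c * a * (b * a * b) := by simp only [mul_assoc]
        _ = c * a * b := by rw [h4]
    rw [k1, ← k2]

variable {S : Type u} [Semigroup S] [IsInverseSemigroup S]

theorem mul_sinv_mul' (a : S) : a * (sinv a * a) = a := by
  rw [← mul_assoc, mul_sinv_mul]

theorem sinv_mul_sinv' (a : S) : sinv a * (a * sinv a) = sinv a := by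
  rw [← mul_assoc, sinv_mul_sinv]

theorem mul_sinv_mul_assoc (a x : S) : a * (sinv a * (a * x)) = a * x := by
  rw [← mul_assoc, ← mul_assoc, mul_sinv_mul]

theorem sinv_mul_sinv_assoc (a x : S) : sinv a * (a * (sinv a * x)) = sinv a * x := by
  rw [← mul_assoc, ← mul_assoc, sinv_mul_sinv]

theorem sinv_sinv (a : S) : sinv (sinv a) = a :=
  (eq_sinv (sinv_mul_sinv a) (mul_sinv_mul a)).symm

theorem sinv_mul_idem (a : S) : sinv a * a * (sinv a * a) = sinv a * a := by
  rw [← mul_assoc, sinv_mul_sinv]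

theorem mul_sinv_idem (a : S) : a * sinv a * (a * sinv a) = a * sinv a := by
  rw [← mul_assoc, mul_sinv_mul]

theorem sinv_of_idem {e : S} (he : e * e = e) : sinv e = e :=
  (eq_sinv (by rw [he, he]) (by rw [he, he])).symm

theorem sinv_mul_of_idem {e : S} (he : e * e = e) : sinv e * e = e := by
  rw [sinv_of_idem he, he]

theorem sinv_mul (a b : S) : sinv (a * b) = sinv b * sinv a := by
  have hc := idem_comm (mul_sinv_idem b) (sinv_mul_idem a)
  refine (eq_sinv ?_ ?_).symm
  · calc a * b * (sinv b * sinv a) * (a * b)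
        = a * (b * sinv b * (sinv a * a)) * b := by simp only [mul_assoc]
      _ = a * (sinv a * a * (b * sinv b)) * b := by rw [hc]
      _ = a * sinv a * a * (b * sinv b * b) := by simp only [mul_assoc]
      _ = a * b := by rw [mul_sinv_mul, mul_sinv_mul]
  · calc sinv b * sinv a * (a * b) * (sinv b * sinv a)
        = sinv b * (sinv a * a * (b * sinv b)) * sinv a := by simp only [mul_assoc]
      _ = sinv b * (b * sinv b * (sinv a * a)) * sinv a := by rw [hc]
      _ = sinv b * b * sinv b * (sinv a * a * sinv a) := by simp only [mul_assoc]
      _ = sinv b * sinv a := by rw [sinv_mul_sinv, sinv_mul_sinv]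

theorem NatLE.eq_right {a b : S} (h : NatLE a b) : b * (sinv a * a) = a := by
  rw [← mul_assoc]; exact h.symm

/-- Since idempotents commute, `a* a = b* b e`, and `b` absorbs `b* b`. So any idempotent may play
the role of `a* a` in the canonical order. -/
theorem natLE_of_mul_idem {a b e : S} (he : e * e = e) (h : a = b * e) : NatLE a b := by
  have hc := idem_comm (sinv_mul_idem b) he
  have h1 : sinv a * a = sinv b * b * e := by
    rw [h, sinv_mul, sinv_of_idem he]
    calc e * sinv b * (b * e) = e * (sinv b * b * e) := by simp only [mul_assoc]
      _ = e * e * (sinv b * b) := by rw [hc]; simp only [mul_assoc]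
      _ = _ := by rw [he, hc]
  unfold NatLE
  rw [mul_assoc, h1, ← mul_assoc, ← mul_assoc, mul_sinv_mul, h]

theorem conj_idem {g : S} (a : S) (hg : g * g = g) :
    sinv a * g * a * (sinv a * g * a) = sinv a * g * a := by
  have hc := idem_comm (mul_sinv_idem a) hg
  calc sinv a * g * a * (sinv a * g * a) = sinv a * (g * (a * sinv a * g)) * a := by
        simp only [mul_assoc]
    _ = sinv a * (g * g * (a * sinv a)) * a := by rw [hc]; simp only [mul_assoc]
    _ = sinv a * g * (a * sinv a * a) := by rw [hg]; simp only [mul_assoc]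
    _ = _ := by rw [mul_sinv_mul]

/-- The inner `a a*` commutes past `g` and is absorbed by the outer `a*`. This is what makes the
pullback of a filter along conjugation closed under products. -/
theorem conj_mul {g : S} (a h : S) (hg : g * g = g) :
    sinv a * g * a * (sinv a * h * a) = sinv a * (g * h) * a := by
  have hc := idem_comm (mul_sinv_idem a) hg
  calc sinv a * g * a * (sinv a * h * a) = sinv a * (g * (a * sinv a)) * h * a := by
        simp only [mul_assoc]
    _ = sinv a * (a * sinv a * g) * h * a := by rw [hc]
    _ = sinv a * a * sinv a * (g * h) * a := by simp only [mul_assoc]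
    _ = _ := by rw [sinv_mul_sinv]

theorem natLE_iff_of_idem {e f : S} (he : e * e = e) : NatLE e f ↔ f * e = e := by
  unfold NatLE
  rw [mul_assoc, sinv_mul_of_idem he]
  exact eq_comm

theorem idem_of_natLE {z e : S} (he : e * e = e) (h : NatLE z e) : z * z = z := by
  have := h.eq_right
  rw [← this]
  exact mul_idem he (sinv_mul_idem z)

/-- If `z ≤ a`, then `z* g z` is the restriction of `a* g a` to `z* z`. -/
theorem NatLE.conj {z a : S} (h : NatLE z a) (g : S) :
    sinv z * g * z = sinv z * z * (sinv a * g * a) * (sinv z * z) := by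
  have h1 := h.eq_right
  have h2 : sinv z = sinv z * z * sinv a := by
    conv_lhs => rw [← h1]
    rw [sinv_mul, sinv_of_idem (sinv_mul_idem z)]
  calc sinv z * g * z = (sinv z * z * sinv a) * g * (a * (sinv z * z)) := by rw [← h2, h1]
    _ = _ := by simp only [mul_assoc]

/-- If `z ≤ a`, then `z* z ≤ a* a`. -/
theorem NatLE.sinv_mul_self {z a : S} (h : NatLE z a) :
    sinv a * a * (sinv z * z) = sinv z * z := by
  have h2 : sinv z = sinv z * z * sinv a := by
    conv_lhs => rw [← h.eq_right]
    rw [sinv_mul, sinv_of_idem (sinv_mul_idem z)]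
  rw [idem_comm (sinv_mul_idem a) (sinv_mul_idem z)]
  calc sinv z * z * (sinv a * a) = sinv z * z * sinv a * a := by simp only [mul_assoc]
    _ = sinv z * a := by rw [← h2]
    _ = sinv z * (z * sinv z * a) := by simp only [← mul_assoc]; rw [sinv_mul_sinv]
    _ = sinv z * z := by rw [h.eq_left]

theorem NatLE.sinv_mul_eq {z a : S} (h : NatLE z a) : sinv a * z = sinv z * z := by
  conv_lhs => rw [← h.eq_right]
  rw [← mul_assoc, h.sinv_mul_self]

/-- If `z ≤ a, a²` then `z` is idempotent. -/
theorem idem_of_natLE_sq {z a : S} (h : NatLE z a) (h' : NatLE z (a * a)) : z * z = z := by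
  have h1 : a * z = z := by
    conv_lhs => rw [← h.eq_right]
    rw [← mul_assoc, h'.eq_right]
  calc z * z = z * sinv z * a * z := by rw [h.eq_left]
    _ = z * sinv z * (a * z) := by simp only [mul_assoc]
    _ = z := by rw [h1, mul_sinv_mul]

end InvSemigroup

/-! ### Σ-ordered inverse semigroups -/

namespace SigmaOrd

variable {S : SigmaOrd.{u}}

theorem zero_idem (S : SigmaOrd.{u}) : (0 : S.Carrier) ∈ S.idem := mul_zero 0

theorem eq_zero_of_sinv_mul {a : S.Carrier} (h : sinv a * a = 0) : a = 0 := by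
  rw [← mul_sinv_mul' a, h, mul_zero]

theorem sub_zero_eq {a : S.Carrier} (h : S.sub a 0) : a = 0 :=
  S.sub_antisymm _ _ h (S.zero_sub a)

theorem sub_sinv_mul {a b : S.Carrier} (h : S.sub a b) : S.sub (sinv a * a) (sinv b * b) := by
  have := S.mul_left_sub _ _ (sinv b) h
  rwa [(S.natLE_of_sub _ _ h).sinv_mul_eq] at this

/-- Inversion is monotone. -/
theorem sub_sinv {a b : S.Carrier} (h : S.sub a b) : S.sub (sinv a) (sinv b) := by
  have h1 := S.mul_right_sub _ _ (sinv b) (sub_sinv_mul h)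
  have h2 : sinv a * a * sinv b = sinv a := by
    conv_rhs => rw [← (S.natLE_of_sub _ _ h).eq_right]
    rw [InvSemigroup.sinv_mul, sinv_of_idem (sinv_mul_idem a)]
  rwa [h2, sinv_mul_sinv] at h1

theorem sub_sinv_iff {a b : S.Carrier} : S.sub (sinv a) (sinv b) ↔ S.sub a b :=
  ⟨fun h => by simpa only [sinv_sinv] using sub_sinv h, sub_sinv⟩

/-- If `z` and `w` have an upper bound, then `z w* w` is a lower bound of them. -/
theorem mul_sub_of_sub {z w b : S.Carrier} (hz : S.sub z b) (hw : S.sub w b) :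
    S.sub (z * (sinv w * w)) z ∧ S.sub (z * (sinv w * w)) w ∧
      sinv (z * (sinv w * w)) * (z * (sinv w * w)) = sinv z * z * (sinv w * w) := by
  have ez := (S.natLE_of_sub _ _ hz).eq_right
  have ew := (S.natLE_of_sub _ _ hw).eq_right
  have hc := idem_comm (sinv_mul_idem z) (sinv_mul_idem w)
  refine ⟨?_, ?_, ?_⟩
  · have := S.mul_right_sub _ _ (sinv z * z) hw
    rw [ez] at this
    -- Both sides equal `b (z* z) (w* w)`.
    have e : z * (sinv w * w) = w * (sinv z * z) := by
      conv_lhs => rw [← ez]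
      conv_rhs => rw [← ew]
      rw [mul_assoc b, mul_assoc b, hc]
    rwa [e]
  · have := S.mul_right_sub _ _ (sinv w * w) hz
    rwa [ew] at this
  · rw [InvSemigroup.sinv_mul, sinv_of_idem (sinv_mul_idem w)]
    calc sinv w * w * sinv z * (z * (sinv w * w))
        = sinv w * w * (sinv z * z * (sinv w * w)) := by simp only [mul_assoc]
      _ = sinv w * w * (sinv w * w) * (sinv z * z) := by rw [hc, mul_assoc (sinv w * w)]
      _ = _ := by rw [sinv_mul_idem, hc]

/-- The condition on left annihilators of an interpolator follows from that on right ones. -/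
theorem isInterpolator_of_right {t a p : S.Carrier} (h : NatLE t p) (hp : S.sub p a)
    (hr : ∀ x, t * x = 0 ↔ p * x = 0) : S.IsInterpolator t a p := by
  refine ⟨h, hp, hr, fun x => ⟨fun hx => ?_, fun hx => ?_⟩⟩
  · have hx1 : sinv x * x * t = 0 := by rw [mul_assoc, hx, mul_zero]
    have hc := idem_comm (mul_sinv_idem p) (sinv_mul_idem x)
    -- The idempotent `x* x` has the same effect as `x` and can be conjugated by `p` to the
    -- right-hand side, where the hypothesis on right annihilators applies.
    have h1 : t * (sinv p * (sinv x * x) * p) = 0 := by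
      calc t * (sinv p * (sinv x * x) * p)
          = t * sinv t * (p * sinv p * (sinv x * x)) * p := by
            conv_lhs => rw [← h.eq_left]
            simp only [mul_assoc]
        _ = t * sinv t * (sinv x * x) * (p * sinv p * p) := by rw [hc]; simp only [mul_assoc]
        _ = sinv x * x * (t * sinv t * p) := by
            rw [mul_sinv_mul, idem_comm (mul_sinv_idem t) (sinv_mul_idem x)]
            simp only [mul_assoc]
        _ = 0 := by rw [h.eq_left, hx1]
    rw [hr] at h1
    have h2 : sinv x * x * p = 0 := by
      calc sinv x * x * p = sinv x * x * (p * sinv p * p) := by rw [mul_sinv_mul]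
        _ = sinv x * x * (p * sinv p) * p := by simp only [mul_assoc]
        _ = p * (sinv p * (sinv x * x) * p) := by rw [← hc]; simp only [mul_assoc]
        _ = 0 := h1
    calc x * p = x * (sinv x * x * p) := by
          rw [← mul_assoc, mul_sinv_mul']
      _ = 0 := by rw [h2, mul_zero]
  · rw [← h.eq_right, ← mul_assoc, hx, zero_mul]

/-- Right multiplication preserves joins. -/
theorem distrib_right {c₁ c₂ c : S.Carrier} (a : S.Carrier) (h : IsSupOf S.sub {c₁, c₂} c) :
    IsSupOf S.sub {c₁ * a, c₂ * a} (c * a) := by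
  -- Inversion is an order automorphism that reverses products, so distributivity on the right
  -- follows from that on the left.
  have key : ∀ {x y z : S.Carrier}, IsSupOf S.sub {x, y} z →
      IsSupOf S.sub {sinv x, sinv y} (sinv z) := by
    intro x y z h
    refine ⟨?_, fun d hd => ?_⟩
    · rintro _ (rfl | rfl)
      · exact sub_sinv (h.1 _ (by simp))
      · exact sub_sinv (h.1 _ (by simp))
    · rw [← sub_sinv_iff, sinv_sinv]
      refine h.2 _ ?_
      rintro w (rfl | rfl)
      · rw [← sub_sinv_iff, sinv_sinv]; exact hd _ (by simp)
      · rw [← sub_sinv_iff, sinv_sinv]; exact hd _ (by simp)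
  have := key (S.distrib (sinv a) _ _ _ (key h))
  simpa only [← InvSemigroup.sinv_mul, sinv_sinv] using this

/-- Finite joins of bounded families exist. -/
theorem exists_finite_sup {F : Set S.Carrier} (hF : F.Finite) {b : S.Carrier}
    (hb : ∀ x ∈ F, S.sub x b) : ∃ j, IsSupOf S.sub F j := by
  suffices ∃ j, IsSupOf S.sub F j ∧ S.sub j b from this.imp fun _ h => h.1
  induction F, hF using Set.Finite.induction_on with
  | empty => exact ⟨0, ⟨by simp, fun d _ => S.zero_sub d⟩, S.zero_sub b⟩
  | @insert a F _ _ ih =>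
    obtain ⟨j, hj, hjb⟩ := ih fun x hx => hb x (Set.mem_insert_of_mem _ hx)
    obtain ⟨k, hk⟩ := S.condJoin a j b (hb a (Set.mem_insert _ _)) hjb
    have hk1 := hk.1 a (by simp)
    have hk2 := hk.1 j (by simp)
    refine ⟨k, ⟨?_, fun d hd => hk.2 d ?_⟩, hk.2 b ?_⟩
    · rintro x (rfl | hx)
      · exact hk1
      · exact S.sub_trans _ _ _ (hj.1 x hx) hk2
    · rintro x (rfl | rfl)
      · exact hd _ (Set.mem_insert _ _)
      · exact hj.2 d fun y hy => hd y (Set.mem_insert_of_mem _ hy)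
    · rintro x (rfl | rfl)
      · exact hb _ (Set.mem_insert _ _)
      · exact hjb

/-- Elements below an idempotent split into complementary parts. -/
theorem exists_compl {e f : S.Carrier} (he : e ∈ S.idem) (hf : f ∈ S.idem) (h : S.sub e f) :
    ∃ c ∈ S.idem, S.sub c f ∧ e * c = 0 ∧ IsSupOf S.sub {e, c} f := by
  obtain ⟨c, hc, h1, h2⟩ := S.relCompl e f he hf h
  have hcf : S.sub c f := h1.1 c (by simp)
  -- The product `e * c` lies below both factors for `⊆`, hence below their meet `0`.
  refine ⟨c, hc, hcf, sub_zero_eq (h2.2 _ ?_), h1⟩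
  rintro x (rfl | rfl)
  · have := S.mul_left_sub _ _ x hcf
    rwa [idem_comm he hf, (natLE_iff_of_idem he).1 (S.natLE_of_sub _ _ h)] at this
  · have := S.mul_right_sub _ _ x h
    rwa [(natLE_iff_of_idem hc).1 (S.natLE_of_sub _ _ hcf)] at this

end SigmaOrd

/-! ### Inverse semigroupoids -/

namespace GraphedSemigroupoid

variable {S : GraphedSemigroupoid.{u}}

theorem mul_congr {a a' b b' : S.Arr} (ha : a = a') (hb : b = b') (h : S.src a = S.rng b)
    (h' : S.src a' = S.rng b') : S.mul a b h = S.mul a' b' h' := by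
  subst ha hb; rfl

theorem IsBisection.mono {A B : Set S.Arr} (hB : S.IsBisection B) (h : A ⊆ B) :
    S.IsBisection A :=
  ⟨hB.1.mono h, hB.2.mono h⟩

theorem IsBisection.setMul {A B : Set S.Arr} (hA : S.IsBisection A) (hB : S.IsBisection B) :
    S.IsBisection (S.setMul A B) := by
  constructor
  · rintro _ ⟨a, ha, b, hb, h, rfl⟩ _ ⟨a', ha', b', hb', h', rfl⟩ e
    rw [S.src_mul, S.src_mul] at e
    have eb := hB.1 hb hb' e
    subst eb
    exact mul_congr (hA.1 ha ha' (h.trans h'.symm)) rfl _ _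
  · rintro _ ⟨a, ha, b, hb, h, rfl⟩ _ ⟨a', ha', b', hb', h', rfl⟩ e
    rw [S.rng_mul, S.rng_mul] at e
    have ea := hA.2 ha ha' e
    subst ea
    exact mul_congr rfl (hB.2 hb hb' (h.symm.trans h')) _ _

theorem setMul_assoc (A B C : Set S.Arr) :
    S.setMul (S.setMul A B) C = S.setMul A (S.setMul B C) := by
  ext x
  constructor
  · rintro ⟨_, ⟨a, ha, b, hb, h, rfl⟩, c, hc, k, rfl⟩
    have k' : S.src b = S.rng c := by rw [← k, S.src_mul]
    exact ⟨a, ha, _, ⟨b, hb, c, hc, k', rfl⟩, by rw [h, S.rng_mul],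
      (S.mul_assoc a b c h k').symm⟩
  · rintro ⟨a, ha, _, ⟨b, hb, c, hc, h, rfl⟩, k, rfl⟩
    have k' : S.src a = S.rng b := by rw [k, S.rng_mul]
    exact ⟨_, ⟨a, ha, b, hb, k', rfl⟩, c, hc, by rw [← h, S.src_mul],
      S.mul_assoc a b c k' h⟩

theorem setMul_mono {A A' B B' : Set S.Arr} (hA : A ⊆ A') (hB : B ⊆ B') :
    S.setMul A B ⊆ S.setMul A' B' := by
  rintro _ ⟨a, ha, b, hb, h, rfl⟩
  exact ⟨a, hA ha, b, hB hb, h, rfl⟩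

theorem setMul_eq_empty {A B : Set S.Arr} :
    S.setMul A B = ∅ ↔ ∀ a ∈ A, ∀ b ∈ B, S.src a ≠ S.rng b := by
  rw [Set.eq_empty_iff_forall_notMem]
  constructor
  · intro H a ha b hb h
    exact H _ ⟨a, ha, b, hb, h, rfl⟩
  · rintro H _ ⟨a, ha, b, hb, h, rfl⟩
    exact H a ha b hb h

/-- The loops at a vertex form a semigroup. -/
def Loop (S : GraphedSemigroupoid.{u}) (v : S.Vert) : Type u :=
  {a : S.Arr // S.src a = v ∧ S.rng a = v}

instance (v : S.Vert) : Semigroup (S.Loop v) where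
  mul a b := ⟨S.mul a.1 b.1 (a.2.1.trans b.2.2.symm),
    (S.src_mul _ _ _).trans b.2.1, (S.rng_mul _ _ _).trans a.2.2⟩
  mul_assoc _ _ _ := Subtype.ext (S.mul_assoc _ _ _ _ _)

/-- An idempotent bisection consists of idempotent arrows. -/
theorem IsBisection.idem_of_setMul_self {A : Set S.Arr} (hA : S.IsBisection A)
    (h : S.setMul A A = A) {a : S.Arr} (ha : a ∈ A) :
    ∃ k : S.src a = S.rng a, S.mul a a k = a := by
  have ha' := ha
  rw [← h] at ha'
  obtain ⟨b, hb, c, hc, k, e⟩ := ha'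
  have e1 : c = a := hA.1 hc ha (by rw [← e, S.src_mul])
  have e2 : b = a := hA.2 hb ha (by rw [← e, S.rng_mul])
  subst e1
  subst e2
  exact ⟨k, e⟩

end GraphedSemigroupoid

namespace InverseSemigroupoid

variable {S : InverseSemigroupoid.{u}}

theorem isInverse_star (a : S.Arr) : S.IsInverse a (S.star a) :=
  (S.existsUnique_inverse a).choose_spec.1

theorem eq_star {a b : S.Arr} (h : S.IsInverse a b) : b = S.star a :=
  (S.existsUnique_inverse a).choose_spec.2 b h

theorem src_star (a : S.Arr) : S.src (S.star a) = S.rng a := (isInverse_star a).choose_spec.choose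

theorem rng_star (a : S.Arr) : S.rng (S.star a) = S.src a := (isInverse_star a).choose.symm

theorem star_star (a : S.Arr) : S.star (S.star a) = a := by
  obtain ⟨h, k, e1, e2⟩ := isInverse_star a
  exact (eq_star ⟨k, h, e2, e1⟩).symm

theorem mul_star_mul (a : S.Arr) (h : S.src a = S.rng (S.star a))
    (k : S.src (S.mul a (S.star a) h) = S.rng a) :
    S.mul (S.mul a (S.star a) h) a k = a := by
  obtain ⟨_, _, e1, _⟩ := isInverse_star a
  exact e1

theorem star_mul_star (a : S.Arr) (h : S.src (S.star a) = S.rng a)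
    (k : S.src (S.mul (S.star a) a h) = S.rng (S.star a)) :
    S.mul (S.mul (S.star a) a h) (S.star a) k = S.star a := by
  obtain ⟨_, _, _, e2⟩ := isInverse_star a
  exact e2

/-- The inverse of a loop is a loop at the same vertex. This lets the commutation of idempotents be
borrowed from inverse semigroups. -/
instance (v : S.Vert) : IsInverseSemigroup (S.Loop v) where
  existsUnique_inverse a := by
    have h1 : S.src (S.star a.1) = v := (src_star _).trans a.2.2
    have h2 : S.rng (S.star a.1) = v := (rng_star _).trans a.2.1
    refine ⟨⟨S.star a.1, h1, h2⟩, ⟨Subtype.ext (mul_star_mul a.1 _ _),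
      Subtype.ext (star_mul_star a.1 _ _)⟩, ?_⟩
    rintro b ⟨e1, e2⟩
    exact Subtype.ext (eq_star ⟨a.2.1.trans b.2.2.symm, b.2.1.trans a.2.2.symm,
      congrArg Subtype.val e1, congrArg Subtype.val e2⟩)

/-- Idempotent arrows commute. -/
theorem mul_comm_of_idem {e f : S.Arr} (he : S.src e = S.rng e) (he' : S.mul e e he = e)
    (hf : S.src f = S.rng f) (hf' : S.mul f f hf = f) (h : S.src e = S.rng f)
    (k : S.src f = S.rng e) : S.mul e f h = S.mul f e k := by
  have := idem_comm (S := S.Loop (S.src e)) (e := ⟨e, rfl, he.symm⟩)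
    (f := ⟨f, hf.trans h.symm, h.symm⟩) (Subtype.ext he') (Subtype.ext hf')
  exact congrArg Subtype.val this

end InverseSemigroupoid

/-! ### Compact-open bisections -/

namespace AmpStar

open InverseSemigroupoid GraphedSemigroupoid

variable {S : AmpStar.{u}}

instance : LocallyCompactSpace S.Vert := S.locallyCompact

instance : T2Space S.Vert := S.hausdorff

theorem exists_compact_open {v : S.Vert} {O : Set S.Vert} (hO : IsOpen O) (hv : v ∈ O) :
    ∃ V, IsCompact V ∧ IsOpen V ∧ v ∈ V ∧ V ⊆ O := by
  obtain ⟨K, hK, hvK, hKO⟩ := exists_compact_subset hO hv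
  obtain ⟨V, hV, hvV, hVK⟩ := S.zeroDimensional.exists_subset_of_mem_open hvK isOpen_interior
  have hVK' := hVK.trans interior_subset
  exact ⟨V, hK.of_isClosed_subset (IsClopen.isClosed hV) hVK', IsClopen.isOpen hV, hvV,
    hVK'.trans hKO⟩

theorem exists_open_injOn_src (a : S.Arr) : ∃ W, IsOpen W ∧ a ∈ W ∧ Set.InjOn S.src W := by
  obtain ⟨e, ha, he⟩ := S.etale a
  exact ⟨e.source, e.open_source, ha, he ▸ e.injOn⟩

theorem exists_open_isBisection (a : S.Arr) : ∃ W, IsOpen W ∧ a ∈ W ∧ S.IsBisection W := by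
  obtain ⟨W, hW, haW, hi⟩ := exists_open_injOn_src a
  obtain ⟨W', hW', haW', hi'⟩ := exists_open_injOn_src (S.star a)
  refine ⟨W ∩ S.star ⁻¹' W', hW.inter (hW'.preimage S.continuous_star), ⟨haW, haW'⟩,
    hi.mono Set.inter_subset_left, ?_⟩
  rintro x ⟨-, hx⟩ y ⟨-, hy⟩ e
  rw [← star_star x, ← star_star y, hi' hx hy (by rw [src_star, src_star, e])]

/-- Compact sets of vertices lift to compact sets along an open set on which the source is
injective. -/
theorem isCompact_inter_src_preimage {W : Set S.Arr} (hW : IsOpen W) (hi : Set.InjOn S.src W)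
    {V : Set S.Vert} (hV : IsCompact V) (hVW : V ⊆ S.src '' W) :
    IsCompact (W ∩ S.src ⁻¹' V) := by
  rw [isCompact_iff_ultrafilter_le_nhds]
  intro f hf
  rw [Filter.le_principal_iff] at hf
  have h1 : (f.map S.src : Filter S.Vert) ≤ Filter.principal V := by
    rw [Filter.le_principal_iff]
    exact Filter.mem_map.2 (Filter.mem_of_superset hf Set.inter_subset_right)
  obtain ⟨v, hv, hfv⟩ := isCompact_iff_ultrafilter_le_nhds.1 hV _ h1
  obtain ⟨w, hw, rfl⟩ := hVW hv
  refine ⟨w, ⟨hw, hv⟩, fun O hO => ?_⟩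
  -- The source map is open, so almost all sources along `f` come from `O ∩ W`; injectivity on `W`
  -- then puts the arrows themselves in `O`.
  have h2 : S.src '' (O ∩ W) ∈ nhds (S.src w) :=
    S.etale.isOpenMap.image_mem_nhds (Filter.inter_mem hO (hW.mem_nhds hw))
  have h3 : S.src ⁻¹' (S.src '' (O ∩ W)) ∈ f := hfv h2
  filter_upwards [hf, h3] with x hx hx'
  obtain ⟨y, hy, e⟩ := hx'
  rw [← hi hy.2 hx.1 e]
  exact hy.1

namespace KB

@[ext]
theorem ext {A B : S.KB} (h : A.1 = B.1) : A = B := Subtype.ext h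

theorem isCompact (A : S.KB) : IsCompact A.1 := A.2.1

theorem isOpen (A : S.KB) : IsOpen A.1 := A.2.2.1

theorem isBisection (A : S.KB) : S.IsBisection A.1 := A.2.2.2

theorem src_inj (A : S.KB) {a b : S.Arr} (ha : a ∈ A.1) (hb : b ∈ A.1)
    (h : S.src a = S.src b) : a = b := A.isBisection.1 ha hb h

theorem rng_inj (A : S.KB) {a b : S.Arr} (ha : a ∈ A.1) (hb : b ∈ A.1)
    (h : S.rng a = S.rng b) : a = b := A.isBisection.2 ha hb h

/-- The compact-open bisections are a basis of the arrow space. -/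
theorem exists_mem_subset {a : S.Arr} {O : Set S.Arr} (hO : IsOpen O) (ha : a ∈ O) :
    ∃ A : S.KB, a ∈ A.1 ∧ A.1 ⊆ O := by
  obtain ⟨W, hW, haW, hb⟩ := exists_open_isBisection a
  have hOW := hO.inter hW
  obtain ⟨V, hV, hV', haV, hVW⟩ := exists_compact_open (S.etale.isOpenMap _ hOW)
    (Set.mem_image_of_mem _ ⟨ha, haW⟩)
  have hb' := hb.mono (Set.inter_subset_right (s := O))
  exact ⟨⟨_, isCompact_inter_src_preimage hOW hb'.1 hV hVW,
    hOW.inter (hV'.preimage S.continuous_src), hb'.mono Set.inter_subset_left⟩,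
    ⟨⟨ha, haW⟩, haV⟩, fun x hx => hx.1.1⟩

theorem exists_mem (a : S.Arr) : ∃ A : S.KB, a ∈ A.1 :=
  (exists_mem_subset isOpen_univ (Set.mem_univ a)).imp fun _ h => h.1

theorem isClosed_src_image (A : S.KB) : IsClosed (S.src '' A.1) :=
  (A.isCompact.image S.continuous_src).isClosed

theorem isOpen_src_image (A : S.KB) : IsOpen (S.src '' A.1) := S.etale.isOpenMap _ A.isOpen

/-- A compact-open subset of a compact-open bisection. -/
def ofSubset (A : S.KB) (B : Set S.Arr) (hc : IsCompact B) (ho : IsOpen B) (h : B ⊆ A.1) :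
    S.KB := ⟨B, hc, ho, A.isBisection.mono h⟩

/-- The part of a compact-open bisection over the source of another one. -/
def restrict (A B : S.KB) : S.KB :=
  A.ofSubset (A.1 ∩ S.src ⁻¹' (S.src '' B.1))
    ((A.isCompact.inter_right (B.isClosed_src_image.preimage S.continuous_src)))
    (A.isOpen.inter (B.isOpen_src_image.preimage S.continuous_src)) Set.inter_subset_left

/-- The difference of two compact-open bisections, the second contained in the first. -/
def diff (A B : S.KB) (h : B.1 ⊆ A.1) : S.KB :=
  A.ofSubset (A.1 \ B.1) (A.isCompact.diff B.isOpen)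
    (by
      -- A compact set of arrows need not be closed, but its image among the Hausdorff vertices is.
      -- Injectivity of the source on `A` allows the difference to be cut out there.
      have : A.1 \ B.1 = A.1 ∩ S.src ⁻¹' (S.src '' B.1)ᶜ := by
        ext x
        refine ⟨fun hx => ⟨hx.1, ?_⟩, fun hx => ⟨hx.1, fun hxB => hx.2 ⟨x, hxB, rfl⟩⟩⟩
        rintro ⟨y, hy, e⟩
        exact hx.2 (A.src_inj (h hy) hx.1 e ▸ hy)
      rw [this]
      exact A.isOpen.inter (B.isClosed_src_image.isOpen_compl.preimage S.continuous_src))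
    Set.sdiff_subset

end KB

/-- Around a product, choose an open `W` with injective source. Products of nearby composable
factors lie in `W`, and their sources fill a neighbourhood because the source map is open; so each
arrow of `W` over it is such a product. -/
theorem isOpen_setMul {A B : Set S.Arr} (hA : IsOpen A) (hB : IsOpen B) :
    IsOpen (S.setMul A B) := by
  rw [isOpen_iff_mem_nhds]
  rintro _ ⟨a, ha, b, hb, h, rfl⟩
  obtain ⟨W, hW, hcW, hi⟩ := exists_open_injOn_src (S.mul a b h)
  have hpre := (hW.preimage S.continuous_mul)
  obtain ⟨O, hO, hOW⟩ := isOpen_induced_iff.1 hpre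
  have habO : (a, b) ∈ O := by
    have : (⟨(a, b), h⟩ : {p : S.Arr × S.Arr // S.src p.1 = S.rng p.2}) ∈
        Subtype.val ⁻¹' O := by rw [hOW]; exact hcW
    exact this
  obtain ⟨A', B', hA', hB', haA', hbB', hAB⟩ := isOpen_prod_iff.1 hO a b habO
  have hV : IsOpen (S.src '' ((B' ∩ B) ∩ S.rng ⁻¹' (S.src '' (A' ∩ A)))) :=
    S.etale.isOpenMap _ ((hB'.inter hB).inter
      ((S.etale.isOpenMap _ (hA'.inter hA)).preimage S.continuous_rng))
  refine Filter.mem_of_superset ((hW.inter (hV.preimage S.continuous_src)).mem_nhds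
    ⟨hcW, b, ⟨⟨hbB', hb⟩, a, ⟨haA', ha⟩, h⟩, (S.src_mul a b h).symm⟩) ?_
  rintro w ⟨hw, y, ⟨⟨hyB', hyB⟩, x, ⟨hxA', hxA⟩, hxy⟩, e⟩
  refine ⟨x, hxA, y, hyB, hxy, hi ?_ hw (by rw [S.src_mul, e])⟩
  have : (⟨(x, y), hxy⟩ : {p : S.Arr × S.Arr // S.src p.1 = S.rng p.2}) ∈
      Subtype.val ⁻¹' O := hAB ⟨hxA', hyB'⟩
  rw [hOW] at this
  exact this

/-- Composable pairs form a closed set because the vertices are Hausdorff, so those in `A × B` are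
compact. -/
theorem isCompact_setMul {A B : Set S.Arr} (hA : IsCompact A) (hB : IsCompact B) :
    IsCompact (S.setMul A B) := by
  have hcl : IsClosed {p : S.Arr × S.Arr | S.src p.1 = S.rng p.2} :=
    isClosed_eq (S.continuous_src.comp continuous_fst) (S.continuous_rng.comp continuous_snd)
  have h1 := hcl.isClosedEmbedding_subtypeVal.isCompact_preimage (hA.prod hB)
  convert h1.image S.continuous_mul using 1
  ext c
  constructor
  · rintro ⟨a, ha, b, hb, h, rfl⟩
    exact ⟨⟨(a, b), h⟩, ⟨ha, hb⟩, rfl⟩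
  · rintro ⟨⟨⟨a, b⟩, h⟩, ⟨ha, hb⟩, rfl⟩
    exact ⟨a, ha, b, hb, h, rfl⟩

theorem star_image (A : Set S.Arr) : S.star '' A = S.star ⁻¹' A :=
  congrFun (Set.image_eq_preimage_of_inverse star_star star_star) A

namespace KB

instance : Mul S.KB where
  mul A B := ⟨S.setMul A.1 B.1, isCompact_setMul A.isCompact B.isCompact,
    isOpen_setMul A.isOpen B.isOpen, A.isBisection.setMul B.isBisection⟩

theorem mul_val (A B : S.KB) : (A * B).1 = S.setMul A.1 B.1 := rfl

instance : Zero S.KB where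
  zero := ⟨∅, isCompact_empty, isOpen_empty, by simp [IsBisection]⟩

theorem eq_zero_iff {A : S.KB} : A = 0 ↔ A.1 = ∅ := ⟨fun h => h ▸ rfl, fun h => ext h⟩

instance : SemigroupWithZero S.KB where
  mul_assoc A B C := ext (setMul_assoc A.1 B.1 C.1)
  zero_mul _ := ext (setMul_eq_empty.2 fun _ h => h.elim)
  mul_zero _ := ext (setMul_eq_empty.2 fun _ _ _ h => h.elim)

/-- The bisection of the inverses. -/
noncomputable def star (A : S.KB) : S.KB :=
  ⟨S.star ⁻¹' A.1, star_image A.1 ▸ A.isCompact.image S.continuous_star,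
    A.isOpen.preimage S.continuous_star, by
      constructor
      · intro x hx y hy e
        rw [← star_star x, ← star_star y, A.rng_inj hx hy (by rw [rng_star, rng_star, e])]
      · intro x hx y hy e
        rw [← star_star x, ← star_star y, A.src_inj hx hy (by rw [src_star, src_star, e])]⟩

theorem mem_star {A : S.KB} {a : S.Arr} : a ∈ A.star.1 ↔ S.star a ∈ A.1 := Iff.rfl

theorem star_mem_star {A : S.KB} {a : S.Arr} : S.star a ∈ A.star.1 ↔ a ∈ A.1 := by
  rw [mem_star, star_star]

theorem star_star (A : S.KB) : A.star.star = A := by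
  ext a
  rw [mem_star, star_mem_star]

theorem mul_star_mul (A : S.KB) : A * A.star * A = A := by
  ext a
  constructor
  · rintro ⟨_, ⟨b, hb, c, hc, h, rfl⟩, d, hd, k, rfl⟩
    rw [mem_star] at hc
    obtain ⟨c, rfl⟩ : ∃ c', S.star c' = c := ⟨_, InverseSemigroupoid.star_star c⟩
    rw [InverseSemigroupoid.star_star] at hc
    have e1 : b = c := A.src_inj hb hc (h.trans (rng_star _))
    have e2 : d = c := A.rng_inj hd hc (by rw [← k, S.src_mul, src_star])
    subst e2
    subst e1
    rwa [InverseSemigroupoid.mul_star_mul]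
  · intro ha
    exact ⟨_, ⟨a, ha, S.star a, star_mem_star.2 ha, (rng_star a).symm, rfl⟩, a, ha,
      by rw [S.src_mul, src_star], InverseSemigroupoid.mul_star_mul a _ _⟩

/-- Pointwise inversion gives regularity; idempotent bisections commute because they consist of
idempotent arrows. -/
instance : IsInverseSemigroup S.KB := by
  refine isInverseSemigroup_of_idem_comm (fun A => ⟨A.star, A.mul_star_mul, ?_⟩) ?_
  · have := A.star.mul_star_mul
    rwa [star_star] at this
  · suffices ∀ E F : S.KB, E * E = E → F * F = F → (E * F).1 ⊆ (F * E).1 from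
      fun E F hE hF => ext ((this E F hE hF).antisymm (this F E hF hE))
    rintro E F hE hF _ ⟨e, he, f, hf, h, rfl⟩
    obtain ⟨ke, ee⟩ := E.isBisection.idem_of_setMul_self (congrArg Subtype.val hE) he
    obtain ⟨kf, ef⟩ := F.isBisection.idem_of_setMul_self (congrArg Subtype.val hF) hf
    have k : S.src f = S.rng e := by rw [← ke, h, kf]
    exact ⟨f, hf, e, he, k, (mul_comm_of_idem ke ee kf ef h k).symm⟩

theorem sinv_eq (A : S.KB) : sinv A = A.star := by
  refine (eq_sinv A.mul_star_mul ?_).symm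
  have := A.star.mul_star_mul
  rwa [star_star] at this

theorem mul_eq_zero {A B : S.KB} : A * B = 0 ↔ ∀ a ∈ A.1, ∀ b ∈ B.1, S.src a ≠ S.rng b := by
  rw [eq_zero_iff, mul_val, setMul_eq_empty]

/-- An idempotent bisection consists of idempotents. -/
theorem idem_iff {A : S.KB} : A * A = A ↔ ∀ a ∈ A.1, ∃ k : S.src a = S.rng a, S.mul a a k = a := by
  refine ⟨fun h a ha => A.isBisection.idem_of_setMul_self (congrArg Subtype.val h) ha,
    fun h => ext (Set.Subset.antisymm ?_ ?_)⟩
  · rintro _ ⟨a, ha, b, hb, k, rfl⟩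
    obtain ⟨kb, e⟩ := h b hb
    have : a = b := A.src_inj ha hb (by rw [k, kb])
    subst this
    rwa [e]
  · intro a ha
    obtain ⟨k, e⟩ := h a ha
    exact ⟨a, ha, a, ha, k, e⟩

/-- The elements of `A (B* B)`. -/
theorem mem_mul_sinv_mul {A B : S.KB} {x : S.Arr} :
    x ∈ (A * sinv B * B).1 ↔ ∃ a ∈ A.1, ∃ b ∈ B.1, ∃ (h : S.src a = S.rng (S.star b))
      (k : S.src (S.mul a (S.star b) h) = S.rng b), S.mul (S.mul a (S.star b) h) b k = x := by
  rw [sinv_eq]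
  constructor
  · rintro ⟨_, ⟨a, ha, c, hc, h, rfl⟩, d, hd, k, rfl⟩
    rw [mem_star] at hc
    obtain ⟨c, rfl⟩ : ∃ c', S.star c' = c := ⟨_, InverseSemigroupoid.star_star c⟩
    rw [InverseSemigroupoid.star_star] at hc
    have e2 : d = c := B.rng_inj hd hc (by rw [← k, S.src_mul, src_star])
    subst e2
    exact ⟨a, ha, _, hd, h, k, rfl⟩
  · rintro ⟨a, ha, b, hb, h, k, rfl⟩
    exact ⟨_, ⟨a, ha, _, star_mem_star.2 hb, h, rfl⟩, b, hb, k, rfl⟩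

theorem src_image_mul_sinv_mul (A B : S.KB) :
    S.src '' (A * sinv B * B).1 = S.src '' A.1 ∩ S.src '' B.1 := by
  ext v
  constructor
  · rintro ⟨x, hx, rfl⟩
    obtain ⟨a, ha, b, hb, h, k, rfl⟩ := mem_mul_sinv_mul.1 hx
    exact ⟨⟨a, ha, by rw [S.src_mul, h, rng_star]⟩, b, hb, (S.src_mul _ _ _).symm⟩
  · rintro ⟨⟨a, ha, rfl⟩, b, hb, e⟩
    have h : S.src a = S.rng (S.star b) := by rw [rng_star, e]
    have k : S.src (S.mul a (S.star b) h) = S.rng b := by rw [S.src_mul, src_star]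
    exact ⟨_, mem_mul_sinv_mul.2 ⟨a, ha, b, hb, h, k, rfl⟩, by rw [S.src_mul, e]⟩

theorem exists_of_natLE {A B : S.KB} (h : NatLE A B) {a : S.Arr} (ha : a ∈ A.1) :
    ∃ b ∈ B.1, S.src b = S.src a := by
  have : S.src a ∈ S.src '' (B * sinv A * A).1 := by
    rw [← h]
    exact ⟨a, ha, rfl⟩
  rw [src_image_mul_sinv_mul] at this
  exact this.1

theorem natLE_of_subset {A B : S.KB} (h : A.1 ⊆ B.1) : NatLE A B := by
  refine ext (Set.Subset.antisymm ?_ ?_)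
  · intro a ha
    exact mem_mul_sinv_mul.2 ⟨a, h ha, a, ha, (rng_star a).symm,
      by rw [S.src_mul, src_star], InverseSemigroupoid.mul_star_mul a _ _⟩
  · intro x hx
    obtain ⟨a, ha, b, hb, h', k, rfl⟩ := mem_mul_sinv_mul.1 hx
    have : a = b := B.src_inj ha (h hb) (h'.trans (rng_star b))
    subst this
    rwa [InverseSemigroupoid.mul_star_mul]

theorem isSup_union {A B : S.KB} (hc : S.IsBisection (A.1 ∪ B.1)) :
    IsSupOf (fun A B : S.KB => A.1 ⊆ B.1) {A, B}
      ⟨A.1 ∪ B.1, A.isCompact.union B.isCompact, A.isOpen.union B.isOpen, hc⟩ := by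
  refine ⟨?_, fun D hD => Set.union_subset (hD A (by simp)) (hD B (by simp))⟩
  rintro X (rfl | rfl)
  · exact Set.subset_union_left
  · exact Set.subset_union_right

/-- Once an upper bound exists, the union is itself a compact-open bisection, so it competes for the
supremum. -/
theorem isSup_pair_iff {A B C : S.KB} :
    IsSupOf (fun A B : S.KB => A.1 ⊆ B.1) {A, B} C ↔ C.1 = A.1 ∪ B.1 := by
  constructor
  · intro h
    have hA : A.1 ⊆ C.1 := h.1 A (by simp)
    have hB : B.1 ⊆ C.1 := h.1 B (by simp)
    refine Set.Subset.antisymm ?_ (Set.union_subset hA hB)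
    exact h.2 _ (isSup_union (C.isBisection.mono (Set.union_subset hA hB))).1
  · intro h
    refine ⟨?_, fun D hD => ?_⟩
    · rintro X (rfl | rfl)
      · exact h ▸ Set.subset_union_left
      · exact h ▸ Set.subset_union_right
    · show C.1 ⊆ D.1
      exact h ▸ Set.union_subset (hD A (by simp)) (hD B (by simp))

theorem finite_sup_eq {F : Set S.KB} (hF : F.Finite) {C : S.KB}
    (h : IsSupOf (fun A B : S.KB => A.1 ⊆ B.1) F C) : C.1 = ⋃ A ∈ F, A.1 := by
  have hs : (⋃ A ∈ F, A.1) ⊆ C.1 := Set.iUnion₂_subset h.1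
  refine Set.Subset.antisymm ?_ hs
  exact h.2 (C.ofSubset _ (hF.isCompact_biUnion fun A _ => A.isCompact)
    (isOpen_biUnion fun A _ => A.isOpen) hs) fun A hA => Set.subset_biUnion_of_mem hA

theorem isSup_of_eq_iUnion {F : Set S.KB} {C : S.KB} (h : C.1 = ⋃ A ∈ F, A.1) :
    IsSupOf (fun A B : S.KB => A.1 ⊆ B.1) F C := by
  refine ⟨fun A hA => ?_, fun D hD => ?_⟩
  · show A.1 ⊆ C.1
    rw [h]
    exact Set.subset_biUnion_of_mem hA
  · show C.1 ⊆ D.1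
    rw [h]
    exact Set.iUnion₂_subset hD

/-- The elements over the source of `T ≤ A` form a compact-open bisection above `T`. -/
theorem natLE_restrict {T A : S.KB} (h : NatLE T A) : NatLE T (A.restrict T) := by
  refine ext (Set.Subset.antisymm ?_ ?_)
  · intro t ht
    rw [h] at ht
    obtain ⟨a, ha, b, hb, k, l, e⟩ := mem_mul_sinv_mul.1 ht
    exact mem_mul_sinv_mul.2 ⟨a, ⟨ha, b, hb, (k.trans (rng_star b)).symm⟩, b, hb, k, l, e⟩
  · intro x hx
    obtain ⟨a, ha, b, hb, k, l, e⟩ := mem_mul_sinv_mul.1 hx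
    rw [h]
    exact mem_mul_sinv_mul.2 ⟨a, ha.1, b, hb, k, l, e⟩

theorem src_image_restrict {T A : S.KB} (h : NatLE T A) :
    S.src '' (A.restrict T).1 = S.src '' T.1 := by
  ext v
  constructor
  · rintro ⟨a, ⟨-, t, ht, e⟩, rfl⟩
    exact ⟨t, ht, e⟩
  · rintro ⟨t, ht, rfl⟩
    obtain ⟨a, ha, e⟩ := exists_of_natLE h ht
    exact ⟨a, ⟨ha, t, ht, e.symm⟩, e⟩

/-- Bisections have the same right annihilators if and only if they have the same source. -/
theorem annihilator_iff {A B : S.KB} :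
    (∀ X : S.KB, A * X = 0 ↔ B * X = 0) ↔ S.src '' A.1 = S.src '' B.1 := by
  constructor
  · suffices ∀ A B : S.KB, (∀ X : S.KB, B * X = 0 → A * X = 0) → S.src '' A.1 ⊆ S.src '' B.1 from
      fun h => (this A B fun X => (h X).2).antisymm (this B A fun X => (h X).1)
    rintro A B h _ ⟨a, ha, rfl⟩
    by_contra hb
    -- A bisection around `a*` whose ranges avoid the source of `B` is annihilated by `B` but not by
    -- `A`.
    obtain ⟨X, haX, hX⟩ := exists_mem_subset (a := S.star a)
      (B.isClosed_src_image.isOpen_compl.preimage S.continuous_rng) (by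
        rw [Set.mem_preimage, rng_star]; exact hb)
    refine mul_eq_zero.1 (h X (mul_eq_zero.2 fun b hb x hx e => hX hx ⟨b, hb, e⟩)) a ha _ haX
      (rng_star a).symm
  · suffices ∀ A B : S.KB, S.src '' A.1 = S.src '' B.1 → ∀ X, A * X = 0 → B * X = 0 from
      fun h X => ⟨this A B h X, this B A h.symm X⟩
    intro A B h X hX
    refine mul_eq_zero.2 fun b hb x hx e => ?_
    obtain ⟨a, ha, e'⟩ : S.src b ∈ S.src '' A.1 := h ▸ ⟨b, hb, rfl⟩
    exact mul_eq_zero.1 hX a ha x hx (e'.trans e)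

end KB

/-- The Σ-ordered inverse semigroup of the compact-open bisections. -/
def bisections (S : AmpStar.{u}) : SigmaOrd.{u} where
  Carrier := S.KB
  sub A B := A.1 ⊆ B.1
  sub_refl _ := subset_rfl
  sub_trans _ _ _ := Set.Subset.trans
  sub_antisymm _ _ h k := KB.ext (h.antisymm k)
  natLE_of_sub _ _ := KB.natLE_of_subset
  mul_right_sub _ _ _ h := setMul_mono h subset_rfl
  mul_left_sub _ _ _ h := setMul_mono subset_rfl h
  zero_sub _ := Set.empty_subset _
  condJoin A B C hA hB := ⟨_, KB.isSup_union (C.isBisection.mono (Set.union_subset hA hB))⟩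
  distrib A B C D h := by
    rw [KB.isSup_pair_iff] at h ⊢
    rw [KB.mul_val, KB.mul_val, KB.mul_val, h]
    ext x
    constructor
    · rintro ⟨a, ha, b, hb | hb, k, rfl⟩
      · exact Or.inl ⟨a, ha, b, hb, k, rfl⟩
      · exact Or.inr ⟨a, ha, b, hb, k, rfl⟩
    · rintro (⟨a, ha, b, hb, k, rfl⟩ | ⟨a, ha, b, hb, k, rfl⟩)
      · exact ⟨a, ha, b, Or.inl hb, k, rfl⟩
      · exact ⟨a, ha, b, Or.inr hb, k, rfl⟩
  relCompl E F hE hF h := by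
    refine ⟨F.diff E h, KB.idem_iff.2 fun a ha => KB.idem_iff.1 hF a ha.1, ?_, ?_, ?_⟩
    · rw [KB.isSup_pair_iff]
      exact (Set.union_sdiff_cancel h).symm
    · exact fun _ _ => Set.empty_subset _
    · intro D hD x hx
      exact (hD (F.diff E h) (by simp) hx).2 (hD E (by simp) hx)
  orthJoin A B h k := by
    -- The two orthogonality conditions say that the ranges, respectively the sources, of `A` and
    -- `B` are disjoint.
    rw [KB.sinv_eq, KB.mul_eq_zero] at h k
    refine ⟨_, KB.isSup_union ⟨?_, ?_⟩⟩
    · have key : ∀ a ∈ A.1, ∀ b ∈ B.1, S.src a ≠ S.src b := fun a ha b hb e =>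
        k a ha _ (KB.star_mem_star.2 hb) (by rw [rng_star, e])
      rintro x (hx | hx) y (hy | hy) e
      · exact A.src_inj hx hy e
      · exact absurd e (key x hx y hy)
      · exact absurd e.symm (key y hy x hx)
      · exact B.src_inj hx hy e
    · have key : ∀ a ∈ A.1, ∀ b ∈ B.1, S.rng a ≠ S.rng b := fun a ha b hb e =>
        h _ (KB.star_mem_star.2 ha) b hb (by rw [src_star, e])
      rintro x (hx | hx) y (hy | hy) e
      · exact A.rng_inj hx hy e
      · exact absurd e (key x hx y hy)
      · exact absurd e.symm (key y hy x hx)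
      · exact B.rng_inj hx hy e
  interpolation T A h := ⟨A.restrict T, KB.natLE_restrict h, Set.inter_subset_left,
    KB.annihilator_iff.2 (KB.src_image_restrict h).symm⟩

end AmpStar

/-! ### The functor of compact-open bisections -/

namespace AmpStar

open InverseSemigroupoid GraphedSemigroupoid

variable {S T : AmpStar.{u}}

/-- Right annihilators record exactly the set of sources, and the condition on left annihilators is
then automatic. -/
theorem isInterpolator_iff {A B P : S.KB} :
    S.bisections.IsInterpolator A B P ↔
      NatLE A P ∧ P.1 ⊆ B.1 ∧ S.src '' A.1 = S.src '' P.1 :=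
  ⟨fun h => ⟨h.1, h.2.1, KB.annihilator_iff.1 h.2.2.1⟩,
    fun h => SigmaOrd.isInterpolator_of_right (S := S.bisections) h.1 h.2.1
      (KB.annihilator_iff.2 h.2.2)⟩

/-- Compact subsets of an intersection of open bisections are covered by one bisection. -/
theorem KB.exists_between {A : S.KB} {C O : Set S.Arr} (hC : IsCompact C) (hO : IsOpen O)
    (hCO : C ⊆ O) (hOA : O ⊆ A.1) : ∃ B : S.KB, C ⊆ B.1 ∧ B.1 ⊆ O := by
  have key : ∀ c : C, ∃ B : S.KB, c.1 ∈ B.1 ∧ B.1 ⊆ O := fun c =>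
    KB.exists_mem_subset hO (hCO c.2)
  choose B hB hBO using key
  obtain ⟨t, ht⟩ := hC.elim_finite_subcover (fun c => (B c).1) (fun c => (B c).isOpen)
    fun c hc => Set.mem_iUnion.2 ⟨⟨c, hc⟩, hB _⟩
  have hsub : (⋃ i ∈ t, (B i).1) ⊆ O := Set.iUnion₂_subset fun i _ => hBO i
  exact ⟨A.ofSubset (⋃ i ∈ t, (B i).1) (t.isCompact_biUnion fun i _ => (B i).isCompact)
    (isOpen_biUnion fun i _ => (B i).isOpen) (hsub.trans hOA), ht, hsub⟩

/-- A compact-open bisection is a finite union of bisections that are small. -/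
theorem KB.exists_finite_cover (A : S.KB) {p : S.KB → Prop}
    (hp : ∀ a ∈ A.1, ∃ B : S.KB, a ∈ B.1 ∧ B.1 ⊆ A.1 ∧ p B) :
    ∃ F : Set S.KB, F.Finite ∧ A.1 = (⋃ B ∈ F, B.1) ∧ ∀ B ∈ F, p B := by
  choose B hB hBA hpB using fun a : A.1 => hp a.1 a.2
  obtain ⟨t, ht⟩ := A.isCompact.elim_finite_subcover (fun a => (B a).1) (fun a => (B a).isOpen)
    fun a ha => Set.mem_iUnion.2 ⟨⟨a, ha⟩, hB _⟩
  refine ⟨B '' t, t.finite_toSet.image B, ?_, ?_⟩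
  · rw [Set.biUnion_image]
    exact ht.antisymm (Set.iUnion₂_subset fun i _ => hBA i)
  · rintro _ ⟨a, -, rfl⟩
    exact hpB a

/-! ### Preimages of bisections under a morphism -/

namespace Hom

variable (φ : Hom S T)

theorem map_star (a : S.Arr) : φ.toFun (S.star a) = T.star (φ.toFun a) := by
  obtain ⟨h, k, e1, e2⟩ := isInverse_star a
  refine eq_star ⟨φ.composable _ _ h, φ.composable _ _ k, ?_, ?_⟩
  · conv_rhs => rw [← e1]
    rw [φ.map_mul, mul_congr (φ.map_mul _ _ _) rfl]
  · conv_rhs => rw [← e2]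
    rw [φ.map_mul, mul_congr (φ.map_mul _ _ _) rfl]

/-- The preimage of a compact-open bisection. -/
def preimage (A : T.KB) : S.KB :=
  ⟨φ.toFun ⁻¹' A.1, φ.proper _ A.isCompact, A.isOpen.preimage φ.continuous, by
    constructor
    · intro a ha b hb h
      exact φ.starInjective a b h (A.src_inj ha hb (φ.src_eq h))
    · intro a ha b hb h
      -- Inversion turns equal ranges into equal sources, so that star-injectivity applies.
      have h' : S.src (S.star a) = S.src (S.star b) := by rw [src_star, src_star, h]
      have e := φ.src_eq h'
      rw [φ.map_star, φ.map_star, src_star, src_star] at e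
      rw [← star_star a, ← star_star b, φ.starInjective _ _ h']
      rw [φ.map_star, φ.map_star, A.rng_inj ha hb e]⟩

theorem mem_preimage {A : T.KB} {a : S.Arr} : a ∈ (φ.preimage A).1 ↔ φ.toFun a ∈ A.1 := Iff.rfl

/-- A factorization `φ x = a b` lifts: star-surjectivity at `x` gives `y` over `b`, then at `y*` it
gives `w` over `a`, and star-injectivity identifies `w y` with `x`. -/
theorem preimage_mul (A B : T.KB) : φ.preimage (A * B) = φ.preimage A * φ.preimage B := by
  refine KB.ext (Set.Subset.antisymm ?_ ?_)
  · rintro x ⟨a, ha, b, hb, h, e⟩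
    obtain ⟨y, hy, rfl⟩ := φ.starSurjective b x (by rw [← e, T.src_mul])
    obtain ⟨w, hw, rfl⟩ := φ.starSurjective a (S.star y) (by rw [φ.map_star, src_star, h])
    have hwy : S.src w = S.rng y := hw.trans (src_star y)
    refine ⟨w, ha, y, hb, hwy, φ.starInjective _ _ ((S.src_mul _ _ _).trans hy) ?_⟩
    rw [φ.map_mul, e]
  · rintro _ ⟨a, ha, b, hb, h, rfl⟩
    exact ⟨_, ha, _, hb, φ.composable a b h, (φ.map_mul a b h).symm⟩

theorem preimage_sinv (A : T.KB) : φ.preimage (sinv A) = sinv (φ.preimage A) :=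
  eq_sinv (by rw [← φ.preimage_mul, ← φ.preimage_mul, mul_sinv_mul])
    (by rw [← φ.preimage_mul, ← φ.preimage_mul, sinv_mul_sinv])

theorem preimage_natLE {A B : T.KB} (h : NatLE A B) : NatLE (φ.preimage A) (φ.preimage B) := by
  unfold NatLE at h ⊢
  rw [← φ.preimage_sinv, ← φ.preimage_mul, ← φ.preimage_mul, ← h]

/-- The preimages of the compact-open bisections form a morphism of Σ-ordered inverse
semigroups. -/
def onBisections : SigmaOrd.Hom T.bisections S.bisections where
  toFun := φ.preimage
  map_mul := φ.preimage_mul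
  map_zero := KB.ext rfl
  mono _ _ h := Set.preimage_mono h
  map_join A B C h := by
    refine KB.isSup_pair_iff.2 ?_
    have := KB.isSup_pair_iff.1 h
    exact (congrArg (φ.toFun ⁻¹' ·) this).trans Set.preimage_union
  weakMeet A B D hA hB := by
    -- The intersection `A ∩ B` need not be compact, but the image of `D` is, so a compact-open
    -- bisection fits between them.
    have hsub : φ.toFun '' D.1 ⊆ A.1 ∩ B.1 :=
      Set.image_subset_iff.2 fun x hx => ⟨hA hx, hB hx⟩
    obtain ⟨C, hC, hCO⟩ := KB.exists_between (KB.isCompact D |>.image φ.continuous)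
      (A.isOpen.inter B.isOpen) hsub Set.inter_subset_left
    exact ⟨C, hCO.trans Set.inter_subset_left, hCO.trans Set.inter_subset_right,
      Set.image_subset_iff.1 hC⟩
  proper D := by
    obtain ⟨F, hF, hDF, hFp⟩ := KB.exists_finite_cover (D : S.KB)
      (p := fun B => ∃ A : T.KB, B.1 ⊆ φ.toFun ⁻¹' A.1) fun x hx => by
        obtain ⟨A, hA⟩ := KB.exists_mem (φ.toFun x)
        obtain ⟨B, hB, hBO⟩ := KB.exists_mem_subset
          ((KB.isOpen D).inter (A.isOpen.preimage φ.continuous)) ⟨hx, hA⟩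
        exact ⟨B, hB, hBO.trans Set.inter_subset_left, A, hBO.trans Set.inter_subset_right⟩
    exact ⟨F, hF, KB.isSup_of_eq_iUnion hDF, hFp⟩
  map_interpolator A B P hAB hP := by
    obtain ⟨h1, h2, h3⟩ := isInterpolator_iff.1 hP
    refine isInterpolator_iff.2 ⟨φ.preimage_natLE h1, Set.preimage_mono h2, ?_⟩
    -- By star-surjectivity, the sources of a preimage depend only on the sources of the bisection.
    · suffices ∀ A B : T.KB, T.src '' A.1 = T.src '' B.1 →
          S.src '' (φ.preimage A).1 ⊆ S.src '' (φ.preimage B).1 from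
        (this A P h3).antisymm (this P A h3.symm)
      rintro A B h _ ⟨a, ha, rfl⟩
      obtain ⟨b, hb, e⟩ : T.src (φ.toFun a) ∈ T.src '' B.1 := h ▸ ⟨_, ha, rfl⟩
      obtain ⟨y, hy, rfl⟩ := φ.starSurjective b a e
      exact ⟨y, hb, hy⟩

end Hom

/-- The functor of compact-open bisections. -/
def bisectionFunctor : AmpStar.{u}ᵒᵖ ⥤ SigmaOrd.{u} where
  obj S := S.unop.bisections
  map φ := Hom.onBisections φ.unop
  map_id _ := rfl
  map_comp _ _ := rfl

theorem isBisectionFunctor_bisectionFunctor :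
    IsBisectionFunctor bisectionFunctor.{u} :=
  ⟨fun _ => Equiv.refl _, fun _ _ _ => rfl, fun _ _ _ => Iff.rfl, fun _ _ _ _ => rfl⟩

/-- Arrows in the same compact-open bisections are equal. -/
theorem KB.eq_of_forall_mem {a b : S.Arr} (h : ∀ A : S.KB, a ∈ A.1 → b ∈ A.1) : a = b := by
  -- Points are separated in two stages: the sources in the Hausdorff vertex space, then the arrows
  -- inside one bisection.
  have e : S.src a = S.src b := by
    by_contra hne
    obtain ⟨U, V, hU, hV, haU, hbV, hUV⟩ := t2_separation hne
    obtain ⟨A, haA, hA⟩ := KB.exists_mem_subset (hU.preimage S.continuous_src) haU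
    exact Set.disjoint_left.1 hUV (hA (h A haA)) hbV
  obtain ⟨A, hA⟩ := KB.exists_mem a
  exact A.src_inj hA (h A hA) e

theorem Hom.eq_of_preimage {φ ψ : Hom S T} (h : ∀ A, φ.preimage A = ψ.preimage A) : φ = ψ := by
  refine Hom.ext (funext fun x => KB.eq_of_forall_mem fun A hA => ?_)
  exact (h A ▸ (φ.mem_preimage.2 hA) : x ∈ (ψ.preimage A).1)

/-! ### Fullness: the homomorphism dual to a morphism of bisections -/

section Full

variable (θ : SigmaOrd.Hom T.bisections S.bisections)

/-- The morphism `θ` as a map of compact-open bisections. -/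
def bisectionMap (A : T.KB) : S.KB := θ.toFun A

theorem bisectionMap_mul (A B : T.KB) :
    bisectionMap θ (A * B) = bisectionMap θ A * bisectionMap θ B := θ.map_mul A B

theorem bisectionMap_mono {A B : T.KB} (h : A.1 ⊆ B.1) :
    (bisectionMap θ A).1 ⊆ (bisectionMap θ B).1 := θ.mono A B h

theorem bisectionMap_zero : bisectionMap θ 0 = 0 := θ.map_zero

theorem exists_mem_bisectionMap (x : S.Arr) : ∃ A, x ∈ (bisectionMap θ A).1 := by
  obtain ⟨D, hD⟩ := KB.exists_mem x
  obtain ⟨F, hF, hs, hp⟩ := θ.proper D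
  rw [KB.finite_sup_eq hF hs] at hD
  obtain ⟨B, hB, hx⟩ := Set.mem_iUnion₂.1 hD
  obtain ⟨A, hA⟩ := hp B hB
  exact ⟨A, hA hx⟩

theorem exists_mem_bisectionMap_inter {x : S.Arr} {A B : T.KB} (hA : x ∈ (bisectionMap θ A).1)
    (hB : x ∈ (bisectionMap θ B).1) :
    ∃ C : T.KB, C.1 ⊆ A.1 ∧ C.1 ⊆ B.1 ∧ x ∈ (bisectionMap θ C).1 := by
  obtain ⟨D, hD, hDO⟩ := KB.exists_mem_subset
    ((bisectionMap θ A).isOpen.inter (bisectionMap θ B).isOpen) ⟨hA, hB⟩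
  obtain ⟨C, h1, h2, h3⟩ := θ.weakMeet A B D (hDO.trans Set.inter_subset_left)
    (hDO.trans Set.inter_subset_right)
  exact ⟨C, h1, h2, h3 hD⟩

theorem exists_forall_mem_iff (x : S.Arr) : ∃ c : T.Arr, ∀ A, c ∈ A.1 ↔ x ∈ (bisectionMap θ A).1 := by
  obtain ⟨A₀, h₀⟩ := exists_mem_bisectionMap θ x
  obtain ⟨c, hc, hcA⟩ : ∃ c ∈ A₀.1, ∀ A : T.KB, c ∈ A.1 → x ∈ (bisectionMap θ A).1 := by
    -- Otherwise, by compactness, `A₀` is a finite join of bisections whose images miss `x`, while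
    -- `θ` preserves that join.
    by_contra! H
    obtain ⟨F, hF, hAF, hFp⟩ := KB.exists_finite_cover A₀
      (p := fun B => x ∉ (bisectionMap θ B).1) fun c hc => by
        obtain ⟨A, hcA, hx⟩ := H c hc
        obtain ⟨B, hB, hBO⟩ := KB.exists_mem_subset (A₀.isOpen.inter A.isOpen) ⟨hc, hcA⟩
        exact ⟨B, hB, hBO.trans Set.inter_subset_left,
          fun h => hx (bisectionMap_mono θ (hBO.trans Set.inter_subset_right) h)⟩
    have hs := SigmaOrd.map_finite_sup (S := T.bisections) (T := S.bisections) θ.toFun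
      (fun d => by rw [θ.map_zero]; exact SigmaOrd.zero_sub _ d) θ.map_join hF
      (KB.isSup_of_eq_iUnion hAF)
    have h1 := KB.finite_sup_eq (hF.image _) hs
    have h2 : x ∈ (bisectionMap θ A₀).1 := h₀
    unfold bisectionMap at h2
    rw [h1] at h2
    obtain ⟨_, ⟨B, hB, rfl⟩, hx⟩ := Set.mem_iUnion₂.1 h2
    exact hFp B hB hx
  refine ⟨c, fun A => ⟨hcA A, fun hx => ?_⟩⟩
  obtain ⟨C, hCA, hC0, hxC⟩ := exists_mem_bisectionMap_inter θ hx h₀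
  by_contra hcn
  -- Now `x` lies in the images of the disjoint bisections `C` and `A₀ \ C`; their weak meet is
  -- empty, yet its image would contain `x`.
  have h1 := hcA (A₀.diff C hC0) ⟨hc, fun h => hcn (hCA h)⟩
  obtain ⟨C', h2, h3, h4⟩ := exists_mem_bisectionMap_inter θ hxC h1
  have : C' = 0 := KB.ext (Set.eq_empty_of_forall_notMem fun y hy => (h3 hy).2 (h2 hy))
  rw [this, bisectionMap_zero] at h4
  exact h4

/-- The map of arrow spaces dual to `θ`. -/
noncomputable def dualFun (x : S.Arr) : T.Arr := (exists_forall_mem_iff θ x).choose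

theorem dualFun_mem_iff {x : S.Arr} {A : T.KB} : dualFun θ x ∈ A.1 ↔ x ∈ (bisectionMap θ A).1 :=
  (exists_forall_mem_iff θ x).choose_spec A

/-- If the two vertices differed, bisections around the image arrows could be chosen with product
`0`, but the product of their images under `θ` contains `ab`. -/
theorem dualFun_composable (a b : S.Arr) (h : S.src a = S.rng b) :
    T.src (dualFun θ a) = T.rng (dualFun θ b) := by
  by_contra hne
  obtain ⟨U, V, hU, hV, haU, hbV, hUV⟩ := t2_separation hne
  obtain ⟨A, haA, hA⟩ := KB.exists_mem_subset (hU.preimage T.continuous_src) haU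
  obtain ⟨B, hbB, hB⟩ := KB.exists_mem_subset (hV.preimage T.continuous_rng) hbV
  have h0 : A * B = 0 := KB.mul_eq_zero.2 fun x hx y hy e =>
    Set.disjoint_left.1 hUV (hA hx) (e ▸ hB hy)
  have h1 := bisectionMap_mul θ A B
  rw [h0, bisectionMap_zero] at h1
  exact KB.mul_eq_zero.1 h1.symm a ((dualFun_mem_iff θ).1 haA) b ((dualFun_mem_iff θ).1 hbB) h

/-- Both arrows lie in the bisection `A * B`, so it is enough to compare sources, which is done by
shrinking `B`. -/
theorem dualFun_mul (a b : S.Arr) (h : S.src a = S.rng b) :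
    dualFun θ (S.mul a b h) =
      T.mul (dualFun θ a) (dualFun θ b) (dualFun_composable θ a b h) := by
  have key : ∀ A B : T.KB, dualFun θ a ∈ A.1 → dualFun θ b ∈ B.1 →
      dualFun θ (S.mul a b h) ∈ (A * B).1 := fun A B hA hB => by
    rw [dualFun_mem_iff, bisectionMap_mul]
    exact ⟨a, (dualFun_mem_iff θ).1 hA, b, (dualFun_mem_iff θ).1 hB, h, rfl⟩
  obtain ⟨A, hA⟩ := KB.exists_mem (dualFun θ a)
  obtain ⟨B, hB⟩ := KB.exists_mem (dualFun θ b)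
  refine (A * B).src_inj (key A B hA hB) ⟨_, hA, _, hB, _, rfl⟩ ?_
  rw [T.src_mul]
  by_contra hne
  obtain ⟨U, V, hU, hV, haU, hbV, hUV⟩ := t2_separation hne
  obtain ⟨B', hbB', hB'⟩ := KB.exists_mem_subset (hV.preimage T.continuous_src) hbV
  obtain ⟨x, _, y, hy, k, e⟩ := key A B' hA hbB'
  rw [← e, T.src_mul] at haU
  exact Set.disjoint_left.1 hUV haU (hB' hy)

theorem dualFun_preimage (A : T.KB) : dualFun θ ⁻¹' A.1 = (bisectionMap θ A).1 :=
  Set.ext fun _ => dualFun_mem_iff θ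

theorem dualFun_continuous : Continuous (dualFun θ) := by
  refine continuous_iff_continuousAt.2 fun x O hO => ?_
  obtain ⟨O', hO', ho, hx⟩ := mem_nhds_iff.1 hO
  obtain ⟨A, hxA, hA⟩ := KB.exists_mem_subset ho hx
  refine Filter.mem_map.2 (Filter.mem_of_superset ((bisectionMap θ A).isOpen.mem_nhds
    ((dualFun_mem_iff θ).1 hxA)) ?_)
  rw [← dualFun_preimage]
  exact Set.preimage_mono (hA.trans hO')

/-- If the image of an ultrafilter tends to `c ∈ A`, the ultrafilter contains the compact set `θ A`
and converges there. Limits in `T` need not be unique, so the image of its limit is identified with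
`c` through sources and the bisection `A`. -/
theorem dualFun_proper (C : Set T.Arr) (hC : IsCompact C) : IsCompact (dualFun θ ⁻¹' C) := by
  rw [isCompact_iff_ultrafilter_le_nhds]
  intro f hf
  have h1 : (f.map (dualFun θ) : Filter T.Arr) ≤ Filter.principal C := by
    rw [Filter.le_principal_iff] at hf ⊢
    exact hf
  obtain ⟨c, hc, hfc⟩ := isCompact_iff_ultrafilter_le_nhds.1 hC _ h1
  obtain ⟨A, hA⟩ := KB.exists_mem c
  have h2 : (bisectionMap θ A).1 ∈ f := by
    rw [← dualFun_preimage]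
    exact hfc (A.isOpen.mem_nhds hA)
  obtain ⟨x, hx, hfx⟩ := isCompact_iff_ultrafilter_le_nhds.1 (bisectionMap θ A).isCompact f
    (Filter.le_principal_iff.2 h2)
  refine ⟨x, ?_, hfx⟩
  have t1 : Filter.Tendsto (fun y => T.src (dualFun θ y)) f (nhds (T.src (dualFun θ x))) :=
    ((T.continuous_src.comp (dualFun_continuous θ)).tendsto x).mono_left hfx
  have t2 : Filter.Tendsto (fun y => T.src (dualFun θ y)) f (nhds (T.src c)) :=
    (T.continuous_src.tendsto c).comp hfc
  have : dualFun θ x = c :=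
    A.src_inj ((dualFun_mem_iff θ).2 hx) hA (tendsto_nhds_unique t1 t2)
  rw [Set.mem_preimage, this]
  exact hc

/-- With `A` around the image of `a` and `B` around `t`, the restriction of `A` to the sources of `A
B* B` is an interpolator. As `θ` preserves it, `θ (A B* B)` has an arrow over the source of `a`, and
its factor in `θ B` is the required lift. -/
theorem dualFun_starSurjective (t : T.Arr) (a : S.Arr) (h : T.src t = T.src (dualFun θ a)) :
    ∃ b : S.Arr, S.src b = S.src a ∧ dualFun θ b = t := by
  obtain ⟨A, hA⟩ := KB.exists_mem (dualFun θ a)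
  obtain ⟨B, hB⟩ := KB.exists_mem t
  have hle : NatLE (A * sinv B * B) A :=
    natLE_of_mul_idem (sinv_mul_idem B) (mul_assoc _ _ _)
  have hP : T.bisections.IsInterpolator (A * sinv B * B) A (A.restrict (A * sinv B * B)) :=
    isInterpolator_iff.2 ⟨KB.natLE_restrict hle, Set.inter_subset_left,
      (KB.src_image_restrict hle).symm⟩
  obtain ⟨-, -, h3⟩ := isInterpolator_iff.1 (θ.map_interpolator _ _ _ hle hP)
  have h4 : dualFun θ a ∈ (A.restrict (A * sinv B * B)).1 := by
    refine ⟨hA, ?_⟩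
    rw [Set.mem_preimage, KB.src_image_mul_sinv_mul]
    exact ⟨⟨_, hA, rfl⟩, t, hB, h⟩
  have h5 : S.src a ∈ S.src '' (bisectionMap θ (A * sinv B * B)).1 :=
    h3 ▸ ⟨a, (dualFun_mem_iff θ).1 h4, rfl⟩
  rw [bisectionMap_mul] at h5
  obtain ⟨_, ⟨x, _, b, hb, k, rfl⟩, e⟩ := h5
  rw [S.src_mul] at e
  refine ⟨b, e, B.src_inj ((dualFun_mem_iff θ).2 hb) hB ?_⟩
  rw [h, dualFun_composable θ b (S.star b) (rng_star b).symm,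
    dualFun_composable θ a (S.star b) (by rw [rng_star, e])]

/-- The homomorphism dual to `θ`. -/
noncomputable def dualHom : Hom S T where
  toFun := dualFun θ
  composable := dualFun_composable θ
  map_mul := dualFun_mul θ
  continuous := dualFun_continuous θ
  proper := dualFun_proper θ
  starInjective a b h e := by
    obtain ⟨A, hA⟩ := KB.exists_mem (dualFun θ a)
    exact (bisectionMap θ A).src_inj ((dualFun_mem_iff θ).1 hA)
      ((dualFun_mem_iff θ).1 (e ▸ hA)) h
  starSurjective := dualFun_starSurjective θ

theorem onBisections_dualHom : (dualHom θ).onBisections = θ :=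
  SigmaOrd.Hom.ext (funext fun A => KB.ext (dualFun_preimage θ A))

end Full

/-- The functor of compact-open bisections is fully faithful. -/
noncomputable def fullyFaithfulBisectionFunctor : bisectionFunctor.{u}.FullyFaithful where
  preimage θ := Quiver.Hom.op (dualHom θ)
  map_preimage θ := onBisections_dualHom θ
  -- The dual homomorphism and `φ` pull bisections back in the same way, which determines them.
  preimage_map φ := Quiver.Hom.unop_inj <| Hom.eq_of_preimage fun A =>
    congrFun (congrArg SigmaOrd.Hom.toFun (onBisections_dualHom (Hom.onBisections φ.unop))) A

end AmpStar

/-! ### The spectrum -/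

namespace SigmaOrd

variable {S : SigmaOrd.{u}}

theorem IsProperFilter.zero_notMem {F : Set S.Carrier} (hF : S.IsProperFilter F) :
    (0 : S.Carrier) ∉ F := fun h0 =>
  hF.ne_idem (hF.subset.antisymm fun f hf =>
    hF.up_mem 0 h0 f hf ((natLE_iff_of_idem S.zero_idem).2 (mul_zero f)))

theorem ne_idem_of_zero_notMem {F : Set S.Carrier} (h : (0 : S.Carrier) ∉ F) : F ≠ S.idem :=
  fun e => h (e ▸ S.zero_idem)

theorem mul_mem_idem {e f : S.Carrier} (he : e ∈ S.idem) (hf : f ∈ S.idem) : e * f ∈ S.idem :=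
  mul_idem he hf

theorem sinv_mul_mem_idem (a : S.Carrier) : sinv a * a ∈ S.idem := sinv_mul_idem a

namespace Spectrum

variable {F : S.Spectrum}

theorem idem_of_mem {e : S.Carrier} (h : e ∈ F.carrier) : e ∈ S.idem := F.isProperFilter.subset h

theorem zero_notMem (F : S.Spectrum) : (0 : S.Carrier) ∉ F.carrier := F.isProperFilter.zero_notMem

theorem mul_mem {e f : S.Carrier} (he : e ∈ F.carrier) (hf : f ∈ F.carrier) : e * f ∈ F.carrier :=
  F.isProperFilter.mul_mem e he f hf

theorem mem_of_mul_eq {e f : S.Carrier} (he : e ∈ F.carrier) (hf : f ∈ S.idem)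
    (h : f * e = e) : f ∈ F.carrier :=
  F.isProperFilter.up_mem e he f hf ((natLE_iff_of_idem (idem_of_mem he)).2 h)

theorem mul_mem_iff {e f : S.Carrier} (he : e ∈ S.idem) (hf : f ∈ S.idem) :
    e * f ∈ F.carrier ↔ e ∈ F.carrier ∧ f ∈ F.carrier := by
  refine ⟨fun h => ⟨mem_of_mul_eq h he ?_, mem_of_mul_eq h hf ?_⟩, fun h => mul_mem h.1 h.2⟩
  · rw [← mul_assoc, he]
  · rw [idem_comm he hf, ← mul_assoc, hf]

/-- If `e` meets every member of `F`, the filter generated by `F` and `e` is proper, hence equal to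
`F` by maximality. -/
theorem mem_iff {e : S.Carrier} (he : e ∈ S.idem) :
    e ∈ F.carrier ↔ ∀ f ∈ F.carrier, e * f ≠ 0 := by
  constructor
  · intro h f hf h0
    exact F.zero_notMem (h0 ▸ mul_mem h hf)
  · intro h
    let G : Set S.Carrier := {g | g ∈ S.idem ∧ ∃ f ∈ F.carrier, g * (e * f) = e * f}
    have hG : S.IsProperFilter G := by
      refine ⟨fun g hg => hg.1, ?_, ?_, ?_, ne_idem_of_zero_notMem ?_⟩
      · obtain ⟨f, hf⟩ := F.isProperFilter.nonempty
        exact ⟨e, he, f, hf, by rw [← mul_assoc, he]⟩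
      · rintro g ⟨hg, f, hf, e1⟩ g' ⟨hg', f', hf', e2⟩
        refine ⟨mul_mem_idem hg hg', f * f', mul_mem hf hf', ?_⟩
        have k1 : g' * (e * (f * f')) = e * (f * f') := by
          rw [idem_comm (idem_of_mem hf) (idem_of_mem hf'), ← mul_assoc e, ← mul_assoc g', e2]
        rw [mul_assoc, k1, ← mul_assoc e, ← mul_assoc g, e1]
      · rintro g ⟨hg, f, hf, e1⟩ g' hg' hle
        refine ⟨hg', f, hf, ?_⟩
        rw [← e1, ← mul_assoc, (natLE_iff_of_idem hg).1 hle]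
      · rintro ⟨-, f, hf, e1⟩
        exact h f hf (by rw [← e1, zero_mul])
    have hFG : F.carrier ⊆ G := fun f hf => ⟨idem_of_mem hf, f, hf, by
      rw [idem_comm he (idem_of_mem hf), ← mul_assoc, idem_of_mem hf]⟩
    rw [← F.maximal G hG hFG]
    obtain ⟨f, hf⟩ := F.isProperFilter.nonempty
    exact ⟨he, f, hf, by rw [← mul_assoc, he]⟩

theorem exists_mul_eq_zero {e : S.Carrier} (he : e ∈ S.idem) (h : e ∉ F.carrier) :
    ∃ f ∈ F.carrier, e * f = 0 := by
  by_contra! H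
  exact h ((mem_iff he).2 H)

theorem eq_of_subset {F G : S.Spectrum} (h : F.carrier ⊆ G.carrier) : F = G :=
  Spectrum.ext (F.maximal _ G.isProperFilter h).symm

/-- Idempotents with the same annihilators lie in the same ultrafilters. -/
theorem mem_congr {e e' : S.Carrier} (he : e ∈ S.idem) (he' : e' ∈ S.idem)
    (h : ∀ x, e * x = 0 ↔ e' * x = 0) : e ∈ F.carrier ↔ e' ∈ F.carrier := by
  rw [mem_iff he, mem_iff he']
  exact forall₂_congr fun f _ => not_congr (h f)

end Spectrum

/-- Zorn's lemma applies to filters above the principal one of `e`: unions of chains stay proper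
because they still omit `0`. -/
theorem exists_spectrum {e : S.Carrier} (he : e ∈ S.idem) (h0 : e ≠ 0) :
    ∃ F : S.Spectrum, e ∈ F.carrier := by
  have hE : S.IsProperFilter {g | g ∈ S.idem ∧ g * e = e} := by
    refine ⟨fun g hg => hg.1, ⟨e, he, he⟩, ?_, ?_, ne_idem_of_zero_notMem ?_⟩
    · rintro g ⟨hg, e1⟩ g' ⟨hg', e2⟩
      exact ⟨mul_mem_idem hg hg', by rw [mul_assoc, e2, e1]⟩
    · rintro g ⟨hg, e1⟩ g' hg' hle
      exact ⟨hg', by rw [← e1, ← mul_assoc, (natLE_iff_of_idem hg).1 hle]⟩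
    · rintro ⟨-, e1⟩
      exact h0 (by rw [← e1, zero_mul])
  obtain ⟨M, hEM, hM⟩ := zorn_subset_nonempty {G | S.IsProperFilter G} (by
    intro c hc hchain hne
    refine ⟨⋃₀ c, ⟨?_, ?_, ?_, ?_, ne_idem_of_zero_notMem ?_⟩, fun s hs =>
      Set.subset_sUnion_of_mem hs⟩
    · exact Set.sUnion_subset fun s hs => (hc hs).subset
    · obtain ⟨s, hs⟩ := hne
      obtain ⟨x, hx⟩ := (hc hs).nonempty
      exact ⟨x, s, hs, hx⟩
    · rintro x ⟨s, hs, hx⟩ y ⟨t, ht, hy⟩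
      rcases hchain.total hs ht with h | h
      · exact ⟨t, ht, (hc ht).mul_mem x (h hx) y hy⟩
      · exact ⟨s, hs, (hc hs).mul_mem x hx y (h hy)⟩
    · rintro x ⟨s, hs, hx⟩ y hy hle
      exact ⟨s, hs, (hc hs).up_mem x hx y hy hle⟩
    · rintro ⟨s, hs, hx⟩
      exact (hc hs).zero_notMem hx) _ hE
  exact ⟨⟨M, hM.prop, fun G hG h => (hM.eq_of_subset hG h).symm⟩, hEM ⟨he, he⟩⟩

/-! ### Topology of the spectrum -/

/-- The basic open set `X[e]`. -/
def basic (S : SigmaOrd.{u}) (e : S.Carrier) : Set S.Spectrum := {F | e ∈ F.carrier}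

theorem isOpen_basic {e : S.Carrier} (he : e ∈ S.idem) : IsOpen (S.basic e) :=
  TopologicalSpace.isOpen_generateFrom_of_mem ⟨e, he, rfl⟩

theorem eq_zero_of_basic_eq_empty {e : S.Carrier} (he : e ∈ S.idem) (h : S.basic e = ∅) :
    e = 0 := by
  by_contra h0
  obtain ⟨F, hF⟩ := exists_spectrum he h0
  exact (h ▸ hF : F ∈ (∅ : Set S.Spectrum))

/-- The generating sets already form a basis, as `X[e] ∩ X[f] = X[e f]`. -/
theorem exists_basic_subset {F : S.Spectrum} {O : Set S.Spectrum} (hO : IsOpen O) (hF : F ∈ O) :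
    ∃ e ∈ F.carrier, S.basic e ⊆ O := by
  induction hO with
  | basic s hs =>
    obtain ⟨e, -, rfl⟩ := hs
    exact ⟨e, hF, subset_rfl⟩
  | univ =>
    obtain ⟨e, he⟩ := F.isProperFilter.nonempty
    exact ⟨e, he, Set.subset_univ _⟩
  | inter s t _ _ ih1 ih2 =>
    obtain ⟨e, he, hs⟩ := ih1 hF.1
    obtain ⟨f, hf, ht⟩ := ih2 hF.2
    refine ⟨e * f, Spectrum.mul_mem he hf, fun G hG => ?_⟩
    have := (Spectrum.mul_mem_iff (Spectrum.idem_of_mem he) (Spectrum.idem_of_mem hf)).1 hG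
    exact ⟨hs this.1, ht this.2⟩
  | sUnion s _ ih =>
    obtain ⟨t, ht, hFt⟩ := hF
    obtain ⟨e, he, h⟩ := ih t ht hFt
    exact ⟨e, he, h.trans (Set.subset_sUnion_of_mem ht)⟩

instance t2Space_spectrum (S : SigmaOrd.{u}) : T2Space S.Spectrum where
  t2 F G hne := by
    obtain ⟨e, heF, heG⟩ := Set.not_subset.1 fun h => hne (Spectrum.eq_of_subset h)
    have he := Spectrum.idem_of_mem heF
    obtain ⟨f, hf, h0⟩ := Spectrum.exists_mul_eq_zero he heG
    refine ⟨_, _, isOpen_basic he, isOpen_basic (Spectrum.idem_of_mem hf), heF, hf, ?_⟩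
    refine Set.disjoint_left.2 fun H h1 h2 => H.zero_notMem ?_
    exact h0 ▸ Spectrum.mul_mem h1 h2

/-- Ultrafilters are prime for finite joins. -/
theorem exists_mem_of_isSup {A : Set S.Carrier} (hA : A.Finite) {j : S.Carrier}
    (hj : IsSupOf S.sub A j) {F : S.Spectrum} (hF : sinv j * j ∈ F.carrier) :
    ∃ a ∈ A, sinv a * a ∈ F.carrier := by
  by_contra! H
  -- If no `a* a` is in `F`, a product of finitely many members of `F` kills all of `A`; right
  -- distributivity then makes it kill `j`, contradicting `j* j ∈ F`.
  obtain ⟨g, hg, hgA⟩ : ∃ g ∈ F.carrier, ∀ a ∈ A, a * g = 0 := by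
    clear hj
    induction A, hA using Set.Finite.induction_on with
    | empty => exact ⟨_, hF, by simp⟩
    | @insert a A _ _ ih =>
      obtain ⟨g, hg, h⟩ := ih fun x hx => H x (Set.mem_insert_of_mem _ hx)
      obtain ⟨f, hf, h0⟩ := Spectrum.exists_mul_eq_zero (sinv_mul_mem_idem a)
        (H a (Set.mem_insert _ _))
      refine ⟨f * g, Spectrum.mul_mem hf hg, ?_⟩
      rintro x (rfl | hx)
      · rw [← mul_assoc, ← mul_sinv_mul' x, mul_assoc x, h0, mul_zero, zero_mul]
      · rw [idem_comm (Spectrum.idem_of_mem hf) (Spectrum.idem_of_mem hg), ← mul_assoc, h x hx,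
          zero_mul]
  have hs := map_finite_sup (S := S) (T := S) (fun x => x * g)
    (fun d => by rw [zero_mul]; exact S.zero_sub d) (fun _ _ _ h => distrib_right g h) hA hj
  have h0 : j * g = 0 := sub_zero_eq (hs.2 0 (by
    rintro _ ⟨a, ha, rfl⟩
    exact hgA a ha ▸ S.sub_refl _))
  refine F.zero_notMem ?_
  have := Spectrum.mul_mem hF hg
  rwa [mul_assoc, h0, mul_zero] at this

theorem mem_or_mem_of_isSup {e c f : S.Carrier} (he : e ∈ S.idem) (hc : c ∈ S.idem)
    (hf : f ∈ S.idem) (h : IsSupOf S.sub {e, c} f) {F : S.Spectrum} (hF : f ∈ F.carrier) :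
    e ∈ F.carrier ∨ c ∈ F.carrier := by
  obtain ⟨a, (rfl | rfl), ha⟩ := exists_mem_of_isSup (Set.toFinite _) h
    (F := F) (by rwa [sinv_mul_of_idem hf])
  · exact Or.inl (by rwa [sinv_mul_of_idem he] at ha)
  · exact Or.inr (by rwa [sinv_mul_of_idem hc] at ha)

/-- Inside `X[f]`, the sets `X[z]` with `z ⊆ f` suffice. -/
theorem exists_sub_basic {e f : S.Carrier} (he : e ∈ S.idem) (hf : f ∈ S.idem) :
    ∃ z ∈ S.idem, S.sub z f ∧ z * (f * e) = f * e ∧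
      ∀ F : S.Spectrum, z ∈ F.carrier ↔ f ∈ F.carrier ∧ e ∈ F.carrier := by
  have hfe := mul_mem_idem hf he
  obtain ⟨z, h1, h2, h3⟩ := S.interpolation (f * e) f (natLE_of_mul_idem he rfl)
  have hz : z ∈ S.idem := idem_of_natLE hf (S.natLE_of_sub _ _ h2)
  refine ⟨z, hz, h2, (natLE_iff_of_idem hfe).1 h1, fun F => ?_⟩
  rw [← Spectrum.mul_mem_iff hf he]
  exact (Spectrum.mem_congr hfe hz h3).symm

/-- The limit of a topological ultrafilter `U` on `X[e]` is the filter of idempotents `f` with `X[f]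
∈ U`; the point is its maximality. -/
theorem isCompact_basic {e : S.Carrier} (he : e ∈ S.idem) : IsCompact (S.basic e) := by
  rw [isCompact_iff_ultrafilter_le_nhds]
  intro U hU
  rw [Filter.le_principal_iff] at hU
  let F : Set S.Carrier := {f | f ∈ S.idem ∧ S.basic f ∈ U}
  have hF : S.IsProperFilter F := by
    refine ⟨fun f hf => hf.1, ⟨e, he, hU⟩, ?_, ?_, ne_idem_of_zero_notMem ?_⟩
    · rintro f ⟨hf, hfU⟩ g ⟨hg, hgU⟩
      exact ⟨mul_mem_idem hf hg, Filter.mem_of_superset (Filter.inter_mem hfU hgU)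
        fun G hG => Spectrum.mul_mem hG.1 hG.2⟩
    · rintro f ⟨hf, hfU⟩ g hg hle
      exact ⟨hg, Filter.mem_of_superset hfU fun G hG =>
        G.isProperFilter.up_mem f hG g hg hle⟩
    · rintro ⟨-, h⟩
      have : S.basic 0 = ∅ := Set.eq_empty_of_forall_notMem fun G hG => G.zero_notMem hG
      rw [this] at h
      exact U.neBot.ne (Filter.empty_mem_iff_bot.1 h)
  have hmax : ∀ G : Set S.Carrier, S.IsProperFilter G → F ⊆ G → G = F := by
    intro G hG hFG
    refine Set.Subset.antisymm (fun g hg => ?_) hFG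
    by_contra hgF
    have hgi := hG.subset hg
    -- Relative complements exist only for `⊆`, so `e g` is first replaced by `z ⊆ e` in the same
    -- ultrafilters. Its complement `c` is then in `F`, and `e g c = 0` would be in `G`.
    obtain ⟨z, hz, hze, hz1, hz2⟩ := exists_sub_basic hgi he
    obtain ⟨c, hc, -, hzc, hsup⟩ := exists_compl hz he hze
    have hzU : S.basic z ∉ U := fun h =>
      hgF ⟨hgi, Filter.mem_of_superset h fun H hH => ((hz2 H).1 hH).2⟩
    have hcU : S.basic c ∈ U := by
      filter_upwards [hU, Ultrafilter.compl_mem_iff_notMem.2 hzU] with H h1 h2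
      exact (mem_or_mem_of_isSup hz hc he hsup h1).resolve_left h2
    have h1 := hG.mul_mem _ (hG.mul_mem e (hFG ⟨he, hU⟩) g hg) c (hFG ⟨hc, hcU⟩)
    rw [← hz1, idem_comm hz (mul_mem_idem he hgi), mul_assoc, hzc, mul_zero] at h1
    exact hG.zero_notMem h1
  refine ⟨⟨F, hF, hmax⟩, ⟨he, hU⟩, fun O hO => ?_⟩
  obtain ⟨O', hO', ho, hx⟩ := mem_nhds_iff.1 hO
  obtain ⟨f, hf, hfO⟩ := exists_basic_subset ho hx
  exact Filter.mem_of_superset hf.2 (hfO.trans hO')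

theorem isClopen_basic {e : S.Carrier} (he : e ∈ S.idem) : IsClopen (S.basic e) :=
  ⟨(isCompact_basic he).isClosed, isOpen_basic he⟩

theorem isTopologicalBasis_isClopen_spectrum (S : SigmaOrd.{u}) :
    TopologicalSpace.IsTopologicalBasis {U : Set S.Spectrum | IsClopen U} := by
  refine TopologicalSpace.isTopologicalBasis_of_isOpen_of_nhds (fun U hU => IsClopen.isOpen hU) ?_
  intro F O hF hO
  obtain ⟨e, he, h⟩ := exists_basic_subset hO hF
  exact ⟨_, isClopen_basic (Spectrum.idem_of_mem he), he, h⟩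

instance locallyCompactSpace_spectrum (S : SigmaOrd.{u}) : LocallyCompactSpace S.Spectrum where
  local_compact_nhds F O hO := by
    obtain ⟨O', hO', ho, hx⟩ := mem_nhds_iff.1 hO
    obtain ⟨e, he, h⟩ := exists_basic_subset ho hx
    have hi := Spectrum.idem_of_mem he
    exact ⟨_, (isOpen_basic hi).mem_nhds he, h.trans hO', isCompact_basic hi⟩

/-! ### The action on the spectrum -/

/-- The idempotents `g` with `a* g a ∈ F`. -/
def conj (a : S.Carrier) (F : Set S.Carrier) : Set S.Carrier :=
  {g | g ∈ S.idem ∧ sinv a * g * a ∈ F}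

theorem conj_mul (a b : S.Carrier) (F : Set S.Carrier) : conj (a * b) F = conj a (conj b F) := by
  ext g
  simp only [conj, Set.mem_ofPred_eq, InvSemigroup.sinv_mul]
  have : sinv b * sinv a * g * (a * b) = sinv b * (sinv a * g * a) * b := by
    simp only [mul_assoc]
  rw [this]
  exact ⟨fun h => ⟨h.1, conj_idem a h.1, h.2⟩, fun h => ⟨h.1, h.2.2⟩⟩

/-- When `a* g a ∈ F`, it is itself a witness, for its conjugate is `g a a* ≤ g`; conversely every
witness lies below `a* g a`. The pullback form composes without upward closures. -/
theorem munnHat_eq (a : S.Carrier) (F : S.Spectrum) :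
    S.munnHat a F.carrier = conj a F.carrier := by
  ext g
  constructor
  · rintro ⟨hg, e, he, hle, hle'⟩
    have hei : e ∈ S.idem := Spectrum.idem_of_mem he
    refine ⟨hg, Spectrum.mem_of_mul_eq he (conj_idem a hg) ?_⟩
    have h1 : sinv a * a * e = e := (natLE_iff_of_idem hei).1 hle
    have hi : a * e * sinv a ∈ S.idem := by
      have := conj_idem (sinv a) hei
      rwa [sinv_sinv] at this
    have h2 : g * (a * e * sinv a) = a * e * sinv a := (natLE_iff_of_idem hi).1 hle'
    have h3 : e * (sinv a * a) = e := by rw [idem_comm hei (sinv_mul_mem_idem a), h1]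
    calc sinv a * g * a * e = sinv a * (g * (a * e * sinv a)) * a := by
          conv_lhs => rw [← h3]
          simp only [mul_assoc]
      _ = sinv a * a * (e * (sinv a * a)) := by rw [h2]; simp only [mul_assoc]
      _ = e := by rw [h3, h1]
  · rintro ⟨hg, hF⟩
    refine ⟨hg, _, hF, ?_, ?_⟩
    · refine (natLE_iff_of_idem (conj_idem a hg)).2 ?_
      simp only [mul_assoc, sinv_mul_sinv_assoc]
    · refine natLE_of_mul_idem (mul_sinv_idem a) ?_
      have hc := idem_comm (mul_sinv_idem a) hg
      calc a * (sinv a * g * a) * sinv a = a * sinv a * g * (a * sinv a) := by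
            simp only [mul_assoc]
        _ = g * (a * sinv a) := by rw [hc, mul_assoc, mul_sinv_idem]

/-- The image of an ultrafilter under the action. -/
def Spectrum.act (F : S.Spectrum) (a : S.Carrier) (h : sinv a * a ∈ F.carrier) : S.Spectrum where
  carrier := conj a F.carrier
  isProperFilter := by
    refine ⟨fun g hg => hg.1, ⟨a * sinv a, mul_sinv_idem a, ?_⟩, ?_, ?_,
      ne_idem_of_zero_notMem ?_⟩
    · rwa [sinv_mul_sinv']
    · rintro e ⟨he, he'⟩ f ⟨hf, hf'⟩
      refine ⟨mul_mem_idem he hf, ?_⟩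
      rw [← InvSemigroup.conj_mul a f he]
      exact mul_mem he' hf'
    · rintro e ⟨he, he'⟩ f hf hle
      refine ⟨hf, mem_of_mul_eq he' (conj_idem a hf) ?_⟩
      rw [InvSemigroup.conj_mul a e hf, (natLE_iff_of_idem he).1 hle]
    · rintro ⟨-, h0⟩
      rw [mul_zero, zero_mul] at h0
      exact F.zero_notMem h0
  maximal G hG hsub := by
    refine Set.Subset.antisymm (fun g hg => ⟨hG.subset hg, ?_⟩) hsub
    have hgi := hG.subset hg
    refine (mem_iff (conj_idem a hgi)).2 fun f hf h0 => ?_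
    have hfi : f ∈ S.idem := idem_of_mem hf
    -- A member `f` of `F` with `(a* g a) f = 0` would give `g (a f a*) = 0`, although both factors
    -- are in `G`.
    have h1 : a * f * sinv a ∈ G := by
      refine hsub ⟨?_, ?_⟩
      · have := conj_idem (sinv a) hfi
        rwa [sinv_sinv] at this
      · have := mul_mem (mul_mem h hf) h
        simpa only [mul_assoc] using this
    have h2 := hG.mul_mem g hg _ h1
    have hc := idem_comm (mul_sinv_idem a) hgi
    refine hG.zero_notMem ?_
    convert h2 using 1
    calc (0 : S.Carrier) = a * (sinv a * g * a * f) * sinv a := by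
          rw [h0, mul_zero, zero_mul]
      _ = a * sinv a * g * (a * f * sinv a) := by simp only [mul_assoc]
      _ = g * (a * f * sinv a) := by
          rw [hc]
          simp only [mul_assoc, mul_sinv_mul_assoc]

/-- Here `z* g z` is `a* g a` cut down by `z* z`, and `z* z` already belongs to `F`. Hence germs act
through any lower bound. -/
theorem conj_of_natLE {z a : S.Carrier} (h : NatLE z a) {F : S.Spectrum}
    (hz : sinv z * z ∈ F.carrier) : conj z F.carrier = conj a F.carrier := by
  ext g
  refine and_congr_right fun hg => ?_
  have hi := conj_idem a hg
  rw [h.conj, Spectrum.mul_mem_iff (mul_mem_idem (sinv_mul_mem_idem z) hi) (sinv_mul_mem_idem z),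
    Spectrum.mul_mem_iff (sinv_mul_mem_idem z) hi]
  exact ⟨fun h => h.1.2, fun h => ⟨⟨hz, h⟩, hz⟩⟩

theorem conj_sinv_conj {a : S.Carrier} {F : S.Spectrum} (h : sinv a * a ∈ F.carrier) :
    conj (sinv a) (conj a F.carrier) = F.carrier := by
  rw [← conj_mul]
  ext g
  have hi := sinv_mul_mem_idem a
  simp only [conj, Set.mem_ofPred_eq, sinv_of_idem (sinv_mul_idem a)]
  constructor
  · rintro ⟨hg, h'⟩
    rw [Spectrum.mul_mem_iff (mul_mem_idem hi hg) hi, Spectrum.mul_mem_iff hi hg] at h'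
    exact h'.1.2
  · intro hg
    exact ⟨Spectrum.idem_of_mem hg, Spectrum.mul_mem (Spectrum.mul_mem h hg) h⟩

/-! ### Equality of germs -/

/-- The elements `a` and `b` have the same germ at `F`. -/
def GermEq (F : S.Spectrum) (a b : S.Carrier) : Prop :=
  ∃ z, S.sub z a ∧ S.sub z b ∧ sinv z * z ∈ F.carrier

namespace GermEq

variable {F G : S.Spectrum} {a a' b b' c : S.Carrier}

theorem refl (h : sinv a * a ∈ F.carrier) : GermEq F a a := ⟨a, S.sub_refl a, S.sub_refl a, h⟩

theorem symm (h : GermEq F a b) : GermEq F b a := by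
  obtain ⟨z, h1, h2, h3⟩ := h
  exact ⟨z, h2, h1, h3⟩

theorem trans (h : GermEq F a b) (k : GermEq F b c) : GermEq F a c := by
  obtain ⟨z, h1, h2, h3⟩ := h
  obtain ⟨w, k1, k2, k3⟩ := k
  obtain ⟨m1, m2, m3⟩ := mul_sub_of_sub h2 k1
  exact ⟨_, S.sub_trans _ _ _ m1 h1, S.sub_trans _ _ _ m2 k2, m3 ▸ Spectrum.mul_mem h3 k3⟩

theorem mem_of_natLE {z : S.Carrier} (h : NatLE z a) (hz : sinv z * z ∈ F.carrier) :
    sinv a * a ∈ F.carrier :=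
  Spectrum.mem_of_mul_eq hz (sinv_mul_mem_idem a) h.sinv_mul_self

theorem left_mem (h : GermEq F a b) : sinv a * a ∈ F.carrier := by
  obtain ⟨z, h1, -, h3⟩ := h
  exact mem_of_natLE (S.natLE_of_sub _ _ h1) h3

theorem right_mem (h : GermEq F a b) : sinv b * b ∈ F.carrier := h.symm.left_mem

theorem conj_eq (h : GermEq F a b) : conj a F.carrier = conj b F.carrier := by
  obtain ⟨z, h1, h2, h3⟩ := h
  rw [← conj_of_natLE (S.natLE_of_sub _ _ h1) h3, ← conj_of_natLE (S.natLE_of_sub _ _ h2) h3]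

theorem mul_mem (hG : G.carrier = conj b F.carrier) (ha : sinv a * a ∈ G.carrier) :
    sinv (a * b) * (a * b) ∈ F.carrier := by
  rw [hG] at ha
  have := ha.2
  rw [InvSemigroup.sinv_mul]
  simpa only [mul_assoc] using this

/-- The product of the two witnesses is a witness: `w` moves `F` to the same point `G` as `b`, so `z
w` is still defined at `F`. -/
theorem mul (hG : G.carrier = conj b F.carrier) (ha : GermEq G a a') (hb : GermEq F b b') :
    GermEq F (a * b) (a' * b') := by
  obtain ⟨z, h1, h2, h3⟩ := ha
  obtain ⟨w, k1, k2, k3⟩ := hb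
  refine ⟨z * w, S.sub_trans _ _ _ (S.mul_right_sub _ _ w h1) (S.mul_left_sub _ _ a k1),
    S.sub_trans _ _ _ (S.mul_right_sub _ _ w h2) (S.mul_left_sub _ _ a' k2), mul_mem ?_ h3⟩
  rw [hG, conj_of_natLE (S.natLE_of_sub _ _ k1) k3]

theorem exists_idem (h : GermEq F a (a * a)) : ∃ e, e * e = e ∧ GermEq F a e := by
  obtain ⟨z, h1, h2, h3⟩ := h
  exact ⟨z, idem_of_natLE_sq (S.natLE_of_sub _ _ h1) (S.natLE_of_sub _ _ h2), z, h1,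
    S.sub_refl z, h3⟩

/-- Idempotent germs commute. -/
theorem mul_comm (ha : GermEq F a (a * a)) (hb : GermEq F b (b * b))
    (ha' : F.carrier = conj a F.carrier) (hb' : F.carrier = conj b F.carrier) :
    GermEq F (a * b) (b * a) := by
  obtain ⟨e, he, hae⟩ := ha.exists_idem
  obtain ⟨f, hf, hbf⟩ := hb.exists_idem
  have h1 := mul hb' hae hbf
  have h2 := mul ha' hbf hae
  rw [idem_comm he hf] at h1
  exact h1.trans h2.symm

/-- Inverses of germs are unique. -/
theorem inverse_unique (hbF : F.carrier = conj b G.carrier) (hcF : F.carrier = conj c G.carrier)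
    (haG : G.carrier = conj a F.carrier)
    (hab : GermEq F (a * b * a) a) (hba : GermEq G (b * a * b) b)
    (hac : GermEq F (a * c * a) a) (hca : GermEq G (c * a * c) c) : GermEq G b c := by
  have mb := hba.right_mem
  have mc := hca.right_mem
  have ma := hab.right_mem
  -- The loops `ab`, `ac` at `G` and `ba`, `ca` at `F` fix their base points and have idempotent
  -- germs, so they commute in pairs. The classical computation `b = bac = c` can then be run on
  -- germs.
  have cab : G.carrier = conj (a * b) G.carrier := by rw [conj_mul, ← hbF, ← haG]
  have cac : G.carrier = conj (a * c) G.carrier := by rw [conj_mul, ← hcF, ← haG]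
  have cba : F.carrier = conj (b * a) F.carrier := by rw [conj_mul, ← haG, ← hbF]
  have cca : F.carrier = conj (c * a) F.carrier := by rw [conj_mul, ← haG, ← hcF]
  have iab : GermEq G (a * b) (a * b * (a * b)) := by
    have := mul hbF hab.symm (refl mb); rwa [mul_assoc] at this
  have iac : GermEq G (a * c) (a * c * (a * c)) := by
    have := mul hcF hac.symm (refl mc); rwa [mul_assoc] at this
  have iba : GermEq F (b * a) (b * a * (b * a)) := by
    have := mul haG hba.symm (refl ma); rwa [mul_assoc] at this
  have ica : GermEq F (c * a) (c * a * (c * a)) := by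
    have := mul haG hca.symm (refl ma); rwa [mul_assoc] at this
  have k1 : GermEq G b (b * (a * c)) := by
    have s1 : GermEq G (b * a * b) (b * (a * c * a * b)) := by
      have h : GermEq G (a * b) (a * c * a * b) := mul hbF hac.symm (refl mb)
      have := mul cab (refl mb) h
      rwa [← mul_assoc] at this
    have s2 : GermEq G (b * (a * c * a * b)) (b * (a * b * (a * c))) := by
      have h := mul_comm iac iab cac cab
      have hc : G.carrier = conj (a * c * (a * b)) G.carrier := by
        rw [conj_mul, ← cab, ← cac]
      have := mul hc (refl mb) h
      rwa [← mul_assoc (a * c)] at this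
    have s3 : GermEq G (b * (a * b * (a * c))) (b * (a * c)) := by
      have := mul cac hba (refl iac.left_mem)
      simpa only [mul_assoc] using this
    exact ((hba.symm.trans s1).trans s2).trans s3
  have k2 : GermEq G c (b * (a * c)) := by
    have s1 : GermEq G (c * a * c) (c * a * (b * a) * c) := by
      have h : GermEq G (a * c) (a * b * a * c) := mul hcF hab.symm (refl mc)
      have := mul cac (refl mc) h
      simpa only [mul_assoc] using this
    have s2 : GermEq G (c * a * (b * a) * c) (b * a * (c * a) * c) :=
      mul hcF (mul_comm ica iba cca cba) (refl mc)
    have s3 : GermEq G (b * a * (c * a) * c) (b * (a * c)) := by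
      have := mul (b := c * a * c) (a := b * a) (F := G) (G := F)
        (by rw [conj_mul, ← hcF, ← cca]) (refl iba.left_mem) hca
      simpa only [mul_assoc] using this
    exact ((hca.symm.trans s1).trans s2).trans s3
  exact k1.trans k2.symm

end GermEq

end SigmaOrd

/-! ### The semigroupoid of germs -/

namespace SigmaOrd

variable {S : SigmaOrd.{u}}

theorem germRel_iff {p q : S.Semidirect} :
    S.germRel p q ↔ p.pt = q.pt ∧ GermEq p.pt p.elt q.elt := by
  constructor
  · rintro ⟨z, ⟨e1, h1⟩, e2, h2⟩
    exact ⟨e1.symm.trans e2, z.elt, h1, h2, e1 ▸ z.mem⟩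
  · rintro ⟨e, z, h1, h2, h3⟩
    exact ⟨⟨z, p.pt, h3⟩, ⟨rfl, h1⟩, e, h2⟩

theorem equivalence_germRel (S : SigmaOrd.{u}) : Equivalence S.germRel where
  refl p := germRel_iff.2 ⟨rfl, GermEq.refl p.mem⟩
  symm h := by
    obtain ⟨e, h⟩ := germRel_iff.1 h
    exact germRel_iff.2 ⟨e.symm, e ▸ h.symm⟩
  trans h k := by
    obtain ⟨e, h⟩ := germRel_iff.1 h
    obtain ⟨e', k⟩ := germRel_iff.1 k
    exact germRel_iff.2 ⟨e.trans e', h.trans (e ▸ k)⟩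

theorem germ_eq_iff {p q : S.Semidirect} :
    p.germ = q.germ ↔ p.pt = q.pt ∧ GermEq p.pt p.elt q.elt :=
  (S.equivalence_germRel.quot_mk_eq_iff p q).trans germRel_iff

theorem Semidirect.germ_surjective (γ : S.Germ) : ∃ p : S.Semidirect, p.germ = γ :=
  Quot.exists_rep γ

namespace Semidirect

/-- The range of `(a, F)`. -/
def rng (p : S.Semidirect) : S.Spectrum := p.pt.act p.elt p.mem

theorem rng_carrier (p : S.Semidirect) : p.rng.carrier = conj p.elt p.pt.carrier := rfl

/-- The product `(a, G) (b, F) = (a b, F)`. -/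
def mul (p q : S.Semidirect) (h : p.pt = q.rng) : S.Semidirect :=
  ⟨p.elt * q.elt, q.pt, GermEq.mul_mem (congrArg Spectrum.carrier h) p.mem⟩

theorem rng_eq_of_germ_eq {p q : S.Semidirect} (h : p.germ = q.germ) : p.rng = q.rng := by
  obtain ⟨e, h⟩ := germ_eq_iff.1 h
  apply Spectrum.ext
  rw [rng_carrier, rng_carrier, h.conj_eq, e]

theorem mul_germ_congr {p q p' q' : S.Semidirect} (hp : p.germ = p'.germ) (hq : q.germ = q'.germ)
    (h : p.pt = q.rng) (h' : p'.pt = q'.rng) : (p.mul q h).germ = (p'.mul q' h').germ := by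
  obtain ⟨-, hp⟩ := germ_eq_iff.1 hp
  obtain ⟨e, hq⟩ := germ_eq_iff.1 hq
  exact germ_eq_iff.2 ⟨e, GermEq.mul (congrArg Spectrum.carrier h) hp hq⟩

theorem rng_mul (p q : S.Semidirect) (h : p.pt = q.rng) : (p.mul q h).rng = p.rng := by
  apply Spectrum.ext
  rw [rng_carrier, rng_carrier, h, rng_carrier]
  exact conj_mul _ _ _

/-- The inverse `(a*, a F)` of `(a, F)`. -/
noncomputable def inv (p : S.Semidirect) : S.Semidirect :=
  ⟨sinv p.elt, p.rng, by rw [sinv_sinv]; exact mul_sinv_idem p.elt, by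
    rw [sinv_sinv, sinv_mul_sinv']; exact p.mem⟩

theorem rng_inv (p : S.Semidirect) : p.inv.rng = p.pt :=
  Spectrum.ext (conj_sinv_conj p.mem)

end Semidirect

namespace Germ

/-- The source of a germ. -/
def src (γ : S.Germ) : S.Spectrum :=
  Quot.lift Semidirect.pt (fun _ _ h => (germRel_iff.1 h).1) γ

/-- The range of a germ. -/
def rng (γ : S.Germ) : S.Spectrum :=
  Quot.lift Semidirect.rng (fun _ _ h => Semidirect.rng_eq_of_germ_eq (Quot.sound h)) γ

theorem src_germ (p : S.Semidirect) : src p.germ = p.pt := rfl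

theorem rng_germ (p : S.Semidirect) : rng p.germ = p.rng := rfl

/-- A representative of a germ. -/
noncomputable def rep (γ : S.Germ) : S.Semidirect := (Semidirect.germ_surjective γ).choose

theorem germ_rep (γ : S.Germ) : γ.rep.germ = γ := (Semidirect.germ_surjective γ).choose_spec

theorem rep_composable {α β : S.Germ} (h : src α = rng β) : α.rep.pt = β.rep.rng := by
  rw [← src_germ, ← rng_germ, germ_rep, germ_rep, h]

/-- The product of germs. -/
noncomputable def mul (α β : S.Germ) (h : src α = rng β) : S.Germ :=
  (α.rep.mul β.rep (rep_composable h)).germ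

theorem mul_germ (p q : S.Semidirect) (h : src p.germ = rng q.germ) :
    mul p.germ q.germ h = (p.mul q h).germ :=
  Semidirect.mul_germ_congr (germ_rep _) (germ_rep _) _ _

/-- The germs of `a`. -/
def ofElt (a : S.Carrier) : Set S.Germ := {γ | ∃ p : S.Semidirect, p.elt = a ∧ p.germ = γ}

theorem germ_mem_ofElt {p : S.Semidirect} {a : S.Carrier} :
    p.germ ∈ ofElt a ↔ GermEq p.pt p.elt a := by
  constructor
  · rintro ⟨q, rfl, h⟩
    obtain ⟨e, h⟩ := germ_eq_iff.1 h
    exact e ▸ h.symm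
  · intro h
    exact ⟨⟨a, p.pt, h.right_mem⟩, rfl, germ_eq_iff.2 ⟨rfl, h.symm⟩⟩

theorem injOn_src_ofElt (a : S.Carrier) : Set.InjOn src (ofElt a) := by
  rintro _ ⟨⟨_, F, hF⟩, rfl, rfl⟩ _ ⟨⟨_, G, hG⟩, rfl, rfl⟩ e
  obtain rfl : F = G := e
  rfl

theorem src_image_ofElt (a : S.Carrier) : src '' ofElt a = S.basic (sinv a * a) := by
  ext F
  constructor
  · rintro ⟨_, ⟨p, rfl, rfl⟩, rfl⟩
    exact p.mem
  · intro hF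
    exact ⟨_, ⟨⟨a, F, hF⟩, rfl, rfl⟩, rfl⟩

end Germ

/-! ### Topology of the germs -/

theorem Semidirect.continuous_pt : Continuous (Semidirect.pt (S := S)) :=
  continuous_def.2 fun _ hs =>
    inf_le_right (α := TopologicalSpace S.Semidirect) _ ⟨_, hs, rfl⟩

/-- As `S` is discrete, the space is the disjoint union of slices `{a} × X[a* a]`, each homeomorphic
to an open part of the spectrum. -/
theorem isOpen_semidirect_iff {V : Set S.Semidirect} :
    IsOpen V ↔ ∀ a, IsOpen {F : S.Spectrum | ∃ h, (⟨a, F, h⟩ : S.Semidirect) ∈ V} := by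
  constructor
  · intro hV a
    let f : S.basic (sinv a * a) → S.Semidirect := fun F => ⟨a, F.1, F.2⟩
    have hf : Continuous f := by
      refine continuous_iff_coinduced_le.2 (le_inf (α := TopologicalSpace S.Semidirect) ?_ ?_)
      · exact continuous_iff_coinduced_le.1
          (continuous_induced_rng.2 (@continuous_const _ _ _ ⊥ a))
      · exact continuous_iff_coinduced_le.1 (continuous_induced_rng.2 continuous_subtype_val)
    have h1 := (isOpen_basic (sinv_mul_mem_idem a)).isOpenMap_subtype_val _ (hV.preimage hf)
    convert h1 using 1
    ext F
    constructor
    · rintro ⟨h, hF⟩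
      exact ⟨⟨F, h⟩, hF, rfl⟩
    · rintro ⟨⟨F, h⟩, hF, rfl⟩
      exact ⟨h, hF⟩
  · intro H
    have hV : V = ⋃ a, (Semidirect.elt ⁻¹' {a} ∩
        Semidirect.pt ⁻¹' {F : S.Spectrum | ∃ h, (⟨a, F, h⟩ : S.Semidirect) ∈ V}) := by
      ext p
      simp only [Set.mem_iUnion]
      constructor
      · intro hp
        exact ⟨p.elt, rfl, p.mem, hp⟩
      · rintro ⟨a, rfl, _, hp⟩
        exact hp
    rw [hV]
    refine isOpen_iUnion fun a => IsOpen.inter ?_ ?_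
    · exact inf_le_left (α := TopologicalSpace S.Semidirect) _
        ⟨{a}, trivial, rfl⟩
    · exact inf_le_right (α := TopologicalSpace S.Semidirect) _ ⟨_, H a, rfl⟩

theorem isOpen_germ_iff {W : Set S.Germ} :
    IsOpen W ↔ ∀ a, IsOpen {F : S.Spectrum | ∃ h, (⟨a, F, h⟩ : S.Semidirect).germ ∈ W} :=
  isOpen_coinduced.trans isOpen_semidirect_iff

namespace Germ

theorem continuous_src : Continuous (src (S := S)) :=
  continuous_coinduced_dom.2 Semidirect.continuous_pt

theorem continuous_rng : Continuous (rng (S := S)) := by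
  refine continuous_coinduced_dom.2 (continuous_generateFrom_iff.2 ?_)
  rintro _ ⟨g, hg, rfl⟩
  refine isOpen_semidirect_iff.2 fun a => ?_
  convert (isOpen_basic (sinv_mul_mem_idem a)).inter (isOpen_basic (conj_idem a hg)) using 1
  ext F
  exact ⟨fun ⟨h, h'⟩ => ⟨h, h'.2⟩, fun ⟨h, h'⟩ => ⟨h, hg, h'⟩⟩

/-- A lower bound `z` that witnesses equality of germs at `F` does so on all of `X[z* z]`. -/
theorem isOpen_ofElt (a : S.Carrier) : IsOpen (ofElt a) := by
  refine isOpen_germ_iff.2 fun b => isOpen_iff_forall_mem_open.2 ?_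
  rintro F ⟨h, hF⟩
  obtain ⟨z, h1, h2, h3⟩ := germ_mem_ofElt.1 hF
  refine ⟨_, fun G hG => ?_, isOpen_basic (sinv_mul_mem_idem z), h3⟩
  have : GermEq G b a := ⟨z, h1, h2, hG⟩
  exact ⟨this.left_mem, germ_mem_ofElt.2 this⟩

theorem isOpenMap_src : IsOpenMap (src (S := S)) := by
  intro W hW
  have : src '' W = ⋃ a, {F : S.Spectrum | ∃ h, (⟨a, F, h⟩ : S.Semidirect).germ ∈ W} := by
    ext F
    simp only [Set.mem_iUnion]
    constructor
    · rintro ⟨γ, hγ, rfl⟩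
      obtain ⟨p, rfl⟩ := Semidirect.germ_surjective γ
      exact ⟨p.elt, p.mem, hγ⟩
    · rintro ⟨a, h, hF⟩
      exact ⟨_, hF, rfl⟩
  rw [this]
  exact isOpen_iUnion (isOpen_germ_iff.1 hW)

theorem isLocalHomeomorph_src : IsLocalHomeomorph (src (S := S)) := by
  rw [isLocalHomeomorph_iff_isOpenEmbedding_restrict]
  intro γ
  obtain ⟨p, rfl⟩ := Semidirect.germ_surjective γ
  refine ⟨ofElt p.elt, (isOpen_ofElt _).mem_nhds ⟨p, rfl, rfl⟩, ?_⟩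
  exact Topology.IsOpenEmbedding.of_continuous_injective_isOpenMap
    (continuous_src.comp continuous_subtype_val) (Set.injOn_iff_injective.1 (injOn_src_ofElt _))
    (isOpenMap_src.domRestrict (isOpen_ofElt _))

/-- The sets of germs of the elements form a basis. -/
theorem exists_ofElt_subset {γ : S.Germ} {W : Set S.Germ} (hW : IsOpen W) (hγ : γ ∈ W) :
    ∃ a, γ ∈ ofElt a ∧ ofElt a ⊆ W := by
  obtain ⟨⟨a, F, h⟩, rfl⟩ := Semidirect.germ_surjective γ
  obtain ⟨e, he, heW⟩ := exists_basic_subset (isOpen_germ_iff.1 hW a) ⟨h, hγ⟩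
  have hai := sinv_mul_mem_idem a
  -- Restricting `a` by `e` gives only `a e ≤ a`, which may change germs. With `z ⊆ a* a` one has `a
  -- z ⊆ a`, over the same points.
  obtain ⟨z, hz, hza, -, hzF⟩ := exists_sub_basic (Spectrum.idem_of_mem he) hai
  have hsub : S.sub (a * z) a := by
    have := S.mul_left_sub _ _ a hza
    rwa [mul_sinv_mul'] at this
  have hs : sinv (a * z) * (a * z) = z := by
    have h1 : sinv a * a * z = z := (natLE_iff_of_idem hz).1 (S.natLE_of_sub _ _ hza)
    rw [InvSemigroup.sinv_mul, sinv_of_idem hz, mul_assoc, ← mul_assoc (sinv a), h1, hz]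
  refine ⟨a * z, germ_mem_ofElt.2 ⟨a * z, hsub, S.sub_refl _, ?_⟩, ?_⟩
  · rw [hs]
    exact (hzF F).2 ⟨h, he⟩
  · rintro _ ⟨⟨_, G, hG⟩, rfl, rfl⟩
    have hG' := hG
    rw [hs, hzF] at hG'
    obtain ⟨h', hGW⟩ := heW hG'.2
    convert hGW using 1
    exact germ_eq_iff.2 ⟨rfl, a * z, S.sub_refl _, hsub, hG⟩

/-- If `z` witnesses that the product is a germ of `c`, it also serves for germs of the same two
elements whose product has source in `X[z* z]`. -/
theorem continuous_mul : Continuous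
    (fun p : {p : S.Germ × S.Germ // src p.1 = rng p.2} => mul p.1.1 p.1.2 p.2) := by
  refine continuous_iff_continuousAt.2 ?_
  rintro ⟨⟨α, β⟩, h⟩
  obtain ⟨p, rfl⟩ := Semidirect.germ_surjective α
  obtain ⟨q, rfl⟩ := Semidirect.germ_surjective β
  intro O hO
  obtain ⟨O', hO', ho, hx⟩ := mem_nhds_iff.1 hO
  obtain ⟨c, hc, hcO⟩ := exists_ofElt_subset ho hx
  simp only [mul_germ] at hc
  obtain ⟨z, h1, h2, h3⟩ := germ_mem_ofElt.1 hc
  have hopen : IsOpen {x : {p : S.Germ × S.Germ // src p.1 = rng p.2} |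
      x.1.1 ∈ ofElt p.elt ∧ x.1.2 ∈ ofElt q.elt ∧ src x.1.2 ∈ S.basic (sinv z * z)} := by
    have c1 : Continuous fun x : {p : S.Germ × S.Germ // src p.1 = rng p.2} => x.1.1 :=
      continuous_fst.comp continuous_subtype_val
    have c2 : Continuous fun x : {p : S.Germ × S.Germ // src p.1 = rng p.2} => x.1.2 :=
      continuous_snd.comp continuous_subtype_val
    exact ((isOpen_ofElt _).preimage c1).inter (((isOpen_ofElt _).preimage c2).inter
      ((isOpen_basic (sinv_mul_mem_idem z)).preimage (continuous_src.comp c2)))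
  refine Filter.mem_map.2 (Filter.mem_of_superset (hopen.mem_nhds
    ⟨⟨p, rfl, rfl⟩, ⟨q, rfl, rfl⟩, h3⟩) ?_)
  rintro ⟨⟨α', β'⟩, h'⟩ ⟨⟨p', hp', hp''⟩, ⟨q', hq', hq''⟩, hz⟩
  dsimp only at hp'' hq'' hz h'
  subst hp'' hq''
  refine hO' (hcO ?_)
  simp only [mul_germ]
  refine germ_mem_ofElt.2 ⟨z, ?_, h2, hz⟩
  have : (p'.mul q' h').elt = (p.mul q h).elt := congrArg₂ (· * ·) hp' hq'
  rwa [this]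

end Germ

/-! ### Assembling the ample semigroupoid of germs -/

/-- The graphed semigroupoid of germs. -/
noncomputable def germGraphed (S : SigmaOrd.{u}) : GraphedSemigroupoid.{u} where
  Vert := S.Spectrum
  Arr := S.Germ
  src := Germ.src
  rng := Germ.rng
  mul := Germ.mul
  src_mul α β h := by
    obtain ⟨p, rfl⟩ := Semidirect.germ_surjective α
    obtain ⟨q, rfl⟩ := Semidirect.germ_surjective β
    rw [Germ.mul_germ]
    rfl
  rng_mul α β h := by
    obtain ⟨p, rfl⟩ := Semidirect.germ_surjective α
    obtain ⟨q, rfl⟩ := Semidirect.germ_surjective β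
    rw [Germ.mul_germ]
    exact Semidirect.rng_mul p q h
  mul_assoc α β γ h k := by
    obtain ⟨p, rfl⟩ := Semidirect.germ_surjective α
    obtain ⟨q, rfl⟩ := Semidirect.germ_surjective β
    obtain ⟨r, rfl⟩ := Semidirect.germ_surjective γ
    simp only [Germ.mul_germ]
    refine congrArg Semidirect.germ ?_
    simp only [Semidirect.mul, mul_assoc]
  vert_eq F := by
    obtain ⟨e, he⟩ := F.isProperFilter.nonempty
    exact Or.inl ⟨(⟨e, F, by rwa [sinv_mul_of_idem (Spectrum.idem_of_mem he)]⟩ :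
      S.Semidirect).germ, rfl⟩

/-- Moves the inverse laws from germs to representatives, where `GermEq.inverse_unique` applies. -/
theorem isInverse_germ_iff {p q : S.Semidirect} :
    S.germGraphed.IsInverse p.germ q.germ ↔ p.pt = q.rng ∧ q.pt = p.rng ∧
      GermEq p.pt (p.elt * q.elt * p.elt) p.elt ∧ GermEq q.pt (q.elt * p.elt * q.elt) q.elt := by
  have key : ∀ (p q : S.Semidirect) (h : p.pt = q.rng) (k : q.pt = p.rng)
      (h' : S.germGraphed.src p.germ = S.germGraphed.rng q.germ)
      (k' : S.germGraphed.src (S.germGraphed.mul p.germ q.germ h') = S.germGraphed.rng p.germ),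
      S.germGraphed.mul (S.germGraphed.mul p.germ q.germ h') p.germ k' = p.germ ↔
        GermEq p.pt (p.elt * q.elt * p.elt) p.elt := by
    intro p q h k h' k'
    have e1 : S.germGraphed.mul p.germ q.germ h' = (p.mul q h).germ := Germ.mul_germ p q h
    have e2 : S.germGraphed.mul (S.germGraphed.mul p.germ q.germ h') p.germ k' =
        ((p.mul q h).mul p k).germ :=
      (GraphedSemigroupoid.mul_congr e1 rfl _ (by exact k)).trans
        (Germ.mul_germ (p.mul q h) p k)
    rw [e2]
    exact germ_eq_iff.trans ⟨fun h => h.2, fun h => ⟨rfl, h⟩⟩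
  constructor
  · rintro ⟨h, k, e1, e2⟩
    exact ⟨h, k, (key p q h k _ _).1 e1, (key q p k h _ _).1 e2⟩
  · rintro ⟨h, k, e1, e2⟩
    exact ⟨h, k, (key p q h k _ _).2 e1, (key q p k h _ _).2 e2⟩

theorem isInverse_inv (p : S.Semidirect) : S.germGraphed.IsInverse p.germ p.inv.germ := by
  refine isInverse_germ_iff.2 ⟨p.rng_inv.symm, rfl, ?_, ?_⟩
  · show GermEq _ (p.elt * sinv p.elt * p.elt) _
    rw [mul_sinv_mul]
    exact GermEq.refl p.mem
  · show GermEq _ (sinv p.elt * p.elt * sinv p.elt) (sinv p.elt)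
    rw [sinv_mul_sinv]
    exact GermEq.refl p.inv.mem

/-- The inverse semigroupoid of germs. -/
noncomputable def germInverse (S : SigmaOrd.{u}) : InverseSemigroupoid.{u} where
  toGraphedSemigroupoid := S.germGraphed
  existsUnique_inverse α := by
    obtain ⟨p, rfl⟩ := Semidirect.germ_surjective α
    refine ⟨p.inv.germ, isInverse_inv p, fun β hβ => ?_⟩
    obtain ⟨q, rfl⟩ := Semidirect.germ_surjective β
    obtain ⟨h1, h2, h3, h4⟩ := isInverse_germ_iff.1 hβ
    obtain ⟨k1, k2, k3, k4⟩ := isInverse_germ_iff.1 (isInverse_inv p)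
    refine germ_eq_iff.2 ⟨h2, GermEq.inverse_unique (congrArg Spectrum.carrier h1) ?_
      (congrArg Spectrum.carrier h2) h3 h4 k3 ?_⟩
    · rw [h2]
      exact congrArg Spectrum.carrier k1
    · rw [h2]
      exact k4

theorem star_germ (p : S.Semidirect) : S.germInverse.star p.germ = p.inv.germ :=
  (InverseSemigroupoid.eq_star (S := S.germInverse) (isInverse_inv p)).symm

theorem star_mem_ofElt {γ : S.Germ} {a : S.Carrier} (h : γ ∈ Germ.ofElt a) :
    S.germInverse.star γ ∈ Germ.ofElt (sinv a) := by
  obtain ⟨p, rfl, rfl⟩ := h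
  rw [star_germ]
  exact ⟨p.inv, rfl, rfl⟩

/-- Inversion exchanges the basic sets of `a` and of `a*`. -/
theorem continuous_germ_star : @Continuous S.Germ S.Germ _ _ S.germInverse.star := by
  refine continuous_iff_continuousAt.2 fun γ O hO => ?_
  obtain ⟨O', hO', ho, hx⟩ := mem_nhds_iff.1 hO
  obtain ⟨c, hc, hcO⟩ := Germ.exists_ofElt_subset ho hx
  have h1 := star_mem_ofElt hc
  have h2 : S.germInverse.star (S.germInverse.star γ) = γ :=
    InverseSemigroupoid.star_star (S := S.germInverse) γ
  rw [h2] at h1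
  refine Filter.mem_map.2 (Filter.mem_of_superset ((Germ.isOpen_ofElt _).mem_nhds h1) ?_)
  intro δ hδ
  have := star_mem_ofElt hδ
  rw [sinv_sinv] at this
  exact hO' (hcO this)

/-- The topological inverse semigroupoid of germs. -/
noncomputable def germTop (S : SigmaOrd.{u}) : TopInverseSemigroupoid.{u} :=
  @TopInverseSemigroupoid.mk S.germInverse S.instTopologicalSpaceSpectrum
    S.instTopologicalSpaceGerm Germ.continuous_src Germ.continuous_rng Germ.continuous_mul
    continuous_germ_star

/-- The ample inverse semigroupoid of germs. -/
noncomputable def germs (S : SigmaOrd.{u}) : AmpStar.{u} where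
  toTopInverseSemigroupoid := S.germTop
  etale := Germ.isLocalHomeomorph_src
  locallyCompact := locallyCompactSpace_spectrum S
  hausdorff := t2Space_spectrum S
  zeroDimensional := S.isTopologicalBasis_isClopen_spectrum

/-! ### The compact-open bisections of germs -/

theorem isCompact_ofElt (a : S.Carrier) : IsCompact (Germ.ofElt a) := by
  have h := AmpStar.isCompact_inter_src_preimage (S := S.germs) (Germ.isOpen_ofElt a)
    (Germ.injOn_src_ofElt a) (isCompact_basic (sinv_mul_mem_idem a))
    (Germ.src_image_ofElt a).symm.subset
  have e : Germ.ofElt a ∩ Germ.src ⁻¹' S.basic (sinv a * a) = Germ.ofElt a :=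
    Set.inter_eq_left.2 (Set.image_subset_iff.1 (Germ.src_image_ofElt a).subset)
  exact e ▸ h

/-- The action of `a*` recovers the source of a germ of `a` from its range. -/
theorem injOn_rng_ofElt (a : S.Carrier) : Set.InjOn Germ.rng (Germ.ofElt a) := by
  rintro _ ⟨p, hp, rfl⟩ _ ⟨q, hq, rfl⟩ e
  refine Germ.injOn_src_ofElt a ⟨p, hp, rfl⟩ ⟨q, hq, rfl⟩ ?_
  have e' : conj p.elt p.pt.carrier = conj q.elt q.pt.carrier := congrArg Spectrum.carrier e
  apply Spectrum.ext
  have h1 := conj_sinv_conj p.mem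
  rw [e', hp, ← hq, conj_sinv_conj q.mem] at h1
  exact h1.symm

/-- The compact-open bisection of the germs of an element. -/
def toKB (a : S.Carrier) : S.germs.KB :=
  ⟨Germ.ofElt a, isCompact_ofElt a, Germ.isOpen_ofElt a, Germ.injOn_src_ofElt a,
    injOn_rng_ofElt a⟩

/-- From `(ab)* (ab) ∈ F` it follows that `b` acts on `F` and `a` on the result, so `[ab, F]`
factors into a germ of `a` and a germ of `b`. -/
theorem toKB_mul (a b : S.Carrier) : toKB (a * b) = toKB a * toKB b := by
  refine AmpStar.KB.ext (Set.Subset.antisymm ?_ ?_)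
  · rintro _ ⟨p, hp, rfl⟩
    have hab : sinv b * (sinv a * a) * b ∈ p.pt.carrier := by
      have := p.mem
      rw [hp, InvSemigroup.sinv_mul] at this
      simpa only [mul_assoc] using this
    have hb : sinv b * b ∈ p.pt.carrier := by
      refine Spectrum.mem_of_mul_eq hab (sinv_mul_mem_idem b) ?_
      simp only [mul_assoc, sinv_mul_sinv_assoc]
    let q : S.Semidirect := ⟨b, p.pt, hb⟩
    let r : S.Semidirect := ⟨a, q.rng, sinv_mul_mem_idem a, hab⟩
    refine ⟨r.germ, ⟨r, rfl, rfl⟩, q.germ, ⟨q, rfl, rfl⟩, rfl, ?_⟩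
    refine (Germ.mul_germ r q rfl).trans (germ_eq_iff.2 ⟨rfl, ?_⟩)
    show GermEq p.pt (a * b) p.elt
    rw [hp]
    exact GermEq.refl (hp ▸ p.mem)
  · rintro _ ⟨_, ⟨p, rfl, rfl⟩, _, ⟨q, rfl, rfl⟩, h, rfl⟩
    exact ⟨p.mul q h, rfl, (Germ.mul_germ p q h).symm⟩

theorem ofElt_mono {a b : S.Carrier} (h : S.sub a b) : Germ.ofElt a ⊆ Germ.ofElt b := by
  rintro _ ⟨p, rfl, rfl⟩
  exact Germ.germ_mem_ofElt.2 ⟨p.elt, S.sub_refl _, h, p.mem⟩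

theorem ofElt_of_isSup {A : Set S.Carrier} (hA : A.Finite) {j : S.Carrier}
    (hj : IsSupOf S.sub A j) : Germ.ofElt j = ⋃ a ∈ A, Germ.ofElt a := by
  refine Set.Subset.antisymm ?_ (Set.iUnion₂_subset fun a ha => ofElt_mono (hj.1 a ha))
  rintro _ ⟨p, rfl, rfl⟩
  obtain ⟨a, ha, hp⟩ := exists_mem_of_isSup hA hj p.mem
  exact Set.mem_iUnion₂.2 ⟨a, ha, Germ.germ_mem_ofElt.2 ⟨a, hj.1 a ha, S.sub_refl a, hp⟩⟩

theorem ofElt_inter (a b : S.Carrier) :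
    Germ.ofElt a ∩ Germ.ofElt b = ⋃ z ∈ {z | S.sub z a ∧ S.sub z b}, Germ.ofElt z := by
  refine Set.Subset.antisymm ?_ (Set.iUnion₂_subset fun z hz =>
    Set.subset_inter (ofElt_mono hz.1) (ofElt_mono hz.2))
  rintro _ ⟨⟨p, rfl, rfl⟩, hp⟩
  obtain ⟨z, h1, h2, h3⟩ := Germ.germ_mem_ofElt.1 hp
  exact Set.mem_iUnion₂.2 ⟨z, ⟨h1, h2⟩, Germ.germ_mem_ofElt.2 ⟨z, h1, S.sub_refl z, h3⟩⟩

/-- If `a` and `b` have compactly many germs in common, these are the germs of a lower bound. -/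
theorem exists_ofElt_inter {a b : S.Carrier} (h : IsCompact (Germ.ofElt a ∩ Germ.ofElt b)) :
    ∃ z, S.sub z a ∧ S.sub z b ∧ Germ.ofElt z = Germ.ofElt a ∩ Germ.ofElt b := by
  obtain ⟨t, ht, htf, hsub⟩ := h.elim_finite_subcover_image (b := {z | S.sub z a ∧ S.sub z b})
    (c := Germ.ofElt) (fun z _ => Germ.isOpen_ofElt z) (ofElt_inter a b).subset
  obtain ⟨j, hj⟩ := exists_finite_sup htf fun x hx => (ht hx).1
  have hja := hj.2 a fun x hx => (ht hx).1
  have hjb := hj.2 b fun x hx => (ht hx).2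
  refine ⟨j, hja, hjb, Set.Subset.antisymm
    (Set.subset_inter (ofElt_mono hja) (ofElt_mono hjb)) ?_⟩
  rwa [ofElt_of_isSup htf hj]

/-- A lower bound splits off. -/
theorem exists_compl_of_sub {z b : S.Carrier} (h : S.sub z b) :
    ∃ c, S.sub c b ∧ IsSupOf S.sub {z, c} b ∧ sinv z * z * (sinv c * c) = 0 := by
  obtain ⟨e, he, heb, h0, hs⟩ := exists_compl (sinv_mul_mem_idem z) (sinv_mul_mem_idem b)
    (sub_sinv_mul h)
  have h1 := S.distrib b _ _ _ hs
  rw [mul_sinv_mul', (S.natLE_of_sub _ _ h).eq_right] at h1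
  refine ⟨b * e, h1.1 _ (by simp), h1, ?_⟩
  have h2 : sinv b * b * e = e := (natLE_iff_of_idem he).1 (S.natLE_of_sub _ _ heb)
  rw [InvSemigroup.sinv_mul, sinv_of_idem he, mul_assoc e, ← mul_assoc (sinv b), h2, he, h0]

theorem eq_zero_of_ofElt_eq_empty {a : S.Carrier} (h : Germ.ofElt a = ∅) : a = 0 := by
  refine eq_zero_of_sinv_mul (eq_zero_of_basic_eq_empty (sinv_mul_mem_idem a) ?_)
  rw [← Germ.src_image_ofElt, h, Set.image_empty]

/-- Compactness gives `z ⊆ a, b` with all the germs of `a`. The complement of `z` in `a` then has no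
germs, so it is `0` and `a ⊆ z`. -/
theorem ofElt_subset_iff {a b : S.Carrier} : Germ.ofElt a ⊆ Germ.ofElt b ↔ S.sub a b := by
  refine ⟨fun h => ?_, ofElt_mono⟩
  have hi := Set.inter_eq_left.2 h
  obtain ⟨z, hza, hzb, e⟩ := exists_ofElt_inter (hi ▸ isCompact_ofElt a)
  rw [hi] at e
  obtain ⟨c, hca, hs, h0⟩ := exists_compl_of_sub hza
  have hc : c = 0 := by
    refine eq_zero_of_ofElt_eq_empty (Set.eq_empty_of_forall_notMem ?_)
    rintro _ ⟨p, rfl, rfl⟩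
    have h1 : p.germ ∈ Germ.ofElt z := e ▸ ofElt_mono hca ⟨p, rfl, rfl⟩
    refine p.pt.zero_notMem (h0 ▸ Spectrum.mul_mem ?_ p.mem)
    exact (Germ.germ_mem_ofElt.1 h1).right_mem
  subst hc
  have haz : S.sub a z := hs.2 z (by
    rintro x (rfl | rfl)
    · exact S.sub_refl _
    · exact S.zero_sub _)
  exact S.sub_trans _ _ _ haz hzb

theorem toKB_injective : Function.Injective (toKB (S := S)) := fun a b h => by
  have e : Germ.ofElt a = Germ.ofElt b := congrArg Subtype.val h
  exact S.sub_antisymm _ _ (ofElt_subset_iff.1 e.subset) (ofElt_subset_iff.1 e.symm.subset)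

/-- Elements whose germs together form a bisection have a join. -/
theorem exists_ofElt_union {a b : S.Carrier}
    (h : S.germs.IsBisection (Germ.ofElt a ∪ Germ.ofElt b)) :
    ∃ j, Germ.ofElt j = Germ.ofElt a ∪ Germ.ofElt b := by
  -- Because the source is injective on the union, the common germs are those of `a` over the clopen
  -- set `X[b* b]`.
  have hcomp : IsCompact (Germ.ofElt a ∩ Germ.ofElt b) := by
    have hc : IsClosed (Germ.src ⁻¹' S.basic (sinv b * b)) :=
      (isClopen_basic (sinv_mul_mem_idem b)).1.preimage Germ.continuous_src
    convert (isCompact_ofElt a).inter_right hc using 1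
    ext γ
    refine and_congr_right fun hγ => ?_
    rw [← Germ.src_image_ofElt]
    constructor
    · intro hb
      exact ⟨γ, hb, rfl⟩
    · rintro ⟨δ, hδ, e⟩
      exact h.1 (Or.inr hδ) (Or.inl hγ) e ▸ hδ
  obtain ⟨z, hza, hzb, hz⟩ := exists_ofElt_inter hcomp
  obtain ⟨c, hcb, hs, h0⟩ := exists_compl_of_sub hzb
  have hb : Germ.ofElt b = Germ.ofElt z ∪ Germ.ofElt c := by
    rw [ofElt_of_isSup (Set.toFinite _) hs, Set.biUnion_pair]
  have hdisj : ∀ γ ∈ Germ.ofElt a, γ ∉ Germ.ofElt c := by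
    intro γ h1 h2
    have h3 : γ ∈ Germ.ofElt z := hz ▸ ⟨h1, ofElt_mono hcb h2⟩
    obtain ⟨p, rfl, rfl⟩ := h2
    refine p.pt.zero_notMem (h0 ▸ Spectrum.mul_mem ?_ p.mem)
    exact (Germ.germ_mem_ofElt.1 h3).right_mem
  have hbis : ∀ α ∈ Germ.ofElt a, ∀ β ∈ Germ.ofElt c,
      Germ.src α ≠ Germ.src β ∧ Germ.rng α ≠ Germ.rng β := by
    refine fun α hα β hβ => ⟨fun e => ?_, fun e => ?_⟩
    · exact hdisj α hα (h.1 (Or.inl hα) (Or.inr (ofElt_mono hcb hβ)) e ▸ hβ)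
    · exact hdisj α hα (h.2 (Or.inl hα) (Or.inr (ofElt_mono hcb hβ)) e ▸ hβ)
  -- Orthogonality is read off from germs: `x * y` has no germs when no germ of `x` composes with
  -- one of `y`. Here `c` is the part of `b` away from `a`.
  have hzero : ∀ x y : S.Carrier,
      (∀ α ∈ Germ.ofElt x, ∀ β ∈ Germ.ofElt y, Germ.src α ≠ Germ.rng β) → x * y = 0 := by
    intro x y hxy
    refine eq_zero_of_ofElt_eq_empty ?_
    have : toKB (x * y) = 0 := by
      rw [toKB_mul]
      exact AmpStar.KB.mul_eq_zero.2 hxy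
    exact congrArg Subtype.val this
  have h1 : a * sinv c = 0 := hzero _ _ fun α hα β hβ e => by
    have hs := star_mem_ofElt hβ
    rw [sinv_sinv] at hs
    exact (hbis α hα _ hs).1 (e.trans (InverseSemigroupoid.src_star (S := S.germInverse) β).symm)
  have h2 : sinv a * c = 0 := hzero _ _ fun α hα β hβ e => by
    have hs := star_mem_ofElt hα
    rw [sinv_sinv] at hs
    exact (hbis _ hs β hβ).2 ((InverseSemigroupoid.rng_star (S := S.germInverse) α).trans e)
  obtain ⟨j, hj⟩ := S.orthJoin a c h2 h1
  refine ⟨j, ?_⟩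
  rw [ofElt_of_isSup (Set.toFinite _) hj, Set.biUnion_pair, hb, ← Set.union_assoc,
    Set.union_eq_left.2 (ofElt_mono hza)]

theorem toKB_surjective : Function.Surjective (toKB (S := S)) := by
  intro A
  -- Keeping the union inside `A` makes each partial union a bisection, as binary joins require.
  suffices ∀ t : Set S.Carrier, t.Finite → (⋃ a ∈ t, Germ.ofElt a) ⊆ A.1 →
      ∃ j, Germ.ofElt j = ⋃ a ∈ t, Germ.ofElt a by
    obtain ⟨t, ht, htf, hsub⟩ := A.isCompact.elim_finite_subcover_image
      (b := {a | Germ.ofElt a ⊆ A.1}) (c := Germ.ofElt) (fun a _ => Germ.isOpen_ofElt a)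
      (fun γ hγ => by
        obtain ⟨a, ha, haA⟩ := Germ.exists_ofElt_subset A.isOpen hγ
        exact Set.mem_iUnion₂.2 ⟨a, haA, ha⟩)
    have hsub' : (⋃ a ∈ t, Germ.ofElt a) ⊆ A.1 := Set.iUnion₂_subset fun a ha => ht ha
    obtain ⟨j, hj⟩ := this t htf hsub'
    exact ⟨j, AmpStar.KB.ext (hj.trans (hsub'.antisymm hsub))⟩
  intro t ht
  induction t, ht using Set.Finite.induction_on with
  | empty =>
    refine fun _ => ⟨0, ?_⟩
    rw [Set.biUnion_empty]
    refine Set.eq_empty_of_forall_notMem ?_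
    rintro _ ⟨p, hp, rfl⟩
    have := p.mem
    rw [hp, mul_zero] at this
    exact p.pt.zero_notMem this
  | @insert a t _ _ ih =>
    intro h
    rw [Set.biUnion_insert] at h ⊢
    obtain ⟨j, hj⟩ := ih (Set.subset_union_right.trans h)
    rw [← hj] at h ⊢
    exact exists_ofElt_union (A.isBisection.mono h)

/-! ### Isomorphisms of Σ-ordered inverse semigroups -/

theorem isSupOf_image {T : SigmaOrd.{u}} (f : S.Carrier ≃ T.Carrier)
    (hs : ∀ a b, T.sub (f a) (f b) ↔ S.sub a b) {F : Set S.Carrier} {c : S.Carrier}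
    (h : IsSupOf S.sub F c) : IsSupOf T.sub (f '' F) (f c) := by
  refine ⟨?_, fun d hd => ?_⟩
  · rintro _ ⟨x, hx, rfl⟩
    exact (hs _ _).2 (h.1 x hx)
  · obtain ⟨d, rfl⟩ := f.surjective d
    exact (hs _ _).2 (h.2 d fun x hx => (hs _ _).1 (hd _ ⟨x, hx, rfl⟩))

/-- A multiplicative order isomorphism is a morphism. -/
def Hom.ofEquiv {T : SigmaOrd.{u}} (f : S.Carrier ≃ T.Carrier)
    (hm : ∀ a b, f (a * b) = f a * f b) (hs : ∀ a b, T.sub (f a) (f b) ↔ S.sub a b) :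
    Hom S T :=
  have h0 : f 0 = 0 := sub_zero_eq (by
    obtain ⟨x, hx⟩ := f.surjective 0
    rw [← hx, hs]
    exact S.zero_sub x)
  have hz : ∀ x y, f x * f y = 0 ↔ x * y = 0 := fun x y => by
    rw [← hm, ← h0, f.apply_eq_iff_eq]
  { toFun := f
    map_mul := hm
    map_zero := h0
    mono := fun a b => (hs a b).2
    map_join := fun a b c h => by
      have := isSupOf_image f hs h
      rwa [Set.image_pair] at this
    weakMeet := fun a b t ha hb => by
      obtain ⟨c, rfl⟩ := f.surjective t
      exact ⟨c, (hs _ _).1 ha, (hs _ _).1 hb, T.sub_refl _⟩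
    proper := fun t => by
      obtain ⟨c, rfl⟩ := f.surjective t
      exact ⟨{f c}, Set.finite_singleton _,
        ⟨by rintro _ rfl; exact T.sub_refl _, fun _ hd => hd _ rfl⟩,
        by rintro _ rfl; exact ⟨c, T.sub_refl _⟩⟩
    map_interpolator := fun a b p _ h => by
      have hsinv : f (sinv a) = sinv (f a) :=
        eq_sinv (by rw [← hm, ← hm, mul_sinv_mul]) (by rw [← hm, ← hm, sinv_mul_sinv])
      refine ⟨?_, (hs _ _).2 h.2.1, f.surjective.forall.2 fun x => ?_,
        f.surjective.forall.2 fun x => ?_⟩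
      · unfold NatLE
        rw [← hsinv, ← hm, ← hm]
        exact congrArg f h.1
      · rw [hz, hz]
        exact h.2.2.1 x
      · rw [hz, hz]
        exact h.2.2.2 x }

/-- A multiplicative order isomorphism is an isomorphism. -/
def isoOfEquiv {T : SigmaOrd.{u}} (f : S.Carrier ≃ T.Carrier)
    (hm : ∀ a b, f (a * b) = f a * f b) (hs : ∀ a b, T.sub (f a) (f b) ↔ S.sub a b) :
    S ≅ T where
  hom := Hom.ofEquiv f hm hs
  inv := Hom.ofEquiv f.symm
    (fun a b => f.injective (by rw [hm, f.apply_symm_apply, f.apply_symm_apply,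
      f.apply_symm_apply]))
    (fun a b => by rw [← hs, f.apply_symm_apply, f.apply_symm_apply])
  hom_inv_id := Hom.ext (funext fun a => f.symm_apply_apply a)
  inv_hom_id := Hom.ext (funext fun a => f.apply_symm_apply a)

/-- A Σ-ordered inverse semigroup is that of the compact-open bisections of its germs. -/
noncomputable def isoBisectionsGerms (S : SigmaOrd.{u}) : S ≅ S.germs.bisections :=
  isoOfEquiv (T := S.germs.bisections) (Equiv.ofBijective toKB ⟨toKB_injective, toKB_surjective⟩)
    toKB_mul (fun _ _ => ofElt_subset_iff)

end SigmaOrd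

/-! ### The duality -/

namespace SigmaOrd

open AmpStar

/-- The canonical isomorphism with the bisections of the germs. -/
noncomputable def isoBisectionFunctor (S : SigmaOrd.{u}) :
    S ≅ bisectionFunctor.obj (op S.germs) := S.isoBisectionsGerms

/-- The functor of germs. -/
noncomputable def germFunctor : SigmaOrd.{u} ⥤ AmpStar.{u}ᵒᵖ where
  obj S := op S.germs
  -- Conjugation of `θ` by the canonical isomorphisms is a morphism of bisections, hence comes from
  -- a unique homomorphism of germs.
  map {S T} θ := fullyFaithfulBisectionFunctor.preimage
    (S.isoBisectionFunctor.inv ≫ θ ≫ T.isoBisectionFunctor.hom)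
  map_id S := fullyFaithfulBisectionFunctor.map_injective (by simp)
  map_comp f g := fullyFaithfulBisectionFunctor.map_injective (by simp)

/-- The canonical isomorphism with the bisections of the germs, for the functor of germs. -/
noncomputable def isoGermFunctor (S : SigmaOrd.{u}) :
    S ≅ bisectionFunctor.obj (germFunctor.obj S) := S.isoBisectionsGerms

theorem map_germFunctor_map {S T : SigmaOrd.{u}} (θ : S ⟶ T) :
    bisectionFunctor.map (germFunctor.map θ) =
      S.isoGermFunctor.inv ≫ θ ≫ T.isoGermFunctor.hom :=
  fullyFaithfulBisectionFunctor.map_preimage _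

/-- The duality between ample inverse semigroupoids and Σ-ordered inverse semigroups. -/
noncomputable def stoneDuality : AmpStar.{u}ᵒᵖ ≌ SigmaOrd.{u} :=
  CategoryTheory.Equivalence.mk bisectionFunctor germFunctor
    -- The unit is the lift, through full faithfulness, of the isomorphism between the bisections of
    -- an object and those of their germs.
    (NatIso.ofComponents
      (fun X => fullyFaithfulBisectionFunctor.preimageIso
        (bisectionFunctor.obj X).isoGermFunctor)
      (fun f => fullyFaithfulBisectionFunctor.map_injective (by simp [map_germFunctor_map, Functor.FullyFaithful.preimageIso])))
    (NatIso.ofComponents (fun S => S.isoGermFunctor.symm)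
      (fun f => by simp [map_germFunctor_map]))

/-! ### Explicit form of the germ functor on morphisms -/

/-- The homomorphism of germs induced by a morphism. -/
noncomputable def germMap {S T : SigmaOrd.{u}} (θ : S ⟶ T) : AmpStar.Hom T.germs S.germs :=
  (germFunctor.map θ).unop

/-- The naturality of the canonical isomorphism, evaluated at `s`; it is the only information about
`germMap` on bisections that the formula needs. -/
theorem germMap_mem_ofElt {S T : SigmaOrd.{u}} (θ : S ⟶ T) {γ : T.Germ} {s : S.Carrier} :
    (germMap θ).toFun γ ∈ Germ.ofElt s ↔ γ ∈ Germ.ofElt (Hom.toFun θ s) := by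
  have h : S.isoGermFunctor.hom ≫ bisectionFunctor.map (germFunctor.map θ) =
      θ ≫ T.isoGermFunctor.hom :=
    (Iso.eq_inv_comp _).1 (map_germFunctor_map θ)
  have h1 : (germMap θ).preimage (toKB s) = toKB (Hom.toFun θ s) :=
    congrFun (congrArg Hom.toFun h) s
  have h2 : (germMap θ).toFun ⁻¹' Germ.ofElt s = Germ.ofElt (Hom.toFun θ s) :=
    congrArg Subtype.val h1
  rw [← h2]
  exact Iff.rfl

/-- If `f` is in the source of the image, star-surjectivity lifts the germ of `f` there to a germ of
`θ f` with the source of `γ`. Conversely the germ of `θ f` at that source maps to a germ of `f`. -/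
theorem mem_src_germMap {S T : SigmaOrd.{u}} (θ : S ⟶ T) (γ : T.Germ) {f : S.Carrier}
    (hf : f ∈ S.idem) :
    f ∈ (Germ.src ((germMap θ).toFun γ)).carrier ↔ Hom.toFun θ f ∈ (Germ.src γ).carrier := by
  have hθf : Hom.toFun θ f * Hom.toFun θ f = Hom.toFun θ f := by
    rw [← Hom.map_mul, show f * f = f from hf]
  constructor
  · intro h
    let p : S.Semidirect := ⟨f, Germ.src ((germMap θ).toFun γ), by rwa [sinv_mul_of_idem hf]⟩
    obtain ⟨β, hβ, e⟩ := (germMap θ).starSurjective p.germ γ rfl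
    have h1 : (germMap θ).toFun β ∈ Germ.ofElt f := ⟨p, rfl, e.symm⟩
    obtain ⟨q, hq, rfl⟩ := (germMap_mem_ofElt θ).1 h1
    have h2 := q.mem
    rw [hq, sinv_mul_of_idem hθf] at h2
    have h3 : q.pt = Germ.src γ := hβ
    exact h3 ▸ h2
  · intro h
    let q : T.Semidirect := ⟨Hom.toFun θ f, Germ.src γ, by rwa [sinv_mul_of_idem hθf]⟩
    obtain ⟨p, hp, e⟩ := (germMap_mem_ofElt θ).2 (⟨q, rfl, rfl⟩ : q.germ ∈ Germ.ofElt _)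
    have h2 := p.mem
    rw [hp, sinv_mul_of_idem hf] at h2
    have h3 : p.pt = Germ.src ((germMap θ).toFun q.germ) := by
      rw [← Germ.src_germ, e]
    have h4 : Germ.src ((germMap θ).toFun q.germ) = Germ.src ((germMap θ).toFun γ) :=
      (germMap θ).src_eq (a := q.germ) (b := γ) rfl
    rw [h3, h4] at h2
    exact h2

/-- The source of the image of a germ is given by the map of spectra. -/
theorem src_germMap {S T : SigmaOrd.{u}} (θ : S ⟶ T) (γ : T.Germ) :
    (Germ.src ((germMap θ).toFun γ)).carrier = specMap θ (Germ.src γ).carrier := by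
  ext e
  constructor
  · intro he
    have hei := Spectrum.idem_of_mem he
    exact ⟨hei, fun f hf hf' => (Spectrum.mem_iff hei).1 he f ((mem_src_germMap θ γ hf).2 hf')⟩
  · rintro ⟨hei, h⟩
    exact (Spectrum.mem_iff hei).2 fun f hf => h f (Spectrum.idem_of_mem hf)
      ((mem_src_germMap θ γ (Spectrum.idem_of_mem hf)).1 hf)

theorem exists_represents {S T : SigmaOrd.{u}} (θ : S ⟶ T) (q : T.Semidirect) :
    ∃ p : S.Semidirect, Represents θ q p := by
  obtain ⟨p, hp⟩ := Semidirect.germ_surjective ((germMap θ).toFun q.germ)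
  have h := src_germMap θ q.germ
  rw [← hp] at h
  obtain ⟨q', h1, h2⟩ := (germMap_mem_ofElt θ).1 
    (⟨p, rfl, hp⟩ : (germMap θ).toFun q.germ ∈ Germ.ofElt p.elt)
  exact ⟨p, h, q', h1, (germ_eq_iff.1 h2).1, h2⟩

/-- Both are germs of the same element with the same source, so the choice of representative is
immaterial. -/
theorem germMap_eq_of_represents {S T : SigmaOrd.{u}} {θ : S ⟶ T} {q : T.Semidirect}
    {p : S.Semidirect} (h : Represents θ q p) : (germMap θ).toFun q.germ = p.germ := by
  obtain ⟨h1, q', h2, -, h4⟩ := h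
  have h5 : (germMap θ).toFun q.germ ∈ Germ.ofElt p.elt :=
    (germMap_mem_ofElt θ).2 ⟨q', h2, h4⟩
  exact Germ.injOn_src_ofElt p.elt h5 ⟨p, rfl, rfl⟩
    (Spectrum.ext ((src_germMap θ q.germ).trans h1.symm))

theorem isGermFunctor_germFunctor : IsGermFunctor germFunctor.{u}.leftOp :=
  ⟨fun S => Homeomorph.refl S.Spectrum, fun S => Homeomorph.refl S.Germ,
    fun _ _ => rfl, fun _ p => (munnHat_eq p.elt p.pt).symm,
    fun _ p q h => ⟨p.mul q h, rfl, rfl, Germ.mul_germ p q h⟩,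
    fun _ _ θ q => ⟨exists_represents θ q, fun _ h => germMap_eq_of_represents h⟩⟩

end SigmaOrd

theorem mainTheorem1 :
    ∃ D : AmpStar.{u}ᵒᵖ ≌ SigmaOrd.{u},
      IsBisectionFunctor D.functor ∧ IsGermFunctor D.inverse.leftOp := by
  exact ⟨SigmaOrd.stoneDuality, AmpStar.isBisectionFunctor_bisectionFunctor,
    SigmaOrd.isGermFunctor_germFunctor⟩
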